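/- Let $m,n\in\mathbb N$ and $\ell:=\min\{m,n\}$. The singular values of a complex $m\times n$ matrix $M$ are the $\ell$ largest non-negative square roots $\sigma^\downarrow_1(M)\ge\dots\ge\sigma^\downarrow_\ell(M)\ge 0$ of the eigenvalues of $M^*M$ (with multiplicities); a system of singular values of a family $A(\cdot)$ of such matrices is a map $\sigma=(\sigma_1,\dots,\sigma_\ell)$ on the parameter set such that, for each parameter $t$, $\sigma(t)$ and $(\sigma^\downarrow_1(A(t)),\dots,\sigma^\downarrow_\ell(A(t)))$ coincide as unordered $\ell$-tuples. A real function on a convex set is difference-convex ($DC$) if it is the difference of two continuous convex functions there; it is locally $DC$ if each point of its domain has a convex neighbourhood in the domain on which it is $DC$. For vector- and complex-matrix-valued maps, $DC$ refers to every real component (real and imaginary parts of the entries). $W^{2,1}$ denotes the integrable functions whose first and second weak derivatives are integrable, with norm $\|f\|_{L^1}+\|f'\|_{L^1}+\|f''\|_{L^1}$. **Theorem.** (1) Let $A:\mathbb R\to\mathbb C^{m\times n}$ be a curve of class $C^1\cap DC\cap W^{2,1}_{\mathrm{loc}}$ with $\operatorname{rank}A(t)=\ell$ for all $t\in\mathbb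 R$. Then there exists a system $\sigma=(\sigma_1,\dots,\sigma_\ell)$ of the singular values of $A$ with $\sigma\in C^1(\mathbb R,\mathbb R^\ell)\cap DC(\mathbb R,\mathbb R^\ell)\cap W^{2,1}_{\mathrm{loc}}(\mathbb R,\mathbb R^\ell)$. (2) The result is uniform in the following sense. Let $k\ge 0$, let $I\subseteq\mathbb R$ be a non-empty bounded open interval, let $U$ be an open neighbourhood of $\overline I^{\,1+k}$ in $\mathbb R^{1+k}$, and let $A:U\to\mathbb C^{m\times n}$ be locally $DC$ on $U$ such that $A(\cdot,r)\in C^1(\overline I,\mathbb C^{m\times n})\cap W^{2,1}(I,\mathbb C^{m\times n})$ for all $r\in\overline I^{\,k}$ and $\operatorname{rank}A(t,r)=\ell$ for all $(t,r)\in\overline I\times\overline I^{\,k}$. Assume that for each $r\in\overline I^{\,k}$ a system $\sigma(\cdot,r)\in C^1(\overline I,\mathbb R^\ell)$ of the singular values of $A(\cdot,r)$ on $\overline I$ is fixed. Then the family $\sigma(\cdot,r)$, $r\in\overline I^{\,k}$, is bounded in $C^1(\overline I,\mathbb R^\ell)$, and there is a non-negative $L^1$-function $\mu:I^k\to\mathbb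 R_{\ge0}$ such that $$\|\sigma(\cdot,r)\|_{W^{2,1}(I,\mathbb R^\ell)}\le \mu(r)\quad\text{for a.e. } r\in I^k.$$ -/

import Mathlib

open Set MeasureTheory Topology
open scoped ENNReal ContDiff

/-- `f` is difference-convex on `U`: a difference of two continuous convex functions on `U`
(convexity of the set `U` is part of `ConvexOn`). -/
def IsDCOn {E : Type*} [AddCommGroup E] [Module ℝ E] [TopologicalSpace E]
    (U : Set E) (f : E → ℝ) : Prop :=
  ∃ g h : E → ℝ, ConvexOn ℝ U g ∧ ContinuousOn g U ∧ ConvexOn ℝ U h ∧ ContinuousOn h U ∧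
    ∀ x ∈ U, f x = g x - h x

/-- `f` is locally difference-convex on `U`: every point of `U` has a convex neighbourhood in `U`
on which `f` is difference-convex. -/
def IsLocallyDCOn {E : Type*} [AddCommGroup E] [Module ℝ E] [TopologicalSpace E]
    (U : Set E) (f : E → ℝ) : Prop :=
  ∀ x ∈ U, ∃ V ∈ 𝓝[U] x, V ⊆ U ∧ IsDCOn V f

/-- `g` is the weak derivative of `f` on the open set `Ω ⊆ ℝ`, both being locally integrable. -/
structure IsWeakDerivOn {E : Type*} [NormedAddCommGroup E] [NormedSpace ℝ E]
    (Ω : Set ℝ) (f g : ℝ → E) : Prop where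
  locallyIntegrableOn : LocallyIntegrableOn f Ω
  locallyIntegrableOn_deriv : LocallyIntegrableOn g Ω
  integral_eq : ∀ φ : ℝ → ℝ, ContDiff ℝ ∞ φ → HasCompactSupport φ → tsupport φ ⊆ Ω →
    ∫ x in Ω, deriv φ x • f x = - ∫ x in Ω, φ x • g x

/-- The local Sobolev class `W^{2,1}_loc(Ω)`, for `Ω ⊆ ℝ` open. -/
def MemW21Loc {E : Type*} [NormedAddCommGroup E] [NormedSpace ℝ E]
    (Ω : Set ℝ) (f : ℝ → E) : Prop :=
  ∃ g h : ℝ → E, IsWeakDerivOn Ω f g ∧ IsWeakDerivOn Ω g h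

/-- The Sobolev class `W^{2,1}(Ω)`, for `Ω ⊆ ℝ` open: `f` and its first and second weak
derivatives are integrable on `Ω`. -/
def MemW21 {E : Type*} [NormedAddCommGroup E] [NormedSpace ℝ E]
    (Ω : Set ℝ) (f : ℝ → E) : Prop :=
  ∃ g h : ℝ → E, IsWeakDerivOn Ω f g ∧ IsWeakDerivOn Ω g h ∧
    IntegrableOn f Ω ∧ IntegrableOn g Ω ∧ IntegrableOn h Ω

/-- The `W^{2,1}(Ω)`-norm `‖f‖₁ + ‖f'‖₁ + ‖f''‖₁` with weak derivatives `f'`, `f''`. As these are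
unique almost everywhere, the infimum is over equal values; it is `∞` if they do not exist. -/
noncomputable def w21Norm {E : Type*} [NormedAddCommGroup E] [NormedSpace ℝ E]
    (Ω : Set ℝ) (f : ℝ → E) : ℝ≥0∞ :=
  ⨅ (g : ℝ → E) (h : ℝ → E) (_ : IsWeakDerivOn Ω f g) (_ : IsWeakDerivOn Ω g h),
    (∫⁻ x in Ω, ‖f x‖ₑ) + (∫⁻ x in Ω, ‖g x‖ₑ) + (∫⁻ x in Ω, ‖h x‖ₑ)

/-- `s` lists the `min m n` largest singular values of `M` (square roots of eigenvalues of
`Mᴴ * M`), with multiplicities and in any order. Mathlib's `LinearMap.singularValues` is the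
decreasing enumeration, indexed from `0`. -/
def IsSingularValueTuple {m n : ℕ} (M : Matrix (Fin m) (Fin n) ℂ)
    (s : EuclideanSpace ℝ (Fin (min m n))) : Prop :=
  ∃ π : Equiv.Perm (Fin (min m n)), ∀ j, s j = (Matrix.toEuclideanLin M).singularValues (π j)

/-! ### Sorted eigenvalues of Hermitian matrices and Ky Fan's inequality -/

open scoped InnerProductSpace

/-- The eigenvalues of a Hermitian matrix in decreasing order. -/
noncomputable def sortedEig {n : ℕ} (H : Matrix (Fin n) (Fin n) ℂ) (k : Fin n) : ℝ :=
  open Classical in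
  if h : H.IsHermitian then
    (Matrix.isSymmetric_toEuclideanLin_iff.mpr h).eigenvalues finrank_euclideanSpace_fin k
  else 0

/-- The quadratic form of a matrix. -/
noncomputable def quadForm {n : ℕ} (H : Matrix (Fin n) (Fin n) ℂ)
    (v : EuclideanSpace ℂ (Fin n)) : ℝ :=
  (⟪v, Matrix.toEuclideanLin H v⟫_ℂ).re

/-- The sum of the moduli of the entries of a matrix. -/
noncomputable def entrySum {m n : ℕ} (M : Matrix (Fin m) (Fin n) ℂ) : ℝ :=
  ∑ i, ∑ j, ‖M i j‖

/-- The sum of the `k` largest eigenvalues. -/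
noncomputable def topEigSum {n : ℕ} (H : Matrix (Fin n) (Fin n) ℂ) (k : ℕ) : ℝ :=
  ∑ j : Fin n with j.val < k, sortedEig H j

section Eigenvalues

variable {n : ℕ} {H K : Matrix (Fin n) (Fin n) ℂ}

lemma sortedEig_antitone (H : Matrix (Fin n) (Fin n) ℂ) : Antitone (sortedEig H) := by
  by_cases h : H.IsHermitian
  · have : sortedEig H = (Matrix.isSymmetric_toEuclideanLin_iff.mpr h).eigenvalues
        finrank_euclideanSpace_fin := by
      funext k; simp [sortedEig, h]
    rw [this]
    exact LinearMap.IsSymmetric.eigenvalues_antitone _ _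
  · have : sortedEig H = fun _ => 0 := by funext k; simp [sortedEig, h]
    rw [this]
    exact antitone_const

lemma exists_eigenbasis (hH : H.IsHermitian) :
    ∃ b : OrthonormalBasis (Fin n) ℂ (EuclideanSpace ℂ (Fin n)),
      ∀ k, Matrix.toEuclideanLin H (b k) = (sortedEig H k : ℂ) • b k := by
  refine ⟨(Matrix.isSymmetric_toEuclideanLin_iff.mpr hH).eigenvectorBasis
    finrank_euclideanSpace_fin, fun k => ?_⟩
  rw [LinearMap.IsSymmetric.apply_eigenvectorBasis]
  simp [sortedEig, hH]

lemma topEigSum_succ (H : Matrix (Fin n) (Fin n) ℂ) (k : Fin n) :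
    topEigSum H (k + 1) = topEigSum H k + sortedEig H k := by
  unfold topEigSum
  have : (Finset.univ.filter fun j : Fin n => j.val < k + 1)
      = insert k (Finset.univ.filter fun j : Fin n => j.val < k) := by
    ext j
    simp only [Finset.mem_filter, Finset.mem_univ, true_and, Finset.mem_insert, Fin.ext_iff]
    omega
  rw [this, Finset.sum_insert (by simp), add_comm]

lemma entrySum_nonneg {m : ℕ} (M : Matrix (Fin m) (Fin n) ℂ) : 0 ≤ entrySum M := by
  unfold entrySum; positivity

lemma norm_le_entrySum {m : ℕ} (M : Matrix (Fin m) (Fin n) ℂ) (i : Fin m) (j : Fin n) :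
    ‖M i j‖ ≤ entrySum M := by
  refine le_trans ?_ (Finset.single_le_sum (f := fun i => ∑ j, ‖M i j‖)
    (fun i _ => by positivity) (Finset.mem_univ i))
  exact Finset.single_le_sum (f := fun j => ‖M i j‖) (fun j _ => norm_nonneg _)
    (Finset.mem_univ j)

lemma quadForm_sub (H K : Matrix (Fin n) (Fin n) ℂ) (v : EuclideanSpace ℂ (Fin n)) :
    quadForm (H - K) v = quadForm H v - quadForm K v := by
  simp [quadForm]

lemma quadForm_smul (c : ℝ) (H : Matrix (Fin n) (Fin n) ℂ) (v : EuclideanSpace ℂ (Fin n)) :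
    quadForm (c • H) v = c * quadForm H v := by
  have : (c • H) = (c : ℂ) • H := by ext i j; simp
  rw [this, quadForm, map_smul, LinearMap.smul_apply, inner_smul_right, Complex.re_ofReal_mul]
  rfl

lemma abs_quadForm_le (H : Matrix (Fin n) (Fin n) ℂ) {v : EuclideanSpace ℂ (Fin n)}
    (hv : ‖v‖ = 1) : |quadForm H v| ≤ entrySum H := by
  have h1 : ∀ i, ‖v i‖ ≤ 1 := fun i => hv ▸ PiLp.norm_apply_le v i
  have : ⟪v, Matrix.toEuclideanLin H v⟫_ℂ
      = ∑ i, ∑ j, (H i j * v j) * (starRingEnd ℂ) (v i) := by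
    simp [PiLp.inner_apply, Matrix.mulVec, dotProduct, Finset.sum_mul,
      Matrix.toLpLin_apply]
  rw [quadForm, this]
  refine (Complex.abs_re_le_norm _).trans ((norm_sum_le _ _).trans ?_)
  refine Finset.sum_le_sum fun i _ => (norm_sum_le _ _).trans (Finset.sum_le_sum fun j _ => ?_)
  rw [norm_mul, norm_mul, RCLike.norm_conj]
  calc ‖H i j‖ * ‖v j‖ * ‖v i‖ ≤ ‖H i j‖ * 1 * 1 := by gcongr <;> exact h1 _
    _ = _ := by ring

lemma quadForm_eq_sum (hH : H.IsHermitian)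
    {b : OrthonormalBasis (Fin n) ℂ (EuclideanSpace ℂ (Fin n))}
    (hb : ∀ k, Matrix.toEuclideanLin H (b k) = (sortedEig H k : ℂ) • b k)
    (v : EuclideanSpace ℂ (Fin n)) :
    quadForm H v = ∑ l, sortedEig H l * ‖⟪b l, v⟫_ℂ‖ ^ 2 := by
  have hs := Matrix.isSymmetric_toEuclideanLin_iff.mpr hH
  have : ⟪v, Matrix.toEuclideanLin H v⟫_ℂ
      = ∑ l, ((sortedEig H l * ‖⟪b l, v⟫_ℂ‖ ^ 2 : ℝ) : ℂ) := by
    rw [← b.sum_inner_mul_inner]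
    refine Finset.sum_congr rfl fun l _ => ?_
    rw [← hs, hb, inner_smul_left, Complex.conj_ofReal, ← inner_conj_symm v (b l)]
    push_cast
    rw [mul_left_comm, mul_comm (starRingEnd ℂ _), RCLike.mul_conj]
    rfl
  rw [quadForm, this, ← Complex.ofReal_sum, Complex.ofReal_re]

lemma sum_mul_le_sum_filter_of_antitone {f p : Fin n → ℝ} (hf : Antitone f) (k : ℕ)
    (hp0 : ∀ l, 0 ≤ p l) (hp1 : ∀ l, p l ≤ 1)
    (hp : ∑ l, p l = ((Finset.univ.filter fun j : Fin n => j.val < k).card : ℝ)) :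
    ∑ l, f l * p l ≤ ∑ l : Fin n with l.val < k, f l := by
  classical
  obtain ⟨c, hc1, hc2⟩ : ∃ c : ℝ, (∀ l : Fin n, l.val < k → c ≤ f l) ∧
      (∀ l : Fin n, k ≤ l.val → f l ≤ c) := by
    by_cases hk : k < n
    · exact ⟨f ⟨k, hk⟩, fun l hl => hf (Fin.le_def.2 hl.le), fun l hl => hf (Fin.le_def.2 hl)⟩
    · rcases n with _ | n
      · exact ⟨0, fun l => l.elim0, fun l => l.elim0⟩
      · exact ⟨f (Fin.last n), fun l _ => hf (Fin.le_last l),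
          fun l hl => absurd l.isLt (by omega)⟩
  have h1 : ∑ l, (f l - c) * ((if l.val < k then 1 else 0) - p l) ≥ 0 := by
    refine Finset.sum_nonneg fun l _ => ?_
    split_ifs with hl
    · exact mul_nonneg (by linarith [hc1 l hl]) (by linarith [hp1 l])
    · have := hc2 l (not_lt.1 hl)
      nlinarith [hp0 l]
  have h2 : ∑ l : Fin n, (if l.val < k then (1 : ℝ) else 0) = ∑ l, p l := by
    rw [hp, Finset.sum_ite]; simp
  have h3 : ∑ l, (f l - c) * ((if l.val < k then 1 else 0) - p l)
      = ∑ l : Fin n with l.val < k, f l - ∑ l, f l * p l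
        - c * (∑ l : Fin n, (if l.val < k then (1 : ℝ) else 0) - ∑ l, p l) := by
    rw [Finset.sum_filter, ← Finset.sum_sub_distrib, ← Finset.sum_sub_distrib, Finset.mul_sum,
      ← Finset.sum_sub_distrib]
    refine Finset.sum_congr rfl fun l _ => ?_
    split_ifs <;> ring
  rw [h3, h2] at h1
  linarith

/-- **Ky Fan's inequality**. -/
lemma sum_quadForm_le_topEigSum (hH : H.IsHermitian)
    (e : OrthonormalBasis (Fin n) ℂ (EuclideanSpace ℂ (Fin n))) (k : ℕ) :
    ∑ j : Fin n with j.val < k, quadForm H (e j) ≤ topEigSum H k := by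
  obtain ⟨b, hb⟩ := exists_eigenbasis hH
  simp_rw [quadForm_eq_sum hH hb]
  rw [Finset.sum_comm]
  simp_rw [← Finset.mul_sum]
  refine sum_mul_le_sum_filter_of_antitone (sortedEig_antitone H) k (fun l => by positivity)
    (fun l => ?_) ?_
  · calc ∑ j : Fin n with j.val < k, ‖⟪b l, e j⟫_ℂ‖ ^ 2
        ≤ ∑ j, ‖⟪b l, e j⟫_ℂ‖ ^ 2 :=
          Finset.sum_le_sum_of_subset_of_nonneg (Finset.filter_subset _ _)
            (fun _ _ _ => by positivity)
      _ = 1 := by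
          rw [e.sum_sq_norm_inner_left, b.norm_eq_one, one_pow]
  · rw [Finset.sum_comm]
    simp_rw [b.sum_sq_norm_inner_right, e.norm_eq_one]
    simp

lemma topEigSum_eq_sum_quadForm
    {b : OrthonormalBasis (Fin n) ℂ (EuclideanSpace ℂ (Fin n))}
    (hb : ∀ k, Matrix.toEuclideanLin H (b k) = (sortedEig H k : ℂ) • b k) (k : ℕ) :
    topEigSum H k = ∑ j : Fin n with j.val < k, quadForm H (b j) := by
  refine Finset.sum_congr rfl fun j _ => ?_
  rw [quadForm, hb, inner_smul_right, inner_self_eq_norm_sq_to_K, b.norm_eq_one]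
  simp

lemma topEigSum_sub_le (hH : H.IsHermitian) (hK : K.IsHermitian) (k : ℕ) :
    topEigSum H k - topEigSum K k ≤ n * entrySum (H - K) := by
  obtain ⟨b, hb⟩ := exists_eigenbasis hH
  have h1 := sum_quadForm_le_topEigSum hK b k
  have h2 := topEigSum_eq_sum_quadForm hb k
  have h3 : ∑ j : Fin n with j.val < k, quadForm H (b j)
      - ∑ j : Fin n with j.val < k, quadForm K (b j) ≤ n * entrySum (H - K) := by
    rw [← Finset.sum_sub_distrib]
    calc ∑ j : Fin n with j.val < k, (quadForm H (b j) - quadForm K (b j))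
        ≤ ∑ j : Fin n with j.val < k, entrySum (H - K) := by
          refine Finset.sum_le_sum fun j _ => ?_
          rw [← quadForm_sub]
          exact (le_abs_self _).trans (abs_quadForm_le _ (b.norm_eq_one j))
      _ ≤ ∑ j : Fin n, entrySum (H - K) :=
          Finset.sum_le_sum_of_subset_of_nonneg (Finset.filter_subset _ _)
            (fun _ _ _ => entrySum_nonneg _)
      _ = _ := by simp
  linarith

lemma entrySum_sub_comm {m : ℕ} (M N : Matrix (Fin m) (Fin n) ℂ) :
    entrySum (M - N) = entrySum (N - M) := by
  simp only [entrySum, Matrix.sub_apply]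
  refine Finset.sum_congr rfl fun i _ => Finset.sum_congr rfl fun j _ => norm_sub_rev _ _

lemma abs_topEigSum_sub_le (hH : H.IsHermitian) (hK : K.IsHermitian) (k : ℕ) :
    |topEigSum H k - topEigSum K k| ≤ n * entrySum (H - K) := by
  rw [abs_le]
  have h1 := topEigSum_sub_le hH hK k
  have h2 := topEigSum_sub_le hK hH k
  rw [entrySum_sub_comm] at h2
  constructor <;> linarith

lemma sortedEig_eq_sub (H : Matrix (Fin n) (Fin n) ℂ) (k : Fin n) :
    sortedEig H k = topEigSum H (k + 1) - topEigSum H k := by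
  rw [topEigSum_succ]; ring

lemma continuousOn_topEigSum {X : Type*} [TopologicalSpace X] {s : Set X}
    {F : X → Matrix (Fin n) (Fin n) ℂ} (hF : ∀ i j, ContinuousOn (fun x => F x i j) s)
    (hH : ∀ x ∈ s, (F x).IsHermitian) (k : ℕ) :
    ContinuousOn (fun x => topEigSum (F x) k) s := by
  intro x hx
  have h1 : Filter.Tendsto (fun y => (n : ℝ) * entrySum (F y - F x)) (𝓝[s] x) (𝓝 0) := by
    have : ContinuousWithinAt (fun y => (n : ℝ) * entrySum (F y - F x)) s x := by
      unfold entrySum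
      refine ContinuousWithinAt.mul continuousWithinAt_const ?_
      refine tendsto_finsetSum _ fun i _ => tendsto_finsetSum _ fun j _ => ?_
      exact ((hF i j x hx).sub continuousWithinAt_const).norm
    have h0 : (n : ℝ) * entrySum (F x - F x) = 0 := by simp [entrySum]
    rw [← h0]
    exact this
  refine tendsto_iff_norm_sub_tendsto_zero.2 (squeeze_zero' (by simp) ?_ h1)
  filter_upwards [self_mem_nhdsWithin] with y hy
  exact abs_topEigSum_sub_le (hH y hy) (hH x hx) k

lemma continuousOn_sortedEig {X : Type*} [TopologicalSpace X] {s : Set X}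
    {F : X → Matrix (Fin n) (Fin n) ℂ} (hF : ∀ i j, ContinuousOn (fun x => F x i j) s)
    (hH : ∀ x ∈ s, (F x).IsHermitian) (k : Fin n) :
    ContinuousOn (fun x => sortedEig (F x) k) s := by
  simp_rw [sortedEig_eq_sub]
  exact (continuousOn_topEigSum hF hH _).sub (continuousOn_topEigSum hF hH _)

/-- Traces of powers are power sums of eigenvalues. -/
lemma trace_pow_eq_sum (hH : H.IsHermitian) (q : ℕ) :
    (H ^ q).trace = ∑ k, ((sortedEig H k : ℂ)) ^ q := by
  obtain ⟨b, hb⟩ := exists_eigenbasis hH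
  have h1 : (H ^ q).trace = LinearMap.trace ℂ _ ((Matrix.toEuclideanLin H) ^ q) := by
    have : (Matrix.toEuclideanLin H) ^ q = Matrix.toEuclideanLin (H ^ q) := by
      induction q with
      | zero => simp [Module.End.one_eq_id]
      | succ q ih =>
        rw [pow_succ, ih, pow_succ]
        ext v : 1
        simp [Matrix.toLpLin_apply]
    rw [this, Matrix.toEuclideanLin, Matrix.toLpLin_eq_toLin, Matrix.trace_toLin_eq]
  have h2 : ∀ k, ((Matrix.toEuclideanLin H) ^ q) (b k) = ((sortedEig H k : ℂ)) ^ q • b k := by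
    intro k
    clear h1
    induction q with
    | zero => simp
    | succ q ih =>
      rw [pow_succ, Module.End.mul_apply, hb, map_smul, ih, smul_smul, pow_succ, mul_comm]
  rw [h1, LinearMap.trace_eq_sum_inner _ b]
  refine Finset.sum_congr rfl fun k _ => ?_
  rw [h2, inner_smul_right, inner_self_eq_norm_sq_to_K, b.norm_eq_one]
  simp

/-- The characteristic determinant of a Hermitian matrix factors over its eigenvalues. -/
lemma det_sub_smul_one (hH : H.IsHermitian) (z : ℂ) :
    (H - z • (1 : Matrix (Fin n) (Fin n) ℂ)).det = ∏ k, ((sortedEig H k : ℂ) - z) := by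
  obtain ⟨b, hb⟩ := exists_eigenbasis hH
  have h1 : (H - z • (1 : Matrix (Fin n) (Fin n) ℂ)).det
      = LinearMap.det (Matrix.toEuclideanLin (H - z • (1 : Matrix (Fin n) (Fin n) ℂ))) := by
    rw [Matrix.toEuclideanLin, Matrix.toLpLin_eq_toLin, LinearMap.det_toLin]
  rw [h1, ← LinearMap.det_toMatrix b.toBasis]
  have : LinearMap.toMatrix b.toBasis b.toBasis
      (Matrix.toEuclideanLin (H - z • (1 : Matrix (Fin n) (Fin n) ℂ)))
      = Matrix.diagonal fun k => (sortedEig H k : ℂ) - z := by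
    ext i j
    have hz : Matrix.toEuclideanLin (H - z • (1 : Matrix (Fin n) (Fin n) ℂ)) (b j)
        = ((sortedEig H j : ℂ) - z) • b j := by
      rw [map_sub, map_smul, LinearMap.sub_apply, hb, sub_smul]
      simp
    rw [LinearMap.toMatrix_apply, b.coe_toBasis, hz]
    by_cases hij : i = j
    · subst hij; simp
    · simp [b.repr_self, hij]
  rw [this, Matrix.det_diagonal]

end Eigenvalues

/-! ### Absolute continuity via reparametrization by a dominating monotone function -/

section Reparam

open Filter

/-- The generalized inverse of `t ↦ t + V t`. -/
noncomputable def reparam (V : ℝ → ℝ) (x : ℝ) : ℝ := sSup {t | t + V t ≤ x}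

variable {V : ℝ → ℝ}

lemma reparam_nonempty (hV : Monotone V) (x : ℝ) : {t | t + V t ≤ x}.Nonempty := by
  refine ⟨min 0 (x - V 0), ?_⟩
  have h1 := hV (min_le_left 0 (x - V 0))
  have h2 := min_le_right 0 (x - V 0)
  simp only [mem_ofPred_eq]
  linarith

lemma reparam_bddAbove (hV : Monotone V) (x : ℝ) : BddAbove {t | t + V t ≤ x} := by
  refine ⟨max 0 (x - V 0), fun t ht => ?_⟩
  simp only [mem_ofPred_eq] at ht
  rcases le_total t 0 with h | h
  · exact h.trans (le_max_left _ _)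
  · have := hV h
    exact le_trans (by linarith) (le_max_right _ _)

lemma lt_of_reparam_lt (hV : Monotone V) {x s : ℝ} (h : reparam V x < s) : x < s + V s := by
  by_contra! hc
  exact absurd (le_csSup (reparam_bddAbove hV x) hc) (not_le.2 h)

lemma le_of_lt_reparam (hV : Monotone V) {x s : ℝ} (h : s < reparam V x) : s + V s ≤ x := by
  obtain ⟨t, ht, hst⟩ := exists_lt_of_lt_csSup (reparam_nonempty hV x) h
  have := hV hst.le
  simp only [mem_ofPred_eq] at ht
  linarith

lemma reparam_monotone (hV : Monotone V) : Monotone (reparam V) := fun x y hxy =>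
  csSup_le_csSup (reparam_bddAbove hV y) (reparam_nonempty hV x) fun _ ht => le_trans ht hxy

lemma reparam_apply (hV : Monotone V) (t : ℝ) : reparam V (t + V t) = t := by
  apply le_antisymm
  · refine csSup_le (reparam_nonempty hV _) fun s hs => ?_
    by_contra! hc
    have := hV hc.le
    simp only [mem_ofPred_eq] at hs
    linarith
  · exact le_csSup (reparam_bddAbove hV _) (by simp)

lemma abs_comp_reparam_sub_le (hV : Monotone V) {φ : ℝ → ℝ} (hφ : Continuous φ)
    (h : ∀ s t, s ≤ t → |φ t - φ s| ≤ (t + V t) - (s + V s)) {x y : ℝ} (hxy : x ≤ y) :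
    |φ (reparam V y) - φ (reparam V x)| ≤ y - x := by
  rcases (reparam_monotone hV hxy).eq_or_lt with heq | hlt
  · rw [heq]; simpa using hxy
  · have h1 : Tendsto (fun p : ℝ × ℝ => |φ p.2 - φ p.1|)
        (𝓝[>] (reparam V x) ×ˢ 𝓝[<] (reparam V y))
        (𝓝 |φ (reparam V y) - φ (reparam V x)|) := by
      have a1 : Tendsto (fun p : ℝ × ℝ => φ p.1) (𝓝[>] (reparam V x) ×ˢ 𝓝[<] (reparam V y))
          (𝓝 (φ (reparam V x))) :=
        ((hφ.tendsto _).mono_left nhdsWithin_le_nhds).comp tendsto_fst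
      have a2 : Tendsto (fun p : ℝ × ℝ => φ p.2) (𝓝[>] (reparam V x) ×ˢ 𝓝[<] (reparam V y))
          (𝓝 (φ (reparam V y))) :=
        ((hφ.tendsto _).mono_left nhdsWithin_le_nhds).comp tendsto_snd
      exact (a2.sub a1).abs
    refine le_of_tendsto h1 ?_
    obtain ⟨m, hm1, hm2⟩ := exists_between hlt
    filter_upwards [prod_mem_prod (Ioo_mem_nhdsGT hm1) (Ioo_mem_nhdsLT hm2)]
      with p hp
    obtain ⟨⟨p1, p2⟩, p3, p4⟩ := hp
    have := h p.1 p.2 (p2.trans p3).le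
    have q1 := lt_of_reparam_lt hV p1
    have q2 := le_of_lt_reparam hV p4
    linarith

lemma lipschitzWith_comp_reparam (hV : Monotone V) {φ : ℝ → ℝ} (hφ : Continuous φ)
    (h : ∀ s t, s ≤ t → |φ t - φ s| ≤ (t + V t) - (s + V s)) :
    LipschitzWith 1 (fun x => φ (reparam V x)) := by
  refine LipschitzWith.of_dist_le_mul fun x y => ?_
  rw [NNReal.coe_one, one_mul, Real.dist_eq, Real.dist_eq]
  rcases le_total x y with hxy | hxy
  · rw [abs_sub_comm, abs_sub_comm x y, abs_of_nonneg (sub_nonneg.2 hxy)]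
    exact abs_comp_reparam_sub_le hV hφ h hxy
  · rw [abs_of_nonneg (sub_nonneg.2 hxy)]
    exact abs_comp_reparam_sub_le hV hφ h hxy

lemma lipschitzWith_reparam (hV : Monotone V) : LipschitzWith 1 (reparam V) :=
  lipschitzWith_comp_reparam hV continuous_id fun s t hst => by
    have := hV hst
    rw [id, id, abs_of_nonneg (sub_nonneg.2 hst)]
    linarith

/-- If the reparametrized function has vanishing derivative wherever the reparametrization does,
then the function is absolutely continuous. -/
lemma absolutelyContinuousOnInterval_of_reparam (hV : Monotone V) {w : ℝ → ℝ}
    (hw : Continuous w) (hwV : ∀ s t, s ≤ t → |w t - w s| ≤ V t - V s)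
    (h : ∀ᵐ x, HasDerivAt (reparam V) 0 x → HasDerivAt (fun x => w (reparam V x)) 0 x)
    {a b : ℝ} (hab : a ≤ b) : AbsolutelyContinuousOnInterval w a b := by
  set T := reparam V with hT
  set wT := fun x => w (T x) with hwT
  have hTL : LipschitzWith 1 T := lipschitzWith_reparam hV
  have hwTL : LipschitzWith 1 wT := lipschitzWith_comp_reparam hV hw fun s t hst => by
    linarith [hwV s t hst]
  have hTm : Monotone T := reparam_monotone hV
  have hTd : ∀ x, 0 ≤ deriv T x := fun x => hTm.deriv_nonneg
  set B : ℕ → Set ℝ := fun k =>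
    Ioc (a + V a) (b + V b) ∩ ({x | 0 < deriv T x} ∩ {x | deriv T x < 1 / ((k : ℝ) + 1)}) with hB
  have hBm : ∀ k, MeasurableSet (B k) := fun k =>
    measurableSet_Ioc.inter ((measurableSet_lt measurable_const (measurable_deriv T)).inter
      (measurableSet_lt (measurable_deriv T) measurable_const))
  have hBanti : Antitone B := by
    intro k l hkl x hx
    refine ⟨hx.1, hx.2.1, lt_of_lt_of_le (mem_ofPred_eq ▸ hx.2.2) ?_⟩
    exact one_div_le_one_div_of_le (by positivity) (by exact_mod_cast Nat.succ_le_succ hkl)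
  have hBlim : Tendsto (fun k => volume (B k)) atTop (𝓝 0) := by
    have := tendsto_measure_iInter_atTop (μ := volume) (fun k => (hBm k).nullMeasurableSet) hBanti
      ⟨0, ((measure_mono inter_subset_left).trans_lt measure_Ioc_lt_top).ne⟩
    have he : ⋂ k, B k = ∅ := by
      ext x
      simp only [mem_iInter, mem_empty_iff_false, iff_false, not_forall]
      by_cases hx : 0 < deriv T x
      · obtain ⟨k, hk⟩ := exists_nat_one_div_lt hx
        exact ⟨k, fun hc => absurd hc.2.2 (not_lt.2 hk.le)⟩
      · exact ⟨0, fun hc => hx hc.2.1⟩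
    rwa [he, measure_empty] at this
  rw [absolutelyContinuousOnInterval_iff]
  intro ε hε
  obtain ⟨k, hk⟩ := ((ENNReal.tendsto_nhds_zero.1 hBlim) (ENNReal.ofReal (ε / 3))
    (by simpa using by positivity)).exists
  have hBfin : ∀ S, volume (B k ∩ S) ≠ ⊤ := fun S =>
    ((measure_mono (inter_subset_left.trans inter_subset_left)).trans_lt measure_Ioc_lt_top).ne
  have key : ∀ s t, a ≤ s → s ≤ t → t ≤ b →
      |w t - w s| ≤ volume.real (B k ∩ Ioc (s + V s) (t + V t)) + ((k : ℝ) + 1) * (t - s) := by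
    intro s t has hst htb
    have hτ : s + V s ≤ t + V t := by linarith [hV hst]
    have e1 : ∫ x in (s + V s)..(t + V t), deriv wT x = w t - w s := by
      have := (hwTL.lipschitzOnWith (s := uIcc (s + V s) (t + V t))
        ).absolutelyContinuousOnInterval.integral_deriv_eq_sub
      rw [this, hwT]
      simp only [hT, reparam_apply hV]
    have e2 : ∫ x in (s + V s)..(t + V t), deriv T x = t - s := by
      have := (hTL.lipschitzOnWith (s := uIcc (s + V s) (t + V t))
        ).absolutelyContinuousOnInterval.integral_deriv_eq_sub
      rw [this]
      simp only [hT, reparam_apply hV]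
    have hTi : IntervalIntegrable (deriv T) volume (s + V s) (t + V t) :=
      (hTL.lipschitzOnWith (s := uIcc (s + V s) (t + V t))
        ).absolutelyContinuousOnInterval.intervalIntegrable_deriv
    have hBi : IntervalIntegrable ((B k).indicator fun _ => (1 : ℝ)) volume
        (s + V s) (t + V t) := by
      rw [intervalIntegrable_iff_integrableOn_Ioc_of_le hτ]
      exact (integrable_const (1 : ℝ)).indicator (hBm k)
    rw [← e1]
    calc |∫ x in (s + V s)..(t + V t), deriv wT x|
        ≤ ∫ x in (s + V s)..(t + V t),
            ((B k).indicator (fun _ => (1 : ℝ)) x + ((k : ℝ) + 1) * deriv T x) := by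
          rw [← Real.norm_eq_abs]
          refine intervalIntegral.norm_integral_le_of_norm_le hτ ?_ (hBi.add (hTi.const_mul _))
          filter_upwards [h, hTL.ae_differentiableAt_real] with x hx hTx hxm
          have hk1 : (0 : ℝ) < (k : ℝ) + 1 := by positivity
          have hwT1 : ‖deriv wT x‖ ≤ 1 := by
            simpa using norm_deriv_le_of_lipschitz (x₀ := x) hwTL
          have hi0 : 0 ≤ (B k).indicator (fun _ => (1 : ℝ)) x :=
            indicator_nonneg (fun _ _ => zero_le_one) x
          rcases (hTd x).eq_or_lt with h0 | h0
          · have : HasDerivAt T 0 x := by rw [h0]; exact hTx.hasDerivAt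
            rw [(hx this).deriv, norm_zero]
            nlinarith [hTd x]
          · by_cases hlt : deriv T x < 1 / ((k : ℝ) + 1)
            · have hmem : x ∈ B k :=
                ⟨⟨by linarith [hxm.1, hV has], by linarith [hxm.2, hV htb]⟩, h0, hlt⟩
              rw [indicator_of_mem hmem]
              nlinarith
            · have : 1 ≤ ((k : ℝ) + 1) * deriv T x := by
                rw [not_lt, div_le_iff₀ hk1] at hlt
                linarith
              linarith
      _ = volume.real (B k ∩ Ioc (s + V s) (t + V t)) + ((k : ℝ) + 1) * (t - s) := by
          rw [intervalIntegral.integral_add hBi (hTi.const_mul _),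
            intervalIntegral.integral_const_mul, e2, intervalIntegral.integral_of_le hτ,
            integral_indicator_const _ (hBm k), smul_eq_mul, mul_one,
            measureReal_restrict_apply (hBm k)]
  have key' : ∀ s ∈ uIcc a b, ∀ t ∈ uIcc a b, dist (w s) (w t) ≤
      volume.real (B k ∩ Ioc (min s t + V (min s t)) (max s t + V (max s t)))
        + ((k : ℝ) + 1) * dist s t := by
    intro s hs t ht
    rw [uIcc_of_le hab] at hs ht
    rcases le_total s t with hst | hst
    · rw [min_eq_left hst, max_eq_right hst, dist_comm, dist_comm s, Real.dist_eq, Real.dist_eq,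
        abs_of_nonneg (sub_nonneg.2 hst)]
      exact key s t hs.1 hst ht.2
    · rw [min_eq_right hst, max_eq_left hst, Real.dist_eq, Real.dist_eq,
        abs_of_nonneg (sub_nonneg.2 hst)]
      exact key t s ht.1 hst hs.2
  refine ⟨ε / (3 * ((k : ℝ) + 1)), by positivity, fun E hE hsum => ?_⟩
  obtain ⟨hE1, hE2⟩ := hE
  set J : ℕ → Set ℝ := fun i => B k ∩ Ioc (min (E.2 i).1 (E.2 i).2 + V (min (E.2 i).1 (E.2 i).2))
    (max (E.2 i).1 (E.2 i).2 + V (max (E.2 i).1 (E.2 i).2)) with hJ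
  have hJd : Set.PairwiseDisjoint (Finset.range E.1 : Set ℕ) J := by
    intro i hi j hj hij
    have hd := hE2 hi hj hij
    refine disjoint_left.2 fun x hxi hxj => ?_
    have l1 : ∀ p q, p + V p < x → x ≤ q + V q → p < q := by
      intro p q hp hq
      by_contra! hc
      linarith [hV hc]
    have a1 := l1 _ _ hxi.2.1 hxi.2.2
    have a2 := l1 _ _ hxj.2.1 hxj.2.2
    have a3 := l1 _ _ hxi.2.1 hxj.2.2
    have a4 := l1 _ _ hxj.2.1 hxi.2.2
    have m1 : min (max (E.2 i).1 (E.2 i).2) (max (E.2 j).1 (E.2 j).2)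
        ∈ uIoc (E.2 i).1 (E.2 i).2 := ⟨lt_min a1 a3, min_le_left _ _⟩
    exact disjoint_left.1 hd m1 ⟨lt_min a4 a2, min_le_right _ _⟩
  have hJm : ∀ i, MeasurableSet (J i) := fun i => (hBm k).inter measurableSet_Ioc
  have hJsum : ∑ i ∈ Finset.range E.1, volume.real (J i) ≤ ε / 3 := by
    rw [← measureReal_biUnion_finset hJd (fun i _ => hJm i) (fun i _ => hBfin _)]
    calc volume.real (⋃ i ∈ Finset.range E.1, J i) ≤ volume.real (B k) := by
          refine measureReal_mono ?_ ?_
          · exact iUnion₂_subset fun i _ => inter_subset_left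
          · simpa using hBfin univ
      _ ≤ ε / 3 := ENNReal.toReal_le_of_le_ofReal (by positivity) hk
  calc ∑ i ∈ Finset.range E.1, dist (w (E.2 i).1) (w (E.2 i).2)
      ≤ ∑ i ∈ Finset.range E.1, (volume.real (J i)
          + ((k : ℝ) + 1) * dist (E.2 i).1 (E.2 i).2) :=
        Finset.sum_le_sum fun i hi => key' _ (hE1 i hi).1 _ (hE1 i hi).2
    _ ≤ ε / 3 + ((k : ℝ) + 1) * (ε / (3 * ((k : ℝ) + 1))) := by
        rw [Finset.sum_add_distrib, ← Finset.mul_sum]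
        gcongr
    _ < ε := by
        have : ((k : ℝ) + 1) * (ε / (3 * ((k : ℝ) + 1))) = ε / 3 := by field_simp
        rw [this]; linarith

end Reparam

section ReparamDeriv

open Filter

lemma setLIntegral_ofReal_deriv_le {f : ℝ → ℝ} (hf : Monotone f) {a b : ℝ} (hab : a ≤ b) :
    ∫⁻ x in Icc a b, ENNReal.ofReal (deriv f x) ≤ ENNReal.ofReal (f b - f a) := by
  have h1 := (hf.monotoneOn (uIcc a b)).intervalIntegral_deriv_mem_uIcc
  have h2 := (hf.monotoneOn (uIcc a b)).intervalIntegrable_deriv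
  rw [intervalIntegrable_iff_integrableOn_Icc_of_le hab] at h2
  rw [uIcc_of_le (sub_nonneg.2 (hf hab))] at h1
  rw [← ofReal_integral_eq_lintegral_ofReal h2 (Eventually.of_forall fun x => hf.deriv_nonneg),
    integral_Icc_eq_integral_Ioc, ← intervalIntegral.integral_of_le hab]
  exact ENNReal.ofReal_le_ofReal h1.2

lemma measurableSet_hasDerivAt_zero (T : ℝ → ℝ) : MeasurableSet {x | HasDerivAt T 0 x} := by
  have : {x | HasDerivAt T 0 x} = {x | DifferentiableAt ℝ T x} ∩ {x | deriv T x = 0} := by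
    ext x
    refine ⟨fun h => ⟨h.differentiableAt, h.deriv⟩, fun h => ?_⟩
    have := h.1.hasDerivAt
    rwa [show deriv T x = 0 from h.2] at this
  rw [this]
  exact (measurableSet_of_differentiableAt ℝ T).inter
    (measurable_deriv T (measurableSet_singleton 0))

/-- A monotone absolutely continuous function composed with a monotone Lipschitz `T` has vanishing
derivative almost everywhere where `T` has. -/
lemma ae_hasDerivAt_zero_comp {T g : ℝ → ℝ} (hT : Monotone T)
    (hg : Integrable g) (hg0 : ∀ x, 0 ≤ g x) (a : ℝ) :
    ∀ᵐ x, HasDerivAt T 0 x → HasDerivAt (fun x => ∫ u in a..(T x), g u) 0 x := by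
  set G : ℝ → ℝ := fun t => ∫ u in a..t, g u with hG
  set gM : ℕ → ℝ → ℝ := fun M u => min (g u) M with hgM
  have hgMi : ∀ M, Integrable (gM M) := fun M => by
    refine hg.mono (hg.1.inf aestronglyMeasurable_const) (Eventually.of_forall fun x => ?_)
    simp only [hgM]
    rw [Real.norm_of_nonneg (le_min (hg0 x) (Nat.cast_nonneg M)), Real.norm_of_nonneg (hg0 x)]
    exact min_le_left _ _
  have hrMi : ∀ M, Integrable (fun u => g u - gM M u) := fun M => hg.sub (hgMi M)
  have hr0 : ∀ M x, 0 ≤ g x - gM M x := fun M x => sub_nonneg.2 (min_le_left _ _)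
  set R : ℕ → ℝ → ℝ := fun M t => ∫ u in a..t, (g u - gM M u) with hR
  have mono_of : ∀ {f : ℝ → ℝ}, Integrable f → (∀ x, 0 ≤ f x) →
      Monotone (fun t => ∫ u in a..t, f u) := by
    intro f hf hf0 s t hst
    have : ∫ u in a..t, f u = (∫ u in a..s, f u) + ∫ u in s..t, f u :=
      (intervalIntegral.integral_add_adjacent_intervals hf.intervalIntegrable
        hf.intervalIntegrable).symm
    simp only [this]
    have := intervalIntegral.integral_nonneg (μ := volume) hst fun x _ => hf0 x
    linarith
  have hGm : Monotone (fun x => G (T x)) := (mono_of hg hg0).comp hT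
  have hRm : ∀ M, Monotone (fun x => R M (T x)) := fun M => (mono_of (hrMi M) (hr0 M)).comp hT
  have hlim : Tendsto (fun M : ℕ => ∫ u, (g u - gM M u)) atTop (𝓝 0) := by
    have : Tendsto (fun M : ℕ => ∫ u, (g u - gM M u)) atTop (𝓝 (∫ _ : ℝ, (0 : ℝ))) := by
      refine tendsto_integral_of_dominated_convergence g (fun M => (hrMi M).1) hg
        (fun M => Eventually.of_forall fun x => ?_) (Eventually.of_forall fun x => ?_)
      · rw [Real.norm_of_nonneg (hr0 M x)]
        have : 0 ≤ gM M x := le_min (hg0 x) (Nat.cast_nonneg M)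
        linarith
      · refine tendsto_const_nhds.congr' ?_
        obtain ⟨M, hM⟩ := exists_nat_ge (g x)
        filter_upwards [eventually_ge_atTop M] with M' hM'
        have : g x ≤ M' := hM.trans (by exact_mod_cast hM')
        simp [hgM, min_eq_left this]
    simpa using this
  set N := {x | HasDerivAt T 0 x} with hN
  have hNm : MeasurableSet N := measurableSet_hasDerivAt_zero T
  have hle : ∀ M, ∀ᵐ x, x ∈ N → deriv (fun x => G (T x)) x ≤ deriv (fun x => R M (T x)) x := by
    intro M
    filter_upwards [hGm.ae_differentiableAt, (hRm M).ae_differentiableAt] with x h1 h2 hx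
    have hd : HasDerivAt (fun y => G (T y) - R M (T y)) 0 x := by
      have hlip : ∀ y, |(G (T y) - R M (T y)) - (G (T x) - R M (T x))| ≤ M * |T y - T x| := by
        intro y
        have e : (G (T y) - R M (T y)) - (G (T x) - R M (T x)) = ∫ u in (T x)..(T y), gM M u := by
          simp only [hG, hR]
          rw [intervalIntegral.integral_sub hg.intervalIntegrable (hgMi M).intervalIntegrable,
            intervalIntegral.integral_sub hg.intervalIntegrable (hgMi M).intervalIntegrable,
            ← intervalIntegral.integral_interval_sub_left
              (a := a) (b := T y) (c := T x) (hgMi M).intervalIntegrable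
              (hgMi M).intervalIntegrable]
          ring
        rw [e, ← Real.norm_eq_abs]
        refine intervalIntegral.norm_integral_le_of_norm_le_const fun u _ => ?_
        rw [Real.norm_of_nonneg (le_min (hg0 u) (Nat.cast_nonneg M))]
        exact min_le_right _ _
      have hTo : (fun y => T y - T x) =o[𝓝 x] fun y => y - x := by
        simpa using hasDerivAt_iff_isLittleO.1 hx
      rw [hasDerivAt_iff_isLittleO]
      simp only [smul_zero, sub_zero]
      refine Asymptotics.IsBigO.trans_isLittleO ?_ hTo
      exact Asymptotics.IsBigO.of_bound M (Eventually.of_forall fun y => by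
        simpa [Real.norm_eq_abs] using hlip y)
    have := (h1.hasDerivAt.sub h2.hasDerivAt).unique hd
    linarith
  have hzero : ∀ k : ℕ, ∫⁻ x in Icc (-(k : ℝ)) k ∩ N, ENNReal.ofReal (deriv (fun x => G (T x)) x)
      = 0 := by
    intro k
    have hk : -(k : ℝ) ≤ k := by linarith [(Nat.cast_nonneg k : (0 : ℝ) ≤ k)]
    have hb : ∀ M, ∫⁻ x in Icc (-(k : ℝ)) k ∩ N, ENNReal.ofReal (deriv (fun x => G (T x)) x)
        ≤ ENNReal.ofReal (∫ u, (g u - gM M u)) := by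
      intro M
      calc _ ≤ ∫⁻ x in Icc (-(k : ℝ)) k ∩ N, ENNReal.ofReal (deriv (fun x => R M (T x)) x) := by
            refine lintegral_mono_ae ?_
            rw [ae_restrict_iff' (measurableSet_Icc.inter hNm)]
            filter_upwards [hle M] with x hx hxm
            exact ENNReal.ofReal_le_ofReal (hx hxm.2)
        _ ≤ ∫⁻ x in Icc (-(k : ℝ)) k, ENNReal.ofReal (deriv (fun x => R M (T x)) x) :=
            lintegral_mono_set inter_subset_left
        _ ≤ ENNReal.ofReal (R M (T k) - R M (T (-k))) := setLIntegral_ofReal_deriv_le (hRm M) hk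
        _ ≤ _ := by
            refine ENNReal.ofReal_le_ofReal ?_
            simp only [hR]
            rw [intervalIntegral.integral_interval_sub_left (hrMi M).intervalIntegrable
              (hrMi M).intervalIntegrable, intervalIntegral.integral_of_le (hT hk)]
            exact setIntegral_le_integral (hrMi M) (Eventually.of_forall (hr0 M))
    have hl : Tendsto (fun M : ℕ => ENNReal.ofReal (∫ u, (g u - gM M u))) atTop (𝓝 0) := by
      simpa using ENNReal.tendsto_ofReal hlim
    exact le_antisymm (ge_of_tendsto' hl hb) zero_le
  have hz : ∀ k : ℕ, ∀ᵐ x, x ∈ Icc (-(k : ℝ)) k ∩ N → deriv (fun x => G (T x)) x = 0 := by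
    intro k
    have := hzero k
    rw [lintegral_eq_zero_iff (measurable_deriv _).ennreal_ofReal,
      Filter.EventuallyEq, ae_restrict_iff' (measurableSet_Icc.inter hNm)] at this
    filter_upwards [this] with x hx hxm
    have := hx hxm
    simp only [Pi.zero_apply, ENNReal.ofReal_eq_zero] at this
    exact le_antisymm this hGm.deriv_nonneg
  filter_upwards [ae_all_iff.2 hz, hGm.ae_differentiableAt] with x hx hd hTx
  obtain ⟨k, hk⟩ := exists_nat_ge |x|
  have := hx k ⟨abs_le.1 hk, hTx⟩
  have h2 := hd.hasDerivAt
  rwa [this] at h2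

lemma ae_hasDerivAt_zero_of_const_comp {T φ : ℝ → ℝ} (hT : Monotone T) (c : ℝ) :
    ∀ᵐ x, T x = c → HasDerivAt (fun x => φ (T x)) 0 x := by
  have hconv : Convex ℝ (T ⁻¹' {c}) := by
    have : (T ⁻¹' {c}).OrdConnected := Set.ordConnected_singleton.preimage_mono hT
    exact this.convex
  have h0 := hconv.addHaar_frontier volume
  filter_upwards [compl_mem_ae_iff.2 h0] with x hx hxc
  have hmem : x ∈ interior (T ⁻¹' {c}) := by
    by_contra hcon
    exact hx ⟨subset_closure hxc, hcon⟩
  have : (fun x => φ (T x)) =ᶠ[𝓝 x] fun _ => φ c := by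
    filter_upwards [mem_interior_iff_mem_nhds.1 hmem] with y hy
    rw [show T y = c from hy]
  exact (hasDerivAt_const x (φ c)).congr_of_eventuallyEq this

lemma countable_isolated (E : Set ℝ) : {x ∈ E | ¬ AccPt x (𝓟 E)}.Countable := by
  refine (countable_setOfPred_isolated_right_within (s := E)).mono ?_
  rintro x ⟨hxE, hx⟩
  refine ⟨hxE, ?_⟩
  by_contra hc
  refine hx (NeBot.mono ⟨hc⟩ ?_)
  rw [← nhdsWithin_inter']
  refine nhdsWithin_mono x (fun y hy => ?_)
  exact ⟨(ne_of_gt hy.2 : y ≠ x), hy.1⟩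

lemma hasDerivAt_eq_zero_of_accPt {f : ℝ → ℝ} {d t : ℝ} {E : Set ℝ} (hf : HasDerivAt f d t)
    (hE : ∀ x ∈ E, f x = 0) (ht : AccPt t (𝓟 E)) : d = 0 := by
  by_contra hd
  have h1 := hf.eventually_ne (c := 0) hd
  rw [accPt_iff_frequently_nhdsNE] at ht
  obtain ⟨x, hx1, hx2⟩ := (ht.and_eventually h1).exists
  exact hx2 (hE x hx1)

/-- Vanishing weighted power sums force vanishing weights. -/
lemma eq_zero_of_sum_pow_mul_eq_zero {ι : Type*} [Fintype ι] {l ν : ι → ℝ}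
    (h : ∀ q : ℕ, ∑ i, l i ^ q * ν i = 0) (hl : ∀ i j, l i = l j → ν i = ν j) (i : ι) :
    ν i = 0 := by
  classical
  have hp : ∀ p : Polynomial ℝ, ∑ i, p.eval (l i) * ν i = 0 := by
    intro p
    simp_rw [Polynomial.eval_eq_sum_range, Finset.sum_mul]
    rw [Finset.sum_comm]
    refine Finset.sum_eq_zero fun q _ => ?_
    simp_rw [mul_assoc, ← Finset.mul_sum, h, mul_zero]
  obtain ⟨r, hr⟩ : ∃ r : ℝ → ℝ, ∀ i, r (l i) = ν i := by
    refine ⟨fun x => if hx : ∃ i, l i = x then ν hx.choose else 0, fun i => ?_⟩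
    have hx : ∃ j, l j = l i := ⟨i, rfl⟩
    simp only [hx, dif_pos]
    exact hl _ _ hx.choose_spec
  have h2 := hp (Lagrange.interpolate (Finset.univ.image l) id r)
  have h3 : ∀ i, (Lagrange.interpolate (Finset.univ.image l) id r).eval (l i) = ν i := by
    intro i
    have := Lagrange.eval_interpolate_at_node (s := Finset.univ.image l) (v := id) r
      (Set.injOn_id _) (Finset.mem_image_of_mem l (Finset.mem_univ i))
    simpa [hr] using this
  simp_rw [h3] at h2
  have := (Finset.sum_eq_zero_iff_of_nonneg fun i _ => mul_self_nonneg (ν i)).1 h2 i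
    (Finset.mem_univ i)
  exact mul_self_eq_zero.1 this

end ReparamDeriv

section PowerSums

open Filter

lemma hasDerivAt_zero_of_abs_sub_le {f g : ℝ → ℝ} {x : ℝ} (hg : HasDerivAt g 0 x)
    (h : ∀ᶠ y in 𝓝 x, |f y - f x| ≤ |g y - g x|) : HasDerivAt f 0 x := by
  rw [hasDerivAt_iff_isLittleO] at hg ⊢
  simp only [smul_zero, sub_zero] at hg ⊢
  refine Asymptotics.IsBigO.trans_isLittleO ?_ hg
  exact Asymptotics.IsBigO.of_bound 1 (by simpa [Real.norm_eq_abs] using h)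

lemma max_min_mem_Icc {a b : ℝ} (hab : a ≤ b) (t : ℝ) : max a (min b t) ∈ Icc a b :=
  ⟨le_max_left _ _, max_le hab (min_le_left _ _)⟩

lemma max_min_eq_self {a b t : ℝ} (ht : t ∈ Icc a b) : max a (min b t) = t := by
  rw [min_eq_right ht.2, max_eq_right ht.1]

lemma monotone_max_min (a b : ℝ) : Monotone fun t : ℝ => max a (min b t) := fun _ _ hst =>
  max_le_max le_rfl (min_le_min le_rfl hst)

/-- A tuple of `C¹` functions whose derivatives are dominated by a monotone function and whose
power sums have absolutely continuous derivative has absolutely continuous derivatives. -/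
theorem absolutelyContinuousOnInterval_of_powerSums {ι : Type*} [Fintype ι] {a b : ℝ}
    (hab : a < b) {lam w : ι → ℝ → ℝ} {V : ℝ → ℝ} (hV : MonotoneOn V (Icc a b))
    (hw : ∀ i, ContinuousOn (w i) (Icc a b))
    (hlam : ∀ i, ∀ t ∈ Ioo a b, HasDerivAt (lam i) (w i t) t)
    (hwV : ∀ i, ∀ s ∈ Icc a b, ∀ t ∈ Icc a b, s ≤ t → |w i t - w i s| ≤ V t - V s)
    (hu : ∀ q : ℕ, AbsolutelyContinuousOnInterval (fun t => ∑ i, lam i t ^ q * w i t) a b) (i : ι) :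
    AbsolutelyContinuousOnInterval (w i) a b := by
  set p : ℝ → ℝ := fun t => max a (min b t) with hp
  have hpm : Monotone p := monotone_max_min a b
  have hpI : ∀ t, p t ∈ Icc a b := max_min_mem_Icc hab.le
  have hpe : ∀ t ∈ Icc a b, p t = t := fun t ht => max_min_eq_self ht
  have hpc : Continuous p := by fun_prop
  set W : ι → ℝ → ℝ := fun i t => w i (p t) with hW
  set U : ℝ → ℝ := fun t => V (p t) with hU
  have hUm : Monotone U := fun s t hst => hV (hpI s) (hpI t) (hpm hst)
  have hWc : ∀ i, Continuous (W i) := fun i => (hw i).comp_continuous hpc hpI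
  have hWU : ∀ i s t, s ≤ t → |W i t - W i s| ≤ U t - U s := fun i s t hst =>
    hwV i _ (hpI s) _ (hpI t) (hpm hst)
  set T := reparam U with hT
  have hTm : Monotone T := reparam_monotone hUm
  have hTL : LipschitzWith 1 T := lipschitzWith_reparam hUm
  have hWL : ∀ i, LipschitzWith 1 fun x => W i (T x) := fun i =>
    lipschitzWith_comp_reparam hUm (hWc i) fun s t hst => by linarith [hWU i s t hst]
  suffices hmain : ∀ᵐ x, HasDerivAt T 0 x → ∀ i, HasDerivAt (fun x => W i (T x)) 0 x by
    have := absolutelyContinuousOnInterval_of_reparam hUm (hWc i) (hWU i)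
      (hmain.mono fun x hx h => hx h i) hab.le
    rw [absolutelyContinuousOnInterval_iff] at this ⊢
    intro ε hε
    obtain ⟨δ, hδ, h⟩ := this ε hε
    refine ⟨δ, hδ, fun E hE hs => ?_⟩
    convert h E hE hs using 1
    refine Finset.sum_congr rfl fun j hj => ?_
    have := hE.1 j hj
    rw [uIcc_of_le hab.le] at this
    simp only [hW, hpe _ this.1, hpe _ this.2]
  set u : ℕ → ℝ → ℝ := fun q t => ∑ i, lam i t ^ q * w i t with hu'
  set g : ℕ → ℝ → ℝ := fun q => (Icc a b).indicator fun t => |deriv (u q) t| with hg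
  have hgi : ∀ q, Integrable (g q) := fun q => by
    rw [hg, integrable_indicator_iff measurableSet_Icc]
    have := (hu q).intervalIntegrable_deriv
    rw [intervalIntegrable_iff_integrableOn_Icc_of_le hab.le] at this
    exact this.abs
  have hg0 : ∀ q x, 0 ≤ g q x := fun q x => indicator_nonneg (fun _ _ => abs_nonneg _) x
  have hug : ∀ q, ∀ s ∈ Icc a b, ∀ t ∈ Icc a b,
      |u q t - u q s| ≤ |(∫ x in a..t, g q x) - ∫ x in a..s, g q x| := by
    intro q s hs t ht
    wlog hst : s ≤ t generalizing s t
    · rw [abs_sub_comm, abs_sub_comm (∫ x in a..t, g q x)]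
      exact this t ht s hs (le_of_not_ge hst)
    rw [intervalIntegral.integral_interval_sub_left (hgi q).intervalIntegrable
      (hgi q).intervalIntegrable]
    have hac : AbsolutelyContinuousOnInterval (u q) s t :=
      (hu q).mono (by rw [uIcc_of_le hst, uIcc_of_le hab.le]; exact Icc_subset_Icc hs.1 ht.2)
    rw [← hac.integral_deriv_eq_sub]
    refine le_trans ?_ (le_abs_self _)
    rw [← Real.norm_eq_abs]
    refine intervalIntegral.norm_integral_le_of_norm_le hst
      (Eventually.of_forall fun x hx => ?_) (hgi q).intervalIntegrable
    rw [hg]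
    simp only
    rw [indicator_of_mem (show x ∈ Icc a b from ⟨hs.1.trans hx.1.le, hx.2.trans ht.2⟩)]
    exact le_of_eq (Real.norm_eq_abs _)
  set E : ι → ι → Set ℝ := fun i j => {t ∈ Ioo a b | lam i t = lam j t} with hE
  set C : Set ℝ := {a, b} ∪ ⋃ i, ⋃ j, {t ∈ E i j | ¬ AccPt t (𝓟 (E i j))} with hC
  have hCc : C.Countable := by
    refine Countable.union (by simp) ?_
    exact countable_iUnion fun i => countable_iUnion fun j => countable_isolated _
  set X : ι → ι → Set ℝ := fun i j => {x | T x ∈ E i j ∧ AccPt (T x) (𝓟 (E i j))} with hX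
  have hXc : (⋃ i, ⋃ j, {x ∈ X i j | ¬ AccPt x (𝓟 (X i j))}).Countable :=
    countable_iUnion fun i => countable_iUnion fun j => countable_isolated _
  have hae1 : ∀ᵐ x, ∀ c ∈ C, T x = c → ∀ i, HasDerivAt (fun x => W i (T x)) 0 x := by
    rw [ae_ball_iff hCc]
    intro c _
    filter_upwards [ae_all_iff.2 fun i => ae_hasDerivAt_zero_of_const_comp (φ := W i) hTm c]
      with x hx hxc i using hx i hxc
  have hae2 : ∀ᵐ x, ∀ q, HasDerivAt T 0 x → HasDerivAt (fun x => ∫ v in a..(T x), g q v) 0 x :=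
    ae_all_iff.2 fun q => ae_hasDerivAt_zero_comp hTm (hgi q) (hg0 q) a
  have hae3 : ∀ᵐ x, ∀ i, DifferentiableAt ℝ (fun x => W i (T x)) x :=
    ae_all_iff.2 fun i => (hWL i).ae_differentiableAt_real
  filter_upwards [hae1, hae2, hae3, hXc.ae_notMem volume] with x h1 h2 h3 h4 hTx
  by_cases hxC : T x ∈ C
  · exact h1 _ hxC rfl
  have hne : T x ≠ a ∧ T x ≠ b := by
    constructor <;> intro h <;> exact hxC (by rw [h]; simp [hC])
  have hTcont : ContinuousAt T x := hTL.continuous.continuousAt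
  rcases lt_or_gt_of_ne hne.1 with hlt | hgt
  · intro i
    have : (fun y => W i (T y)) =ᶠ[𝓝 x] fun _ => w i a := by
      filter_upwards [hTcont.eventually (gt_mem_nhds hlt)] with y hy
      simp only [hW, hp]
      rw [min_eq_right (hy.trans hab).le, max_eq_left (le_of_lt hy)]
    exact (hasDerivAt_const x _).congr_of_eventuallyEq this
  rcases lt_or_gt_of_ne hne.2 with hlt' | hgt'
  swap
  · intro i
    have : (fun y => W i (T y)) =ᶠ[𝓝 x] fun _ => w i b := by
      filter_upwards [hTcont.eventually (lt_mem_nhds hgt')] with y hy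
      simp only [hW, hp]
      rw [min_eq_left (le_of_lt hy), max_eq_right hab.le]
    exact (hasDerivAt_const x _).congr_of_eventuallyEq this
  have hTI : T x ∈ Ioo a b := ⟨hgt, hlt'⟩
  have hnear : ∀ᶠ y in 𝓝 x, T y ∈ Ioo a b := hTcont.eventually (Ioo_mem_nhds hgt hlt')
  set ν : ι → ℝ := fun i => deriv (fun x => W i (T x)) x with hν
  have hWd : ∀ i, HasDerivAt (fun x => W i (T x)) (ν i) x := fun i => (h3 i).hasDerivAt
  have hWw : ∀ i, (fun y => W i (T y)) =ᶠ[𝓝 x] fun y => w i (T y) := fun i => by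
    filter_upwards [hnear] with y hy
    simp only [hW, hpe _ (Ioo_subset_Icc_self hy)]
  have hwd : ∀ i, HasDerivAt (fun y => w i (T y)) (ν i) x := fun i =>
    (hWd i).congr_of_eventuallyEq (hWw i).symm
  have hld : ∀ i, HasDerivAt (fun y => lam i (T y)) 0 x := fun i => by
    have := (hlam i _ hTI).comp x hTx
    rwa [mul_zero] at this
  have hsum : ∀ q : ℕ, ∑ i, lam i (T x) ^ q * ν i = 0 := by
    intro q
    have e1 : HasDerivAt (fun y => u q (T y)) 0 x := by
      refine hasDerivAt_zero_of_abs_sub_le (h2 q hTx) ?_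
      filter_upwards [hnear] with y hy
      exact hug q _ (Ioo_subset_Icc_self hTI) _ (Ioo_subset_Icc_self hy)
    have e2 : HasDerivAt (fun y => u q (T y)) (∑ i, (lam i (T x) ^ q * ν i)) x := by
      refine HasDerivAt.fun_sum fun i _ => ?_
      have := ((hld i).fun_pow q).fun_mul (hwd i)
      simpa using this
    exact e2.unique e1
  have heq : ∀ i j, lam i (T x) = lam j (T x) → ν i = ν j := by
    intro i j hij
    have hmemE : T x ∈ E i j := ⟨hTI, hij⟩
    have hacc : AccPt (T x) (𝓟 (E i j)) := by
      by_contra hcon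
      exact hxC (Or.inr (mem_iUnion₂.2 ⟨i, j, hmemE, hcon⟩))
    have hxX : x ∈ X i j := ⟨hmemE, hacc⟩
    have hxacc : AccPt x (𝓟 (X i j)) := by
      by_contra hcon
      exact h4 (mem_iUnion₂.2 ⟨i, j, hxX, hcon⟩)
    have hd := (hwd i).fun_sub (hwd j)
    have := hasDerivAt_eq_zero_of_accPt hd (E := X i j) (fun y hy => ?_) hxacc
    · linarith
    · have hl := (hlam i _ hy.1.1).fun_sub (hlam j _ hy.1.1)
      exact hasDerivAt_eq_zero_of_accPt hl (E := E i j)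
        (fun z hz => by rw [hz.2, sub_self]) hy.2
  intro i
  have := eq_zero_of_sum_pow_mul_eq_zero hsum heq i
  have h := hWd i
  rwa [this] at h

end PowerSums

section Semiconvex

open Filter

/-- `c` is a generalized subgradient of `f` on `s`, with error controlled by `G`. -/
def IsSubgradientOn (s : Set ℝ) (f c G : ℝ → ℝ) : Prop :=
  ∀ x ∈ s, ∀ t ∈ s, f x + (t - x) * c x - |t - x| * |G t - G x| ≤ f t

variable {s : Set ℝ} {f c G : ℝ → ℝ}

lemma IsSubgradientOn.monotoneOn (h : IsSubgradientOn s f c G) (hG : MonotoneOn G s) :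
    MonotoneOn (fun t => c t + 2 * G t) s := by
  intro x hx t ht hxt
  rcases hxt.eq_or_lt with rfl | hlt
  · exact le_rfl
  have h1 := h x hx t ht
  have h2 := h t ht x hx
  have hg := hG hx ht hxt
  rw [abs_of_nonneg (sub_nonneg.2 hxt), abs_of_nonneg (sub_nonneg.2 hg)] at h1
  rw [abs_sub_comm, abs_of_nonneg (sub_nonneg.2 hxt), abs_sub_comm,
    abs_of_nonneg (sub_nonneg.2 hg)] at h2
  have h3 : (t - x) * (c x - c t - 2 * (G t - G x)) ≤ 0 := by linarith
  have h4 : c x - c t - 2 * (G t - G x) ≤ 0 := by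
    by_contra! hc
    nlinarith
  simp only
  linarith

lemma IsSubgradientOn.abs_sub_le (h : IsSubgradientOn s f c G) {x y : ℝ} (hx : x ∈ s)
    (hy : y ∈ s) :
    |f y - f x - (y - x) * c x| ≤ |y - x| * (|G y - G x| + |c y - c x|) := by
  have h1 := h x hx y hy
  have h2 := h y hy x hx
  rw [abs_sub_comm x y, abs_sub_comm (G x)] at h2
  have h3 : (y - x) * (c y - c x) ≤ |y - x| * |c y - c x| := by
    rw [← abs_mul]; exact le_abs_self _
  have h4 : 0 ≤ |y - x| * |c y - c x| := by positivity
  rw [abs_le]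
  constructor <;> nlinarith

lemma IsSubgradientOn.hasDerivAt (h : IsSubgradientOn s f c G) {x : ℝ} (hx : s ∈ 𝓝 x)
    (hc : ContinuousAt c x) (hG : ContinuousAt G x) : HasDerivAt f (c x) x := by
  rw [hasDerivAt_iff_isLittleO, Asymptotics.isLittleO_iff]
  intro ε hε
  have h1 : Tendsto (fun y => |G y - G x| + |c y - c x|) (𝓝 x) (𝓝 0) := by
    have : ContinuousAt (fun y => |G y - G x| + |c y - c x|) x :=
      (hG.sub continuousAt_const).abs.add (hc.sub continuousAt_const).abs
    simpa [ContinuousAt] using this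
  filter_upwards [hx, h1.eventually (gt_mem_nhds hε)] with y hy hlt
  have := h.abs_sub_le (mem_of_mem_nhds hx) hy
  rw [Real.norm_eq_abs, Real.norm_eq_abs, smul_eq_mul, mul_comm ε]
  exact this.trans (mul_le_mul_of_nonneg_left hlt.le (abs_nonneg _))

/-- A continuous function taking its values on a dense set among those of finitely many functions
of small oscillation has small oscillation. -/
lemma abs_sub_le_sum_of_dense_range {κ : Type*} [Fintype κ] {w : ℝ → ℝ} {d : κ → ℝ → ℝ}
    {η : κ → ℝ} {a b : ℝ} (hab : a ≤ b) (hw : ContinuousOn w (Icc a b))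
    (hd : ∀ u v, a ≤ u → u < v → v ≤ b → ∃ x ∈ Ioo u v, ∃ k, w x = d k x)
    (hη : ∀ k, ∀ x ∈ Icc a b, ∀ y ∈ Icc a b, |d k x - d k y| ≤ η k) :
    |w b - w a| ≤ ∑ k, η k := by
  have hη0 : ∀ k, 0 ≤ η k := fun k => (abs_nonneg _).trans
    (hη k a (left_mem_Icc.2 hab) a (left_mem_Icc.2 hab))
  rcases hab.eq_or_lt with rfl | hlt
  · simpa using Finset.sum_nonneg fun k _ => hη0 k
  have hne : ∀ k, (d k '' Icc a b).Nonempty := fun k => ⟨_, mem_image_of_mem _ (left_mem_Icc.2 hab)⟩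
  have hle : ∀ k, ∀ x ∈ Icc a b, ∀ y ∈ Icc a b, d k x ≤ d k y + η k := fun k x hx y hy => by
    linarith [(abs_le.1 (hη k x hx y hy)).2]
  have hbb : ∀ k, BddBelow (d k '' Icc a b) := fun k => by
    refine ⟨d k a - η k, ?_⟩
    rintro _ ⟨x, hx, rfl⟩
    linarith [hle k a (left_mem_Icc.2 hab) x hx]
  have hsub : ∀ k, ∀ x ∈ Icc a b,
      d k x ∈ Icc (sInf (d k '' Icc a b)) (sInf (d k '' Icc a b) + η k) := by
    intro k x hx
    refine ⟨csInf_le (hbb k) (mem_image_of_mem _ hx), ?_⟩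
    rw [← sub_le_iff_le_add]
    refine le_csInf (hne k) ?_
    rintro _ ⟨y, hy, rfl⟩
    linarith [hle k x hx y hy]
  set F : Set ℝ := ⋃ k, Icc (sInf (d k '' Icc a b)) (sInf (d k '' Icc a b) + η k) with hF
  have hFc : IsClosed F := isClosed_iUnion_of_finite fun k => isClosed_Icc
  set D : Set ℝ := {x ∈ Icc a b | ∃ k, w x = d k x} with hD
  have hDF : MapsTo w D F := by
    rintro x ⟨hx, k, hk⟩
    rw [hk]
    exact mem_iUnion.2 ⟨k, hsub k x hx⟩
  have hdense : Icc a b ⊆ closure D := by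
    intro x hx
    rw [Metric.mem_closure_iff]
    intro ε hε
    obtain ⟨u, v, hu, huv, hv, huvx⟩ : ∃ u v, a ≤ u ∧ u < v ∧ v ≤ b ∧
        Ioo u v ⊆ Metric.ball x ε := by
      refine ⟨max a (x - ε), min b (x + ε), le_max_left _ _, ?_, min_le_left _ _, ?_⟩
      · rw [max_lt_iff, lt_min_iff, lt_min_iff]
        exact ⟨⟨hlt, by linarith [hx.1]⟩, by linarith [hx.2], by linarith⟩
      · intro y hy
        rw [Metric.mem_ball, Real.dist_eq, abs_lt]
        have h1 := (le_max_right a (x - ε)).trans_lt hy.1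
        have h2 := hy.2.trans_le (min_le_right b (x + ε))
        constructor <;> linarith
    obtain ⟨y, hy, k, hk⟩ := hd u v hu huv hv
    refine ⟨y, ⟨⟨hu.trans hy.1.le, hy.2.le.trans hv⟩, k, hk⟩, ?_⟩
    rw [dist_comm]
    exact huvx hy
  have hmaps : MapsTo w (Icc a b) F := by
    intro x hx
    have h1 : ContinuousWithinAt w D x := (hw x hx).mono fun y hy => hy.1
    have := h1.mem_closure (hdense hx) hDF
    rwa [hFc.closure_eq] at this
  have hiv : uIcc (w a) (w b) ⊆ F := by
    have := intermediate_value_uIcc (a := a) (b := b) (f := w) (by rwa [uIcc_of_le hab])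
    refine this.trans ?_
    rw [uIcc_of_le hab]
    exact hmaps.image_subset
  have hvol := measure_mono (μ := volume) hiv
  rw [uIcc, Real.volume_Icc, max_sub_min_eq_abs] at hvol
  have h2 : volume F ≤ ENNReal.ofReal (∑ k, η k) := by
    refine (measure_iUnion_fintype_le _ _).trans ?_
    rw [ENNReal.ofReal_sum_of_nonneg fun k _ => hη0 k]
    refine Finset.sum_le_sum fun k _ => ?_
    rw [Real.volume_Icc, add_sub_cancel_left]
  exact (ENNReal.ofReal_le_ofReal_iff (Finset.sum_nonneg fun k _ => hη0 k)).1 (hvol.trans h2)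

lemma exists_Ioo_eqOn_of_forall_exists_eq {κ : Type*} [Fintype κ] {u v : ℝ} (huv : u < v)
    {l : ℝ → ℝ} {e : κ → ℝ → ℝ} (hl : ContinuousOn l (Ioo u v))
    (he : ∀ k, ContinuousOn (e k) (Ioo u v)) (h : ∀ x ∈ Ioo u v, ∃ k, l x = e k x) :
    ∃ u' v', u ≤ u' ∧ u' < v' ∧ v' ≤ v ∧ ∃ k, ∀ x ∈ Ioo u' v', l x = e k x := by
  classical
  by_contra! hcon
  have key : ∀ S : Finset κ, ∃ u' v', u ≤ u' ∧ u' < v' ∧ v' ≤ v ∧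
      ∀ k ∈ S, ∀ x ∈ Ioo u' v', l x ≠ e k x := by
    intro S
    induction S using Finset.induction_on with
    | empty => exact ⟨u, v, le_rfl, huv, le_rfl, by simp⟩
    | insert k S hk ih =>
      obtain ⟨u', v', h1, h2, h3, h4⟩ := ih
      obtain ⟨x, hx, hxne⟩ := hcon u' v' h1 h2 h3 k
      have hsub : Ioo u' v' ⊆ Ioo u v := Ioo_subset_Ioo h1 h3
      have hopen : {y | l y ≠ e k y} ∩ Ioo u' v' ∈ 𝓝 x := by
        have hn := Ioo_mem_nhds hx.1 hx.2
        have c1 : ContinuousAt l x := (hl.mono hsub).continuousAt hn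
        have c2 : ContinuousAt (e k) x := ((he k).mono hsub).continuousAt hn
        exact inter_mem ((c1.sub c2).eventually_ne (sub_ne_zero.2 hxne) |>.mono
          fun y hy => sub_ne_zero.1 hy) hn
      obtain ⟨p, q, hpq, hpqs⟩ := mem_nhds_iff_exists_Ioo_subset.1 hopen
      have hxpq := hpq
      refine ⟨max p u', min q v', h1.trans (le_max_right _ _), ?_, (min_le_right _ _).trans h3, ?_⟩
      · rw [max_lt_iff, lt_min_iff, lt_min_iff]
        exact ⟨⟨hxpq.1.trans hxpq.2, hxpq.1.trans hx.2⟩, hx.1.trans hxpq.2, h2⟩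
      · intro j hj y hy
        have hy1 : y ∈ Ioo p q := ⟨(le_max_left _ _).trans_lt hy.1, hy.2.trans_le (min_le_left _ _)⟩
        have hy2 : y ∈ Ioo u' v' :=
          ⟨(le_max_right _ _).trans_lt hy.1, hy.2.trans_le (min_le_right _ _)⟩
        rcases Finset.mem_insert.1 hj with rfl | hj
        · exact (hpqs hy1).1
        · exact h4 j hj y hy2
  obtain ⟨u', v', h1, h2, h3, h4⟩ := key Finset.univ
  obtain ⟨x, hx⟩ := nonempty_Ioo.2 h2
  obtain ⟨k, hk⟩ := h x ⟨h1.trans_lt hx.1, hx.2.trans_le h3⟩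
  exact h4 k (Finset.mem_univ k) x hx hk

end Semiconvex

section HermitianCurve

open Filter

/-- A `C¹` curve of Hermitian matrices on `s`, with the modulus of continuity of its derivative
controlled by the monotone continuous function `G`. -/
structure IsHermitianCurve {n : ℕ} (s : Set ℝ) (H H' : ℝ → Matrix (Fin n) (Fin n) ℂ)
    (G : ℝ → ℝ) : Prop where
  isHermitian : ∀ t ∈ s, (H t).IsHermitian
  hasDeriv : ∀ i j, ∀ t ∈ s, HasDerivWithinAt (fun t => H t i j) (H' t i j) s t
  mono : MonotoneOn G s
  continuousOn : ContinuousOn G s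
  modulus : ∀ x ∈ s, ∀ y ∈ s, x ≤ y → entrySum (H' y - H' x) ≤ G y - G x

variable {n : ℕ} {s : Set ℝ} {H H' : ℝ → Matrix (Fin n) (Fin n) ℂ} {G : ℝ → ℝ}

lemma IsHermitianCurve.entrySum_deriv_sub_le (h : IsHermitianCurve s H H' G) {x y : ℝ}
    (hx : x ∈ s) (hy : y ∈ s) : entrySum (H' y - H' x) ≤ |G y - G x| := by
  rcases le_total x y with hxy | hxy
  · exact (h.modulus x hx y hy hxy).trans (le_abs_self _)
  · rw [entrySum_sub_comm, abs_sub_comm]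
    exact (h.modulus y hy x hx hxy).trans (le_abs_self _)

lemma IsHermitianCurve.entrySum_taylor_le (h : IsHermitianCurve s H H' G) (hs : Convex ℝ s)
    {x t : ℝ} (hx : x ∈ s) (ht : t ∈ s) :
    entrySum (H t - H x - (t - x) • H' x) ≤ (n : ℝ) ^ 2 * (|t - x| * |G t - G x|) := by
  have hentry : ∀ i j, ‖(H t - H x - (t - x) • H' x) i j‖ ≤ |t - x| * |G t - G x| := by
    intro i j
    have hsub : segment ℝ x t ⊆ s := hs.segment_subset hx ht
    have hd : ∀ u ∈ segment ℝ x t, HasDerivWithinAt (fun u => H u i j - (u - x) • H' x i j)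
        (H' u i j - H' x i j) (segment ℝ x t) u := by
      intro u hu
      have h1 := (h.hasDeriv i j u (hsub hu)).mono hsub
      have h2 := (((hasDerivAt_id u).sub_const x).smul_const (H' x i j)).hasDerivWithinAt
        (s := segment ℝ x t)
      rw [one_smul] at h2
      exact h1.fun_sub h2
    have hb : ∀ u ∈ segment ℝ x t, ‖H' u i j - H' x i j‖ ≤ |G t - G x| := by
      intro u hu
      have h1 := (norm_le_entrySum (H' u - H' x) i j).trans
        (h.entrySum_deriv_sub_le hx (hsub hu))
      refine h1.trans ?_
      rw [segment_eq_uIcc] at hu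
      have hus : u ∈ s := hsub (by rwa [segment_eq_uIcc])
      rcases le_total x t with hxt | hxt
      · rw [uIcc_of_le hxt] at hu
        rw [abs_of_nonneg (sub_nonneg.2 (h.mono hx hus hu.1)),
          abs_of_nonneg (sub_nonneg.2 (h.mono hx ht hxt))]
        linarith [h.mono hus ht hu.2]
      · rw [uIcc_of_ge hxt] at hu
        rw [abs_of_nonpos (sub_nonpos.2 (h.mono hus hx hu.2)),
          abs_of_nonpos (sub_nonpos.2 (h.mono ht hx hxt))]
        linarith [h.mono ht hus hu.1]
    have := (convex_segment x t).norm_image_sub_le_of_norm_hasDerivWithin_le hd hb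
      (left_mem_segment ℝ x t) (right_mem_segment ℝ x t)
    rw [Real.norm_eq_abs, mul_comm] at this
    have he : (H t - H x - (t - x) • H' x) i j
        = H t i j - (t - x) • H' x i j - (H x i j - (x - x) • H' x i j) := by
      simp only [Matrix.sub_apply, Matrix.smul_apply, sub_self, zero_smul, sub_zero]
      abel
    rwa [he]
  calc entrySum (H t - H x - (t - x) • H' x)
      ≤ ∑ _i : Fin n, ∑ _j : Fin n, |t - x| * |G t - G x| :=
        Finset.sum_le_sum fun i _ => Finset.sum_le_sum fun j _ => hentry i j
    _ = _ := by simp; ring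

/-- The sums of the largest eigenvalues along a Hermitian curve are semiconvex. -/
lemma IsHermitianCurve.exists_subgradient (h : IsHermitianCurve s H H' G) (hs : Convex ℝ s) :
    ∃ c : ℕ → ℝ → ℝ, (∀ k, ∀ t ∈ s, |c k t| ≤ n * entrySum (H' t)) ∧
      ∀ k, IsSubgradientOn s (fun t => topEigSum (H t) k) (c k) (fun t => (n : ℝ) ^ 3 * G t) := by
  have hb : ∀ t, ∃ b : OrthonormalBasis (Fin n) ℂ (EuclideanSpace ℂ (Fin n)), t ∈ s →
      ∀ k, Matrix.toEuclideanLin (H t) (b k) = (sortedEig (H t) k : ℂ) • b k := by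
    intro t
    by_cases ht : t ∈ s
    · obtain ⟨b, hb⟩ := exists_eigenbasis (h.isHermitian t ht)
      exact ⟨b, fun _ => hb⟩
    · exact ⟨EuclideanSpace.basisFun _ _, fun h => absurd h ht⟩
  choose b hb using hb
  have hcard : ∀ (k : ℕ) (M : Matrix (Fin n) (Fin n) ℂ)
      (e : OrthonormalBasis (Fin n) ℂ (EuclideanSpace ℂ (Fin n))),
      |∑ j : Fin n with j.val < k, quadForm M (e j)| ≤ n * entrySum M := by
    intro k M e
    calc |∑ j : Fin n with j.val < k, quadForm M (e j)|
        ≤ ∑ j : Fin n with j.val < k, |quadForm M (e j)| := Finset.abs_sum_le_sum_abs _ _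
      _ ≤ ∑ j : Fin n, |quadForm M (e j)| :=
          Finset.sum_le_sum_of_subset_of_nonneg (Finset.filter_subset _ _)
            (fun _ _ _ => abs_nonneg _)
      _ ≤ ∑ j : Fin n, entrySum M :=
          Finset.sum_le_sum fun j _ => abs_quadForm_le _ (e.norm_eq_one j)
      _ = _ := by simp
  refine ⟨fun k t => ∑ j : Fin n with j.val < k, quadForm (H' t) (b t j),
    fun k t _ => hcard k _ _, fun k x hx t ht => ?_⟩
  have h1 := sum_quadForm_le_topEigSum (h.isHermitian t ht) (b x) k
  have h2 := topEigSum_eq_sum_quadForm (hb x hx) k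
  have h3 := hcard k (H t - H x - (t - x) • H' x) (b x)
  have h4 := h.entrySum_taylor_le hs hx ht
  simp only [quadForm_sub, quadForm_smul, Finset.sum_sub_distrib, ← Finset.mul_sum] at h3
  have h5 := (abs_le.1 h3).1
  have h6 : (n : ℝ) * entrySum (H t - H x - (t - x) • H' x)
      ≤ n * ((n : ℝ) ^ 2 * (|t - x| * |G t - G x|)) := by gcongr
  have h7 : |(n : ℝ) ^ 3 * G t - (n : ℝ) ^ 3 * G x| = (n : ℝ) ^ 3 * |G t - G x| := by
    rw [← mul_sub, abs_mul, abs_of_nonneg (by positivity : (0 : ℝ) ≤ (n : ℝ) ^ 3)]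
  simp only [h7]
  nlinarith

/-- The derivatives of a `C¹` system of eigenvalues are bounded and dominated by a monotone
function with controlled total increment. -/
theorem IsHermitianCurve.exists_variation_bound {a b L Γ : ℝ} (hab : a < b)
    (h : IsHermitianCurve (Icc a b) H H' G) (hL : ∀ t ∈ Icc a b, entrySum (H' t) ≤ L)
    (hΓ : G b - G a ≤ Γ) {ι : Type*} {lam w : ι → ℝ → ℝ}
    (hlam : ∀ i, ∀ t ∈ Icc a b, HasDerivWithinAt (lam i) (w i t) (Icc a b) t)
    (hw : ∀ i, ContinuousOn (w i) (Icc a b))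
    (heig : ∀ i, ∀ t ∈ Icc a b, ∃ k, lam i t = sortedEig (H t) k) :
    (∀ i, ∀ t ∈ Icc a b, |w i t| ≤ 2 * (n * L)) ∧
    ∃ V : ℝ → ℝ, MonotoneOn V (Icc a b) ∧
      (∀ i, ∀ x ∈ Icc a b, ∀ t ∈ Icc a b, x ≤ t → |w i t - w i x| ≤ V t - V x) ∧
      V b - V a ≤ 2 * n * (2 * (n * L) + 2 * ((n : ℝ) ^ 3 * Γ)) := by
  obtain ⟨c, hcb, hc⟩ := h.exists_subgradient (convex_Icc a b)
  set G' : ℝ → ℝ := fun t => (n : ℝ) ^ 3 * G t with hG'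
  have hG'm : MonotoneOn G' (Icc a b) := fun x hx y hy hxy =>
    mul_le_mul_of_nonneg_left (h.mono hx hy hxy) (by positivity)
  have hG'c : ContinuousOn G' (Icc a b) := continuousOn_const.mul h.continuousOn
  set m : ℕ → ℝ → ℝ := fun k t => c k t + 2 * G' t with hm
  have hmm : ∀ k, MonotoneOn (m k) (Icc a b) := fun k => (hc k).monotoneOn hG'm
  have hcL : ∀ k, ∀ t ∈ Icc a b, |c k t| ≤ n * L := fun k t ht =>
    (hcb k t ht).trans (mul_le_mul_of_nonneg_left (hL t ht) (Nat.cast_nonneg n))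
  have hHc : ∀ i j, ContinuousOn (fun t => H t i j) (Icc a b) := fun i j t ht =>
    (h.hasDeriv i j t ht).continuousWithinAt
  have hec : ∀ k, ContinuousOn (fun t => sortedEig (H t) k) (Icc a b) :=
    continuousOn_sortedEig hHc h.isHermitian
  have hdense : ∀ i, ∀ u v, a ≤ u → u < v → v ≤ b →
      ∃ x ∈ Ioo u v, ∃ k : Fin n, w i x = c (k + 1) x - c k x := by
    intro i u v hu huv hv
    have hsub : Ioo u v ⊆ Icc a b := fun x hx => ⟨hu.trans hx.1.le, hx.2.le.trans hv⟩
    obtain ⟨u', v', h1, h2, h3, k, hk⟩ := exists_Ioo_eqOn_of_forall_exists_eq huv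
      (fun t ht => ((hlam i t (hsub ht)).continuousWithinAt).mono hsub)
      (fun k => (hec k).mono hsub) (fun x hx => heig i x (hsub hx))
    have hcount : (⋃ k, {x ∈ Icc a b | ¬ ContinuousWithinAt (m k) (Icc a b) x}).Countable :=
      countable_iUnion fun k => (hmm k).countable_not_continuousWithinAt
    obtain ⟨x, hx, hxc⟩ : ∃ x ∈ Ioo u' v',
        x ∉ ⋃ k, {x ∈ Icc a b | ¬ ContinuousWithinAt (m k) (Icc a b) x} := by
      by_contra! hcon
      have := hcount.mono (fun x hx => hcon x hx : Ioo u' v' ⊆ _)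
      exact (Cardinal.Real.Ioo_countable_iff.1 this).not_gt h2
    have hxI : x ∈ Ioo u v := ⟨h1.trans_lt hx.1, hx.2.trans_le h3⟩
    have hxs : x ∈ Icc a b := hsub hxI
    have hnhds : Icc a b ∈ 𝓝 x := Icc_mem_nhds (hu.trans_lt hxI.1) (hxI.2.trans_le hv)
    have hGx : ContinuousAt G' x := hG'c.continuousAt hnhds
    have hcx : ∀ k, ContinuousAt (c k) x := by
      intro k
      have h4 : ContinuousWithinAt (m k) (Icc a b) x := by
        by_contra hcon
        exact hxc (mem_iUnion.2 ⟨k, hxs, hcon⟩)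
      have h5 := (h4.continuousAt hnhds).sub (hGx.const_mul 2)
      refine h5.congr (Eventually.of_forall fun y => ?_)
      simp [hm]
    have hd1 := ((hc (k + 1)).hasDerivAt hnhds (hcx _) hGx).fun_sub
      ((hc k).hasDerivAt hnhds (hcx _) hGx)
    have hd2 := (hlam i x hxs).hasDerivAt hnhds
    have heq : lam i =ᶠ[𝓝 x] fun t => topEigSum (H t) (k + 1) - topEigSum (H t) k := by
      filter_upwards [Ioo_mem_nhds hx.1 hx.2] with y hy
      rw [hk y hy, sortedEig_eq_sub]
    exact ⟨x, hxI, k, hd2.unique (hd1.congr_of_eventuallyEq heq)⟩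
  refine ⟨fun i t ht => ?_, fun t => ∑ k : Fin n, (m (k + 1) t + m k t), ?_, ?_, ?_⟩
  · have hclosure : t ∈ closure {x ∈ Icc a b | |w i x| ≤ 2 * (n * L)} := by
      rw [Metric.mem_closure_iff]
      intro ε hε
      obtain ⟨x, hx, k, hk⟩ := hdense i (max a (t - ε)) (min b (t + ε)) (le_max_left _ _)
        (by
          rw [max_lt_iff, lt_min_iff, lt_min_iff]
          exact ⟨⟨hab, by linarith [ht.1]⟩, by linarith [ht.2], by linarith⟩) (min_le_left _ _)
      have hx1 := (le_max_left a (t - ε)).trans_lt hx.1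
      have hx2 := (le_max_right a (t - ε)).trans_lt hx.1
      have hx3 := hx.2.trans_le (min_le_left b (t + ε))
      have hx4 := hx.2.trans_le (min_le_right b (t + ε))
      have hxs : x ∈ Icc a b := ⟨hx1.le, hx3.le⟩
      refine ⟨x, ⟨hxs, ?_⟩, ?_⟩
      · rw [hk]
        refine (abs_sub _ _).trans ?_
        linarith [hcL (k + 1) x hxs, hcL k x hxs]
      · rw [Real.dist_eq, abs_lt]
        constructor <;> linarith
    have hcont : ContinuousWithinAt (fun x => |w i x|) {x ∈ Icc a b | |w i x| ≤ 2 * (n * L)} t :=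
      ((hw i t ht).mono fun x hx => hx.1).abs
    have := hcont.mem_closure hclosure (t := Iic (2 * (n * L))) fun x hx => hx.2
    rwa [isClosed_Iic.closure_eq] at this
  · intro x hx y hy hxy
    exact Finset.sum_le_sum fun k _ => add_le_add (hmm _ hx hy hxy) (hmm _ hx hy hxy)
  · intro i x hx t ht hxt
    have hsub : Icc x t ⊆ Icc a b := Icc_subset_Icc hx.1 ht.2
    have := abs_sub_le_sum_of_dense_range (d := fun (k : Fin n) x => c (k + 1) x - c k x)
      (η := fun k : Fin n => (m (k + 1) t + m k t) - (m (k + 1) x + m k x)) hxt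
      ((hw i).mono hsub)
      (fun u v hu huv hv => hdense i u v (hx.1.trans hu) huv (hv.trans ht.2)) ?_
    · rwa [Finset.sum_sub_distrib] at this
    · intro k y hy z hz
      have e1 : ∀ k, ∀ y ∈ Icc x t, m k x ≤ m k y ∧ m k y ≤ m k t := fun k y hy =>
        ⟨hmm k hx (hsub hy) hy.1, hmm k (hsub hy) ht hy.2⟩
      have e2 : c (k + 1) y - c k y - (c (k + 1) z - c k z)
          = (m (k + 1) y - m (k + 1) z) - (m k y - m k z) := by simp only [hm]; ring
      rw [e2, abs_le]
      have a1 := e1 (k + 1) y hy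
      have a2 := e1 (k + 1) z hz
      have a3 := e1 k y hy
      have a4 := e1 k z hz
      constructor <;> linarith
  · rw [← Finset.sum_sub_distrib]
    have hgb : G' b - G' a ≤ (n : ℝ) ^ 3 * Γ := by
      simp only [hG']; rw [← mul_sub]; gcongr
    have hk : ∀ k, m k b - m k a ≤ 2 * (n * L) + 2 * ((n : ℝ) ^ 3 * Γ) := by
      intro k
      have h1 := (abs_le.1 (hcL k b (right_mem_Icc.2 hab.le))).2
      have h2 := (abs_le.1 (hcL k a (left_mem_Icc.2 hab.le))).1
      simp only [hm]
      linarith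
    calc ∑ k : Fin n, (m (k + 1) b + m k b - (m (k + 1) a + m k a))
        ≤ ∑ k : Fin n, 2 * (2 * (n * L) + 2 * ((n : ℝ) ^ 3 * Γ)) :=
          Finset.sum_le_sum fun k _ => by linarith [hk (k + 1), hk k]
      _ = _ := by simp; ring

end HermitianCurve

section ACHelpers

open Filter

lemma AbsolutelyContinuousOnInterval.of_dist_le {X Y : Type*} [PseudoMetricSpace X]
    [PseudoMetricSpace Y] {f : ℝ → X} {g : ℝ → Y} {a b : ℝ}
    (hf : AbsolutelyContinuousOnInterval f a b)
    (h : ∀ x ∈ uIcc a b, ∀ y ∈ uIcc a b, dist (g x) (g y) ≤ dist (f x) (f y)) :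
    AbsolutelyContinuousOnInterval g a b := by
  rw [absolutelyContinuousOnInterval_iff] at hf ⊢
  intro ε hε
  obtain ⟨δ, hδ, hf⟩ := hf ε hε
  refine ⟨δ, hδ, fun E hE hs => lt_of_le_of_lt ?_ (hf E hE hs)⟩
  exact Finset.sum_le_sum fun i hi => h _ (hE.1 i hi).1 _ (hE.1 i hi).2

lemma AbsolutelyContinuousOnInterval.finsetSum {F ι : Type*} [NormedAddCommGroup F]
    {f : ι → ℝ → F} {a b : ℝ} (s : Finset ι)
    (hf : ∀ i ∈ s, AbsolutelyContinuousOnInterval (f i) a b) :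
    AbsolutelyContinuousOnInterval (fun t => ∑ i ∈ s, f i t) a b := by
  classical
  induction s using Finset.induction_on with
  | empty =>
    simpa using
      ((LipschitzWith.const (0 : F)).lipschitzOnWith (s := uIcc a b)).absolutelyContinuousOnInterval
  | insert i s hi ih =>
    simp_rw [Finset.sum_insert hi]
    exact (hf i (Finset.mem_insert_self _ _)).add
      (ih fun j hj => hf j (Finset.mem_insert_of_mem hj))

/-- `f` is differentiable on `[a, b]` with absolutely continuous derivative `f'`. -/
structure HasACDeriv {F : Type*} [NormedField F] [NormedAlgebra ℝ F] (a b : ℝ)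
    (f f' : ℝ → F) : Prop where
  hasDeriv : ∀ t ∈ Icc a b, HasDerivWithinAt f (f' t) (Icc a b) t
  ac : AbsolutelyContinuousOnInterval f' a b

variable {F : Type*} [NormedField F] [NormedAlgebra ℝ F] {a b : ℝ} {f f' g g' : ℝ → F}

lemma HasACDeriv.self_ac (hab : a ≤ b) (h : HasACDeriv a b f f') :
    AbsolutelyContinuousOnInterval f a b := by
  obtain ⟨C, hC⟩ := h.ac.exists_bound
  rw [uIcc_of_le hab] at hC
  have hC0 : 0 ≤ C := (norm_nonneg _).trans (hC a (left_mem_Icc.2 hab))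
  have : LipschitzOnWith ⟨C, hC0⟩ f (uIcc a b) := by
    rw [uIcc_of_le hab]
    exact (convex_Icc a b).lipschitzOnWith_of_nnnorm_hasDerivWithin_le h.hasDeriv
      fun x hx => hC x hx
  exact this.absolutelyContinuousOnInterval

lemma hasACDeriv_const (c : F) : HasACDeriv a b (fun _ => c) fun _ => 0 where
  hasDeriv _ _ := hasDerivWithinAt_const _ _ _
  ac := ((LipschitzWith.const (0 : F)).lipschitzOnWith
    (s := uIcc a b)).absolutelyContinuousOnInterval

lemma HasACDeriv.mul (hab : a ≤ b) (hf : HasACDeriv a b f f') (hg : HasACDeriv a b g g') :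
    HasACDeriv a b (fun t => f t * g t) fun t => f' t * g t + f t * g' t where
  hasDeriv t ht := (hf.hasDeriv t ht).mul (hg.hasDeriv t ht)
  ac := by
    have h1 := AbsolutelyContinuousOnInterval.smul (M := F) (F := F) hf.ac (hg.self_ac hab)
    have h2 := AbsolutelyContinuousOnInterval.smul (M := F) (F := F) (hf.self_ac hab) hg.ac
    exact h1.add h2

lemma HasACDeriv.finsetSum {ι : Type*} {f f' : ι → ℝ → F} (s : Finset ι)
    (h : ∀ i ∈ s, HasACDeriv a b (f i) (f' i)) :
    HasACDeriv a b (fun t => ∑ i ∈ s, f i t) fun t => ∑ i ∈ s, f' i t where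
  hasDeriv t ht := HasDerivWithinAt.fun_sum fun i hi => (h i hi).hasDeriv t ht
  ac := .finsetSum s fun i hi => (h i hi).ac

lemma HasACDeriv.conj {f f' : ℝ → ℂ} (h : HasACDeriv a b f f') :
    HasACDeriv a b (fun t => (starRingEnd ℂ) (f t)) fun t => (starRingEnd ℂ) (f' t) where
  hasDeriv t ht := by
    have := Complex.conjCLE.hasFDerivAt (x := f t) |>.comp_hasDerivWithinAt t (h.hasDeriv t ht)
    exact this
  ac := h.ac.of_dist_le fun x _ y _ => by
    rw [dist_eq_norm, dist_eq_norm, ← map_sub, RCLike.norm_conj]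

lemma HasACDeriv.re {f f' : ℝ → ℂ} (h : HasACDeriv a b f f') :
    HasACDeriv a b (fun t => (f t).re) fun t => (f' t).re where
  hasDeriv t ht := by
    have := Complex.reCLM.hasFDerivAt (x := f t) |>.comp_hasDerivWithinAt t (h.hasDeriv t ht)
    exact this
  ac := h.ac.of_dist_le fun x _ y _ => by
    rw [dist_eq_norm, dist_eq_norm, ← Complex.sub_re, Real.norm_eq_abs]
    exact Complex.abs_re_le_norm _

lemma exists_hasACDeriv_pow {n : ℕ} (hab : a ≤ b) {H H' : ℝ → Matrix (Fin n) (Fin n) ℂ}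
    (h : ∀ i j, HasACDeriv a b (fun t => H t i j) fun t => H' t i j) (q : ℕ) :
    ∃ P : ℝ → Matrix (Fin n) (Fin n) ℂ,
      ∀ i j, HasACDeriv a b (fun t => (H t ^ q) i j) fun t => P t i j := by
  induction q with
  | zero => exact ⟨fun _ => 0, fun i j => by simpa using hasACDeriv_const _⟩
  | succ q ih =>
    obtain ⟨P, hP⟩ := ih
    refine ⟨fun t => Matrix.of fun i j =>
      ∑ k, (P t i k * H t k j + (H t ^ q) i k * H' t k j), fun i j => ?_⟩
    simp_rw [pow_succ, Matrix.mul_apply, Matrix.of_apply]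
    exact HasACDeriv.finsetSum _ fun k _ => (hP i k).mul hab (h k j)

lemma exists_hasACDeriv_trace_pow {n : ℕ} (hab : a ≤ b) {H H' : ℝ → Matrix (Fin n) (Fin n) ℂ}
    (h : ∀ i j, HasACDeriv a b (fun t => H t i j) fun t => H' t i j) (q : ℕ) :
    ∃ p : ℝ → ℝ, HasACDeriv a b (fun t => ((H t ^ q).trace).re) p := by
  obtain ⟨P, hP⟩ := exists_hasACDeriv_pow hab h q
  exact ⟨_, (HasACDeriv.finsetSum Finset.univ fun i _ => hP i i).re⟩

lemma integral_abs_deriv_le {w V : ℝ → ℝ} (hab : a ≤ b) (hV : MonotoneOn V (Icc a b))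
    (hw : AbsolutelyContinuousOnInterval w a b)
    (hwV : ∀ s ∈ Icc a b, ∀ t ∈ Icc a b, s ≤ t → |w t - w s| ≤ V t - V s) :
    ∫ t in a..b, |deriv w t| ≤ V b - V a := by
  have hV' : MonotoneOn V (uIcc a b) := by rwa [uIcc_of_le hab]
  have h1 := hV'.intervalIntegral_deriv_mem_uIcc
  rw [uIcc_of_le (sub_nonneg.2 (hV (left_mem_Icc.2 hab) (right_mem_Icc.2 hab) hab))] at h1
  refine le_trans ?_ h1.2
  refine intervalIntegral.integral_mono_ae_restrict hab hw.intervalIntegrable_deriv.abs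
    hV'.intervalIntegrable_deriv ?_
  rw [EventuallyLE, ← restrict_Ioo_eq_restrict_Icc, ae_restrict_iff' measurableSet_Ioo]
  filter_upwards [hw.ae_differentiableAt, hV.ae_differentiableWithinAt_of_mem] with x h2 h3 hx
  have hxI := Ioo_subset_Icc_self hx
  have h4 := (h2 (by rwa [uIcc_of_le hab])).hasDerivAt
  have h5 := ((h3 hxI).differentiableAt (Icc_mem_nhds hx.1 hx.2)).hasDerivAt
  have h6 := h4.tendsto_slope.abs
  refine le_of_tendsto_of_tendsto h6 h5.tendsto_slope ?_
  filter_upwards [mem_nhdsWithin_of_mem_nhds (Icc_mem_nhds hx.1 hx.2), self_mem_nhdsWithin]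
    with y hy hne
  rcases lt_or_gt_of_ne (show y ≠ x from hne) with hlt | hlt
  · rw [slope_comm, slope_comm V, slope_def_field, slope_def_field, abs_div,
      abs_of_pos (sub_pos.2 hlt)]
    exact div_le_div_of_nonneg_right (hwV y hy x hxI hlt.le) (sub_pos.2 hlt).le
  · rw [slope_def_field, slope_def_field, abs_div, abs_of_pos (sub_pos.2 hlt)]
    exact div_le_div_of_nonneg_right (hwV x hxI y hy hlt.le) (sub_pos.2 hlt).le

end ACHelpers

section SingularTuple

variable {m n : ℕ}

lemma LinearMap.IsSymmetric.eigenvalues_congr {E : Type*} [NormedAddCommGroup E]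
    [InnerProductSpace ℂ E] [FiniteDimensional ℂ E] {S T : E →ₗ[ℂ] E} (hS : S.IsSymmetric)
    (hT : T.IsSymmetric) (h : S = T) (hn : Module.finrank ℂ E = n) :
    hS.eigenvalues hn = hT.eigenvalues hn := by
  subst h; rfl

lemma toEuclideanLin_gram (M : Matrix (Fin m) (Fin n) ℂ) :
    Matrix.toEuclideanLin (M.conjTranspose * M)
      = LinearMap.adjoint (Matrix.toEuclideanLin M) ∘ₗ Matrix.toEuclideanLin M := by
  rw [← Matrix.toEuclideanLin_conjTranspose_eq_adjoint]
  ext v : 1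
  simp [Matrix.toLpLin_apply]

lemma sortedEig_gram (M : Matrix (Fin m) (Fin n) ℂ) (k : Fin n) :
    sortedEig (M.conjTranspose * M) k = (Matrix.toEuclideanLin M).singularValues k ^ 2 := by
  have hH : (M.conjTranspose * M).IsHermitian := Matrix.isHermitian_conjTranspose_mul_self M
  have h1 := (Matrix.toEuclideanLin M).sq_singularValues_fin finrank_euclideanSpace_fin k
  have h2 : sortedEig (M.conjTranspose * M) k =
      (Matrix.isSymmetric_toEuclideanLin_iff.mpr hH).eigenvalues finrank_euclideanSpace_fin k := by
    rw [sortedEig, dif_pos hH]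
  rw [h1, h2]
  exact congrFun (LinearMap.IsSymmetric.eigenvalues_congr _ _ (toEuclideanLin_gram M) _) k

lemma singularValues_eq_zero_of_min_le (M : Matrix (Fin m) (Fin n) ℂ) {k : ℕ}
    (hk : min m n ≤ k) : (Matrix.toEuclideanLin M).singularValues k = 0 := by
  rw [LinearMap.singularValues_eq_zero_iff_le_finrank_range]
  refine le_trans (le_min ?_ ?_) hk
  · exact (Submodule.finrank_le _).trans (by simp)
  · exact (LinearMap.finrank_range_le _).trans (by simp)

lemma finrank_range_toEuclideanLin (M : Matrix (Fin m) (Fin n) ℂ) :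
    Module.finrank ℂ (LinearMap.range (Matrix.toEuclideanLin M)) = M.rank := by
  rw [Matrix.rank_eq_finrank_range_toLin M (PiLp.basisFun 2 ℂ (Fin m)) (PiLp.basisFun 2 ℂ (Fin n))]
  rw [← Matrix.toLpLin_eq_toLin]

lemma singularValues_pos_of_rank {M : Matrix (Fin m) (Fin n) ℂ} (hM : M.rank = min m n) {k : ℕ}
    (hk : k < min m n) : 0 < (Matrix.toEuclideanLin M).singularValues k := by
  rw [LinearMap.singularValues_pos_iff_lt_finrank_range, finrank_range_toEuclideanLin, hM]
  exact hk

lemma sum_pow_singularValueTuple {M : Matrix (Fin m) (Fin n) ℂ}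
    {s : EuclideanSpace ℝ (Fin (min m n))} (hs : IsSingularValueTuple M s) (q : ℕ) :
    ∑ j, (s j ^ 2) ^ (q + 1) = (((M.conjTranspose * M) ^ (q + 1)).trace).re := by
  obtain ⟨π, hπ⟩ := hs
  rw [trace_pow_eq_sum (Matrix.isHermitian_conjTranspose_mul_self M)]
  simp_rw [hπ]
  rw [Equiv.sum_comp π fun j => ((Matrix.toEuclideanLin M).singularValues j ^ 2) ^ (q + 1)]
  have h1 : ∀ k : Fin n, ((sortedEig (M.conjTranspose * M) k : ℂ)) ^ (q + 1)
      = (((((Matrix.toEuclideanLin M).singularValues k ^ 2) ^ (q + 1) : ℝ)) : ℂ) := by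
    intro k; rw [sortedEig_gram]; push_cast; rfl
  simp_rw [h1]
  rw [← Complex.ofReal_sum, Complex.ofReal_re,
    Finset.sum_fin_eq_sum_range, Finset.sum_fin_eq_sum_range]
  refine Finset.sum_subset_zero_on_sdiff (Finset.range_mono (min_le_right m n)) ?_ ?_
  · intro k hk
    simp only [Finset.mem_sdiff, Finset.mem_range] at hk
    rw [dif_pos hk.1, singularValues_eq_zero_of_min_le M (not_lt.1 hk.2)]
    simp
  · intro k hk
    rw [Finset.mem_range] at hk
    rw [dif_pos hk, dif_pos (hk.trans_le (min_le_right _ _))]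

lemma sq_singularValueTuple {M : Matrix (Fin m) (Fin n) ℂ}
    {s : EuclideanSpace ℝ (Fin (min m n))} (hs : IsSingularValueTuple M s) (j : Fin (min m n)) :
    ∃ k, s j ^ 2 = sortedEig (M.conjTranspose * M) k := by
  obtain ⟨π, hπ⟩ := hs
  refine ⟨Fin.castLE (min_le_right m n) (π j), ?_⟩
  rw [sortedEig_gram, hπ]
  rfl

end SingularTuple

section Gram

open Filter

lemma entrySum_add_le {m n : ℕ} (P Q : Matrix (Fin m) (Fin n) ℂ) :
    entrySum (P + Q) ≤ entrySum P + entrySum Q := by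
  unfold entrySum
  rw [← Finset.sum_add_distrib]
  refine Finset.sum_le_sum fun i _ => ?_
  rw [← Finset.sum_add_distrib]
  exact Finset.sum_le_sum fun j _ => norm_add_le _ _

lemma entrySum_conjTranspose_mul_le {m n : ℕ} (P Q : Matrix (Fin m) (Fin n) ℂ) :
    entrySum (P.conjTranspose * Q) ≤ entrySum P * entrySum Q := by
  have h1 : entrySum (P.conjTranspose * Q) ≤ ∑ i, ∑ j, ∑ k, ‖P k i‖ * ‖Q k j‖ := by
    refine Finset.sum_le_sum fun i _ => Finset.sum_le_sum fun j _ => ?_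
    rw [Matrix.mul_apply]
    refine (norm_sum_le _ _).trans (Finset.sum_le_sum fun k _ => ?_)
    rw [Matrix.conjTranspose_apply, norm_mul, norm_star]
  have h2 : ∑ i, ∑ j, ∑ k, ‖P k i‖ * ‖Q k j‖ = ∑ k, (∑ i, ‖P k i‖) * ∑ j, ‖Q k j‖ := by
    simp_rw [Finset.sum_mul_sum]
    simp_rw [Finset.sum_comm (s := Finset.univ (α := Fin n)) (t := Finset.univ (α := Fin m))]
  refine h1.trans (h2.le.trans ?_)
  calc ∑ k, (∑ i, ‖P k i‖) * ∑ j, ‖Q k j‖ ≤ ∑ k, (∑ i, ‖P k i‖) * entrySum Q := by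
        refine Finset.sum_le_sum fun k _ => mul_le_mul_of_nonneg_left ?_ (by positivity)
        exact Finset.single_le_sum (f := fun k => ∑ j, ‖Q k j‖)
          (fun k _ => by positivity) (Finset.mem_univ k)
    _ = entrySum P * entrySum Q := by rw [← Finset.sum_mul]; rfl

/-- A `C¹` curve of matrices on `[a, b]` whose derivative has absolutely continuous entries and
modulus of continuity controlled by `G`. -/
structure IsMatrixCurve {m n : ℕ} (a b M L : ℝ) (A A' : ℝ → Matrix (Fin m) (Fin n) ℂ)
    (G : ℝ → ℝ) : Prop where
  hasACDeriv : ∀ i j, HasACDeriv a b (fun t => A t i j) fun t => A' t i j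
  entrySum_le : ∀ t ∈ Icc a b, entrySum (A t) ≤ M
  entrySum_deriv_le : ∀ t ∈ Icc a b, entrySum (A' t) ≤ L
  mono : MonotoneOn G (Icc a b)
  continuousOn : ContinuousOn G (Icc a b)
  modulus : ∀ x ∈ Icc a b, ∀ y ∈ Icc a b, x ≤ y → entrySum (A' y - A' x) ≤ G y - G x

variable {m n : ℕ} {a b M L : ℝ} {A A' : ℝ → Matrix (Fin m) (Fin n) ℂ} {G : ℝ → ℝ}

lemma IsMatrixCurve.entrySum_sub_le (h : IsMatrixCurve a b M L A A' G) {x y : ℝ}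
    (hx : x ∈ Icc a b) (hy : y ∈ Icc a b) (hxy : x ≤ y) :
    entrySum (A y - A x) ≤ m * n * L * (y - x) := by
  have hentry : ∀ i j, ‖(A y - A x) i j‖ ≤ L * (y - x) := by
    intro i j
    have := (convex_Icc a b).norm_image_sub_le_of_norm_hasDerivWithin_le
      (h.hasACDeriv i j).hasDeriv
      (fun t ht => (norm_le_entrySum (A' t) i j).trans (h.entrySum_deriv_le t ht)) hx hy
    rwa [Real.norm_eq_abs, abs_of_nonneg (sub_nonneg.2 hxy)] at this
  calc entrySum (A y - A x) ≤ ∑ _i : Fin m, ∑ _j : Fin n, L * (y - x) :=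
        Finset.sum_le_sum fun i _ => Finset.sum_le_sum fun j _ => hentry i j
    _ = _ := by simp; ring

/-- The derivative of the Gram matrix `Aᴴ * A`. -/
noncomputable def gramDeriv (A A' : ℝ → Matrix (Fin m) (Fin n) ℂ) (t : ℝ) :
    Matrix (Fin n) (Fin n) ℂ :=
  (A' t).conjTranspose * A t + (A t).conjTranspose * A' t

lemma IsMatrixCurve.hasACDeriv_gram (hab : a ≤ b) (h : IsMatrixCurve a b M L A A' G)
    (i j : Fin n) : HasACDeriv a b (fun t => ((A t).conjTranspose * A t) i j)
      fun t => gramDeriv A A' t i j := by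
  have := HasACDeriv.finsetSum Finset.univ fun k (_ : k ∈ Finset.univ) =>
    (h.hasACDeriv k i).conj.mul hab (h.hasACDeriv k j)
  simpa only [gramDeriv, Matrix.add_apply, Matrix.mul_apply, Matrix.conjTranspose_apply,
    ← Finset.sum_add_distrib,
    ← starRingEnd_apply] using this

lemma IsMatrixCurve.entrySum_gramDeriv_le (h : IsMatrixCurve a b M L A A' G) {t : ℝ}
    (ht : t ∈ Icc a b) : entrySum (gramDeriv A A' t) ≤ 2 * (M * L) := by
  have h1 := h.entrySum_le t ht
  have h2 := h.entrySum_deriv_le t ht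
  have e1 := entrySum_conjTranspose_mul_le (A' t) (A t)
  have e2 := entrySum_conjTranspose_mul_le (A t) (A' t)
  have e3 := entrySum_add_le ((A' t).conjTranspose * A t) ((A t).conjTranspose * A' t)
  have e4 : entrySum (A t) * entrySum (A' t) ≤ M * L :=
    mul_le_mul h1 h2 (entrySum_nonneg _) ((entrySum_nonneg _).trans h1)
  unfold gramDeriv
  linarith [mul_comm (entrySum (A t)) (entrySum (A' t))]

lemma IsMatrixCurve.isHermitianCurve_gram (hab : a ≤ b) (h : IsMatrixCurve a b M L A A' G) :
    IsHermitianCurve (Icc a b) (fun t => (A t).conjTranspose * A t) (gramDeriv A A')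
      (fun t => 2 * M * G t + 2 * L * (m * n * L) * t) := by
  have haI := left_mem_Icc.2 hab
  have hM : 0 ≤ M := (entrySum_nonneg _).trans (h.entrySum_le a haI)
  have hL : 0 ≤ L := (entrySum_nonneg _).trans (h.entrySum_deriv_le a haI)
  refine ⟨fun t _ => Matrix.isHermitian_conjTranspose_mul_self _,
    fun i j => (h.hasACDeriv_gram hab i j).hasDeriv, ?_, ?_, ?_⟩
  · intro x hx y hy hxy
    have := h.mono hx hy hxy
    simp only
    gcongr
  · exact (continuousOn_const.mul h.continuousOn).add (by fun_prop)
  · intro x hx y hy hxy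
    have e : gramDeriv A A' y - gramDeriv A A' x
        = ((A' y - A' x).conjTranspose * A y + (A' x).conjTranspose * (A y - A x))
          + ((A y - A x).conjTranspose * A' y + (A x).conjTranspose * (A' y - A' x)) := by
      simp only [gramDeriv, Matrix.conjTranspose_sub, Matrix.sub_mul, Matrix.mul_sub]
      abel
    have d1 := h.modulus x hx y hy hxy
    have d2 := h.entrySum_sub_le hx hy hxy
    have n1 : ∀ P Q : Matrix (Fin m) (Fin n) ℂ, ∀ p q, entrySum P ≤ p → entrySum Q ≤ q →
        entrySum (P.conjTranspose * Q) ≤ p * q := fun P Q p q hp hq =>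
      (entrySum_conjTranspose_mul_le P Q).trans
        (mul_le_mul hp hq (entrySum_nonneg _) ((entrySum_nonneg _).trans hp))
    have f1 := n1 _ _ _ _ d1 (h.entrySum_le y hy)
    have f2 := n1 _ _ _ _ (h.entrySum_deriv_le x hx) d2
    have f3 := n1 _ _ _ _ d2 (h.entrySum_deriv_le y hy)
    have f4 := n1 _ _ _ _ (h.entrySum_le x hx) d1
    rw [e]
    have g1 := entrySum_add_le ((A' y - A' x).conjTranspose * A y)
      ((A' x).conjTranspose * (A y - A x))
    have g2 := entrySum_add_le ((A y - A x).conjTranspose * A' y)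
      ((A x).conjTranspose * (A' y - A' x))
    refine (entrySum_add_le _ _).trans ?_
    nlinarith

lemma abs_sortedEig_le {H : Matrix (Fin n) (Fin n) ℂ} (hH : H.IsHermitian) (k : Fin n) :
    |sortedEig H k| ≤ entrySum H := by
  obtain ⟨e, he⟩ := exists_eigenbasis hH
  have : sortedEig H k = quadForm H (e k) := by
    rw [quadForm, he, inner_smul_right, inner_self_eq_norm_sq_to_K, e.norm_eq_one]
    simp
  rw [this]
  exact abs_quadForm_le H (e.norm_eq_one k)

/-- **Regularity of `C¹` systems of singular values.** The derivatives of a `C¹` system of positive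
singular values are absolutely continuous, with uniform bounds. -/
theorem exists_singularValue_regularity_bound (m n : ℕ) {a b : ℝ} (M L Γ : ℝ) {c₀ : ℝ}
    (hab : a < b) (hc₀ : 0 < c₀) :
    ∃ C : ℝ, 0 ≤ C ∧ ∀ (A A' : ℝ → Matrix (Fin m) (Fin n) ℂ) (G : ℝ → ℝ)
      (σ σ' : ℝ → EuclideanSpace ℝ (Fin (min m n))),
      IsMatrixCurve a b M L A A' G → G b - G a ≤ Γ →
      (∀ t ∈ Icc a b, IsSingularValueTuple (A t) (σ t)) →
      (∀ j, ∀ t ∈ Icc a b, HasDerivWithinAt (fun t => σ t j) (σ' t j) (Icc a b) t) →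
      (∀ j, ContinuousOn (fun t => σ' t j) (Icc a b)) →
      (∀ j, ∀ t ∈ Icc a b, c₀ ≤ σ t j) →
      ∀ j, AbsolutelyContinuousOnInterval (fun t => σ' t j) a b ∧
        (∀ t ∈ Icc a b, |σ t j| ≤ C) ∧ (∀ t ∈ Icc a b, |σ' t j| ≤ C) ∧
        ∫ t in a..b, |deriv (fun t => σ' t j) t| ≤ C := by
  set W : ℝ := 2 * (n * (2 * (M * L))) with hW
  set Γ' : ℝ := 2 * n * (2 * (n * (2 * (M * L)))
    + 2 * ((n : ℝ) ^ 3 * (2 * M * Γ + 2 * L * (m * n * L) * (b - a)))) with hΓ'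
  set K : ℝ := W * (W / (2 * c₀)) / (2 * c₀ ^ 2) with hK
  refine ⟨|M| + (|W / (2 * c₀)| + |Γ' / (2 * c₀) + K * (b - a)|), by positivity, ?_⟩
  intro A A' G σ σ' hA hG hσ hd hc hpos j
  have haI := left_mem_Icc.2 hab.le
  have hbI := right_mem_Icc.2 hab.le
  have hM : 0 ≤ M := (entrySum_nonneg _).trans (hA.entrySum_le a haI)
  have hL : 0 ≤ L := (entrySum_nonneg _).trans (hA.entrySum_deriv_le a haI)
  have hW0 : 0 ≤ W := by positivity
  have hK0 : 0 ≤ K := by positivity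
  have hH := hA.isHermitianCurve_gram hab.le
  set lam : Fin (min m n) → ℝ → ℝ := fun j t => σ t j ^ 2 with hlam
  set w : Fin (min m n) → ℝ → ℝ := fun j t => 2 * σ t j * σ' t j with hw
  have hld : ∀ j, ∀ t ∈ Icc a b, HasDerivWithinAt (lam j) (w j t) (Icc a b) t := fun j t ht => by
    simpa using (hd j t ht).fun_pow 2
  have hσc : ∀ j, ContinuousOn (fun t => σ t j) (Icc a b) := fun j t ht =>
    (hd j t ht).continuousWithinAt
  have hwc : ∀ j, ContinuousOn (w j) (Icc a b) := fun j =>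
    (continuousOn_const.mul (hσc j)).mul (hc j)
  have hΓH : (2 * M * G b + 2 * L * (m * n * L) * b) - (2 * M * G a + 2 * L * (m * n * L) * a)
      ≤ 2 * M * Γ + 2 * L * (m * n * L) * (b - a) := by
    have : 2 * M * (G b - G a) ≤ 2 * M * Γ := by gcongr
    linarith
  obtain ⟨hwb, V, hVm, hwV, hVb⟩ := hH.exists_variation_bound hab
    (fun t ht => hA.entrySum_gramDeriv_le ht) hΓH hld hwc
    (fun j t ht => sq_singularValueTuple (hσ t ht) j)
  have hu : ∀ q : ℕ, AbsolutelyContinuousOnInterval (fun t => ∑ i, lam i t ^ q * w i t) a b := by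
    intro q
    obtain ⟨p, hp⟩ := exists_hasACDeriv_trace_pow hab.le (hA.hasACDeriv_gram hab.le) (q + 1)
    refine (hp.ac.const_mul (1 / ((q : ℝ) + 1))).of_dist_le fun x hx y hy => le_of_eq ?_
    rw [uIcc_of_le hab.le] at hx hy
    have key : ∀ t ∈ Icc a b, ∑ i, lam i t ^ q * w i t = 1 / ((q : ℝ) + 1) * p t := by
      intro t ht
      have e1 : HasDerivWithinAt (fun t => ∑ i, lam i t ^ (q + 1))
          (∑ i, ((q + 1 : ℕ) : ℝ) * lam i t ^ q * w i t) (Icc a b) t :=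
        HasDerivWithinAt.fun_sum fun i _ => by simpa using (hld i t ht).fun_pow (q + 1)
      have e2 : HasDerivWithinAt (fun t => ∑ i, lam i t ^ (q + 1)) (p t) (Icc a b) t :=
        (hp.hasDeriv t ht).congr (fun x hx => sum_pow_singularValueTuple (hσ x hx) q)
          (sum_pow_singularValueTuple (hσ t ht) q)
      have e3 := (uniqueDiffOn_Icc hab t ht).eq_deriv _ e1 e2
      rw [← e3, Finset.mul_sum]
      refine Finset.sum_congr rfl fun i _ => ?_
      push_cast
      field_simp
    rw [key x hx, key y hy]
  have hwac : AbsolutelyContinuousOnInterval (w j) a b :=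
    absolutelyContinuousOnInterval_of_powerSums hab hVm hwc
      (fun i t ht => (hld i t (Ioo_subset_Icc_self ht)).hasDerivAt (Icc_mem_nhds ht.1 ht.2))
      hwV hu j
  have hσpos : ∀ t ∈ Icc a b, 0 < σ t j := fun t ht => hc₀.trans_le (hpos j t ht)
  have hσ'eq : ∀ t ∈ Icc a b, σ' t j = w j t * (1 / (2 * σ t j)) := fun t ht => by
    have := (hσpos t ht).ne'
    simp only [hw]; field_simp
  have hinv : ∀ t ∈ Icc a b, 1 / (2 * σ t j) ≤ 1 / (2 * c₀) := fun t ht => by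
    have := hpos j t ht
    gcongr
  have hσ'b : ∀ t ∈ Icc a b, |σ' t j| ≤ W / (2 * c₀) := fun t ht => by
    rw [hσ'eq t ht, abs_mul, abs_of_pos (by have := hσpos t ht; positivity : 0 < 1 / (2 * σ t j)),
      div_eq_mul_one_div W]
    exact mul_le_mul (hwb j t ht) (hinv t ht) (by have := hσpos t ht; positivity) hW0
  have hσlip : ∀ s ∈ Icc a b, ∀ t ∈ Icc a b, |σ t j - σ s j| ≤ W / (2 * c₀) * |t - s| :=
    fun s hs t ht => by
      have := (convex_Icc a b).norm_image_sub_le_of_norm_hasDerivWithin_le (hd j)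
        (fun t ht => hσ'b t ht) hs ht
      simpa [Real.norm_eq_abs] using this
  have hinvlip : ∀ s ∈ Icc a b, ∀ t ∈ Icc a b, |1 / (2 * σ t j) - 1 / (2 * σ s j)|
      ≤ (W / (2 * c₀)) / (2 * c₀ ^ 2) * |t - s| := fun s hs t ht => by
    have h1 := hσpos s hs
    have h2 := hσpos t ht
    have h3 : 1 / (2 * σ t j) - 1 / (2 * σ s j) = (σ s j - σ t j) / (2 * (σ t j * σ s j)) := by
      field_simp
    rw [h3, abs_div, abs_of_pos (by positivity : 0 < 2 * (σ t j * σ s j)), div_mul_eq_mul_div]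
    have h4 : c₀ ^ 2 ≤ σ t j * σ s j := by
      rw [sq]; exact mul_le_mul (hpos j t ht) (hpos j s hs) hc₀.le h2.le
    have h5 := hσlip s hs t ht
    rw [abs_sub_comm] at h5
    gcongr
  have hac : AbsolutelyContinuousOnInterval (fun t => σ' t j) a b := by
    have l1 : LipschitzOnWith (Real.toNNReal ((W / (2 * c₀)) / (2 * c₀ ^ 2)))
        (fun t => 1 / (2 * σ t j)) (uIcc a b) := by
      rw [uIcc_of_le hab.le]
      refine LipschitzOnWith.of_dist_le_mul fun s hs t ht => ?_
      rw [Real.dist_eq, Real.dist_eq, Real.coe_toNNReal _ (by positivity)]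
      exact hinvlip t ht s hs
    refine (hwac.mul l1.absolutelyContinuousOnInterval).of_dist_le fun x hx y hy => le_of_eq ?_
    rw [uIcc_of_le hab.le] at hx hy
    simp only [Pi.mul_apply]
    rw [hσ'eq x hx, hσ'eq y hy]
  refine ⟨hac, fun t ht => ?_, fun t ht => ?_, ?_⟩
  · obtain ⟨k, hk⟩ := sq_singularValueTuple (hσ t ht) j
    have h1 := abs_sortedEig_le (Matrix.isHermitian_conjTranspose_mul_self (A t)) k
    rw [← hk] at h1
    have h2 := entrySum_conjTranspose_mul_le (A t) (A t)
    have h3 := hA.entrySum_le t ht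
    have h4 : |σ t j| ≤ M := by
      refine abs_le_of_sq_le_sq ?_ hM
      have := (le_abs_self _).trans (h1.trans h2)
      nlinarith [entrySum_nonneg (A t)]
    have : M ≤ |M| := le_abs_self M
    have : 0 ≤ |W / (2 * c₀)| + |Γ' / (2 * c₀) + K * (b - a)| := by positivity
    linarith
  · have := hσ'b t ht
    have : W / (2 * c₀) ≤ |W / (2 * c₀)| := le_abs_self _
    have : 0 ≤ |M| + |Γ' / (2 * c₀) + K * (b - a)| := by positivity
    linarith
  · have := integral_abs_deriv_le (w := fun t => σ' t j)
      (V := fun t => V t / (2 * c₀) + K * t) hab.le ?_ hac ?_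
    · refine this.trans ?_
      have h1 : V b / (2 * c₀) + K * b - (V a / (2 * c₀) + K * a)
          = (V b - V a) / (2 * c₀) + K * (b - a) := by ring
      have h2 : (V b - V a) / (2 * c₀) ≤ Γ' / (2 * c₀) := by gcongr
      have h3 : Γ' / (2 * c₀) + K * (b - a) ≤ |Γ' / (2 * c₀) + K * (b - a)| := le_abs_self _
      have : 0 ≤ |M| + |W / (2 * c₀)| := by positivity
      linarith
    · intro x hx y hy hxy
      have := hVm hx hy hxy
      simp only
      gcongr
    · intro x hx y hy hxy
      have e : σ' y j - σ' x j = (w j y - w j x) * (1 / (2 * σ y j))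
          + w j x * (1 / (2 * σ y j) - 1 / (2 * σ x j)) := by
        rw [hσ'eq x hx, hσ'eq y hy]; ring
      have hy0 : 0 < 1 / (2 * σ y j) := by have := hσpos y hy; positivity
      rw [e]
      refine (abs_add_le _ _).trans ?_
      rw [abs_mul, abs_mul, abs_of_pos hy0]
      have h1 : |w j y - w j x| * (1 / (2 * σ y j)) ≤ (V y - V x) * (1 / (2 * c₀)) :=
        mul_le_mul (hwV j x hx y hy hxy) (hinv y hy) hy0.le
          ((abs_nonneg _).trans (hwV j x hx y hy hxy))
      have h2 : |w j x| * |1 / (2 * σ y j) - 1 / (2 * σ x j)|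
          ≤ W * ((W / (2 * c₀)) / (2 * c₀ ^ 2) * |y - x|) :=
        mul_le_mul (hwb j x hx) (hinvlip x hx y hy) (abs_nonneg _) hW0
      rw [abs_of_nonneg (sub_nonneg.2 hxy)] at h2
      have h3 : W * ((W / (2 * c₀)) / (2 * c₀ ^ 2) * (y - x)) = K * (y - x) := by
        rw [hK]; ring
      have h4 : (V y - V x) * (1 / (2 * c₀)) = V y / (2 * c₀) - V x / (2 * c₀) := by ring
      linarith

end Gram

section Lifting

open Filter

variable {X κ : Type*} [MetricSpace X]

/-- Two tuples are `ε`-close up to a permutation. -/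
def UnorderedClose (ε : ℝ) (x y : κ → X) : Prop :=
  ∃ π : Equiv.Perm κ, ∀ k, dist (y (π k)) (x k) < ε

lemma UnorderedClose.symm {ε : ℝ} {x y : κ → X} (h : UnorderedClose ε x y) :
    UnorderedClose ε y x := by
  obtain ⟨π, hπ⟩ := h
  exact ⟨π.symm, fun k => by simpa [dist_comm] using hπ (π.symm k)⟩

lemma UnorderedClose.trans {ε δ : ℝ} {x y z : κ → X} (h : UnorderedClose ε x y)
    (h' : UnorderedClose δ y z) : UnorderedClose (δ + ε) x z := by
  obtain ⟨π, hπ⟩ := h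
  obtain ⟨ρ, hρ⟩ := h'
  exact ⟨π.trans ρ, fun k => (dist_triangle _ (y (π k)) _).trans_lt
    (add_lt_add (hρ (π k)) (hπ k))⟩

lemma exists_optimal_matching [Fintype κ] (x y : κ → X) (p : Equiv.Perm κ) :
    ∃ p' : Equiv.Perm κ, ∀ ε, UnorderedClose ε x y → ∀ k, dist (y (p' k)) (x (p k)) < ε := by
  classical
  rcases isEmpty_or_nonempty κ with hκ | hκ
  · exact ⟨p, fun ε _ k => hκ.elim k⟩
  obtain ⟨π, -, hπ⟩ := Finset.exists_min_image (Finset.univ : Finset (Equiv.Perm κ))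
    (fun π => Finset.univ.sup' Finset.univ_nonempty fun k => dist (y (π k)) (x k))
    Finset.univ_nonempty
  refine ⟨p.trans π, fun ε hε k => ?_⟩
  obtain ⟨ρ, hρ⟩ := hε
  calc dist (y (π (p k))) (x (p k))
      ≤ Finset.univ.sup' Finset.univ_nonempty fun k => dist (y (π k)) (x k) :=
        Finset.le_sup' (fun k => dist (y (π k)) (x k)) (Finset.mem_univ (p k))
    _ ≤ Finset.univ.sup' Finset.univ_nonempty fun k => dist (y (ρ k)) (x k) :=
        hπ ρ (Finset.mem_univ _)
    _ < ε := (Finset.sup'_lt_iff _).2 fun k _ => hρ k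

lemma exists_pos_separation [Fintype κ] (x : κ → X) :
    ∃ δ > 0, ∀ k l, dist (x k) (x l) < δ → x k = x l := by
  classical
  by_cases h : ∃ q : κ × κ, x q.1 ≠ x q.2
  · have hne : (Finset.univ.filter fun q : κ × κ => x q.1 ≠ x q.2).Nonempty :=
      ⟨h.choose, by simpa using h.choose_spec⟩
    obtain ⟨q, hq, hmin⟩ := Finset.exists_min_image _ (fun q : κ × κ => dist (x q.1) (x q.2)) hne
    refine ⟨dist (x q.1) (x q.2), dist_pos.2 (by simpa using hq), fun k l hkl => ?_⟩
    by_contra hc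
    exact absurd (hmin (k, l) (by simpa using hc)) (not_le.2 hkl)
  · push Not at h
    exact ⟨1, one_pos, fun k l _ => h (k, l)⟩

/-- A chain of small steps starting near a point of a separated set stays near that point. -/
lemma dist_lt_of_chain {x : κ → X} {δ : ℝ} (hsep : ∀ k l, dist (x k) (x l) < 4 * δ → x k = x l)
    {y : ℕ → X} {j d : ℕ} (hnear : ∀ i, j ≤ i → i ≤ j + d → ∃ l, dist (y i) (x l) < δ)
    (hstep : ∀ i, j ≤ i → i < j + d → dist (y (i + 1)) (y i) < 2 * δ) :
    ∃ l, dist (y j) (x l) < δ ∧ dist (y (j + d)) (x l) < δ := by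
  induction d with
  | zero =>
    obtain ⟨l, hl⟩ := hnear j le_rfl le_rfl
    exact ⟨l, hl, hl⟩
  | succ d ih =>
    obtain ⟨l, h1, h2⟩ := ih (fun i hi hi' => hnear i hi (by omega))
      (fun i hi hi' => hstep i hi (by omega))
    obtain ⟨l', hl'⟩ := hnear (j + (d + 1)) (by omega) le_rfl
    have h3 := hstep (j + d) (by omega) (by omega)
    have : x l' = x l := by
      refine hsep _ _ ?_
      have t1 := dist_triangle (x l') (y (j + d + 1)) (x l)
      have t2 := dist_triangle (y (j + d + 1)) (y (j + d)) (x l)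
      rw [dist_comm (x l') (y (j + d + 1))] at t1
      have : dist (y (j + d + 1)) (x l') < δ := hl'
      linarith
    exact ⟨l, h1, this ▸ hl'⟩

/-- **Lifting of continuous curves of unordered tuples** to continuous curves of tuples. -/
theorem exists_continuous_lift [Fintype κ] (D : ℝ → κ → X)
    (hD : ∀ t₀, ∀ ε > 0, ∀ᶠ t in 𝓝 t₀, UnorderedClose ε (D t₀) (D t)) :
    ∃ π : ℝ → Equiv.Perm κ, ∀ k, Continuous fun t => D t (π t k) := by
  classical
  choose opt hopt using fun (s t : ℝ) (p : Equiv.Perm κ) => exists_optimal_matching (D s) (D t) p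
  set gr : ℕ → ℕ → ℝ := fun N j => -(N : ℝ) + j / ((N : ℝ) + 1) with hgr
  set st : ℕ → ℕ → Equiv.Perm κ := fun N j =>
    Nat.rec 1 (fun j p => opt (gr N j) (gr N (j + 1)) p) j with hst
  have hst_succ : ∀ N j, st N (j + 1) = opt (gr N j) (gr N (j + 1)) (st N j) := fun N j => rfl
  set fl : ℕ → ℝ → ℕ := fun N t => ⌊(t + N) * ((N : ℝ) + 1)⌋₊ with hfl
  set ρ : ℕ → ℝ → Equiv.Perm κ := fun N t => opt (gr N (fl N t)) t (st N (fl N t)) with hρ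
  have hlim : ∀ t, ∃ p : Equiv.Perm κ, ∀ᶠ N in (hyperfilter ℕ : Filter ℕ), ρ N t = p := by
    intro t
    have := (Ultrafilter.eventually_exists_iff (f := hyperfilter ℕ)
      (P := fun (p : Equiv.Perm κ) N => ρ N t = p)).1
        (Eventually.of_forall fun N => ⟨ρ N t, rfl⟩)
    exact this
  choose π hπ using hlim
  have hle : (hyperfilter ℕ : Filter ℕ) ≤ atTop := by
    rw [← Nat.cofinite_eq_atTop]; exact hyperfilter_le_cofinite
  have hfl_le : ∀ (N : ℕ) (t : ℝ), -(N : ℝ) ≤ t →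
      gr N (fl N t) ≤ t ∧ t - 1 / ((N : ℝ) + 1) < gr N (fl N t) := by
    intro N t ht
    have hN : (0 : ℝ) < (N : ℝ) + 1 := by positivity
    have h0 : 0 ≤ (t + N) * ((N : ℝ) + 1) := mul_nonneg (by linarith) hN.le
    have h1 := Nat.floor_le h0
    have h2 := Nat.lt_floor_add_one ((t + N) * ((N : ℝ) + 1))
    have h1' : (fl N t : ℝ) / ((N : ℝ) + 1) ≤ t + N := by rwa [div_le_iff₀ hN]
    have h2' : t + N < ((fl N t : ℝ) + 1) / ((N : ℝ) + 1) := by rwa [lt_div_iff₀ hN]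
    rw [add_div] at h2'
    simp only [hgr]
    constructor <;> linarith
  refine ⟨π, fun k => continuous_iff_continuousAt.2 fun t₀ => ?_⟩
  rw [Metric.continuousAt_iff]
  intro ε hε
  obtain ⟨δ₀, hδ₀, hsep₀⟩ := exists_pos_separation (D t₀)
  set δ := min (δ₀ / 4) (ε / 6) with hδ
  have hδpos : 0 < δ := by positivity
  have hδ4 : 4 * δ ≤ δ₀ := by have := min_le_left (δ₀ / 4) (ε / 6); linarith
  have hδ6 : 6 * δ ≤ ε := by have := min_le_right (δ₀ / 4) (ε / 6); linarith
  have hsep : ∀ k l, dist (D t₀ k) (D t₀ l) < 4 * δ → D t₀ k = D t₀ l := fun k l h =>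
    hsep₀ k l (h.trans_le hδ4)
  obtain ⟨r, hr, hball⟩ := Metric.eventually_nhds_iff_ball.1 (hD t₀ δ hδpos)
  refine ⟨r / 2, by positivity, fun t ht => ?_⟩
  have hclose2 : ∀ s ∈ Metric.ball t₀ r, ∀ s' ∈ Metric.ball t₀ r,
      UnorderedClose (2 * δ) (D s) (D s') := fun s hs s' hs' => by
    have := (hball s hs).symm.trans (hball s' hs')
    rwa [← two_mul] at this
  have hnear : ∀ s ∈ Metric.ball t₀ r, ∀ i, ∃ l, dist (D s i) (D t₀ l) < δ := fun s hs i => by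
    obtain ⟨p, hp⟩ := hball s hs
    exact ⟨p.symm i, by simpa using hp (p.symm i)⟩
  have hNlarge : ∀ᶠ N : ℕ in atTop, 1 / ((N : ℝ) + 1) < r / 2 ∧ -(N : ℝ) ≤ t ∧ -(N : ℝ) ≤ t₀ := by
    have e1 : ∀ᶠ N : ℕ in atTop, 1 / ((N : ℝ) + 1) < r / 2 :=
      tendsto_one_div_add_atTop_nhds_zero_nat.eventually (gt_mem_nhds (by positivity))
    obtain ⟨N1, hN1⟩ := exists_nat_ge (-t)
    obtain ⟨N2, hN2⟩ := exists_nat_ge (-t₀)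
    filter_upwards [e1, eventually_ge_atTop N1, eventually_ge_atTop N2] with N h1 h2 h3
    have h2' : (N1 : ℝ) ≤ N := by exact_mod_cast h2
    have h3' : (N2 : ℝ) ≤ N := by exact_mod_cast h3
    exact ⟨h1, by linarith, by linarith⟩
  obtain ⟨N, ⟨hN1, hN2, hN3⟩, hNt, hNt₀⟩ :=
    ((hNlarge.filter_mono hle).and ((hπ t).and (hπ t₀))).exists
  have ht' : |t - t₀| < r / 2 := ht
  obtain ⟨ht1, ht2⟩ := abs_lt.1 ht'
  have hgt := hfl_le N t hN2
  have hgt₀ := hfl_le N t₀ hN3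
  have hmono : Monotone (gr N) := fun i j hij => by
    have : (i : ℝ) ≤ j := by exact_mod_cast hij
    simp only [hgr]; gcongr
  have hmemball : ∀ s, t₀ - r < s → s < t₀ + r → s ∈ Metric.ball t₀ r := fun s h1 h2 => by
    rw [Metric.mem_ball, Real.dist_eq, abs_lt]; constructor <;> linarith
  have htb : t ∈ Metric.ball t₀ r := hmemball t (by linarith) (by linarith)
  have ht₀b : t₀ ∈ Metric.ball t₀ r := Metric.mem_ball_self hr
  have hb1 : gr N (fl N t) ∈ Metric.ball t₀ r := hmemball _ (by linarith) (by linarith)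
  have hb2 : gr N (fl N t₀) ∈ Metric.ball t₀ r := hmemball _ (by linarith) (by linarith)
  set y : ℕ → X := fun j => D (gr N j) (st N j k) with hy
  have hbetween : ∀ i p q, gr N p ∈ Metric.ball t₀ r → gr N q ∈ Metric.ball t₀ r → p ≤ i → i ≤ q →
      gr N i ∈ Metric.ball t₀ r := by
    intro i p q hp hq hpi hiq
    rw [Real.ball_eq_Ioo] at hp hq ⊢
    exact ⟨hp.1.trans_le (hmono hpi), (hmono hiq).trans_lt hq.2⟩
  have hchain : ∀ p q, gr N p ∈ Metric.ball t₀ r → gr N q ∈ Metric.ball t₀ r → p ≤ q →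
      ∃ l, dist (y p) (D t₀ l) < δ ∧ dist (y q) (D t₀ l) < δ := by
    intro p q hp hq hpq
    obtain ⟨d, rfl⟩ := Nat.exists_eq_add_of_le hpq
    refine dist_lt_of_chain hsep (fun i hi hi' => hnear _ (hbetween i _ _ hp hq hi hi') _)
      fun i hi hi' => ?_
    simp only [hy, hst_succ]
    exact hopt _ _ _ _ (hclose2 _ (hbetween i _ _ hp hq hi hi'.le) _
      (hbetween (i + 1) _ _ hp hq (by omega) hi')) k
  obtain ⟨l, hl1, hl2⟩ : ∃ l, dist (y (fl N t)) (D t₀ l) < δ ∧ dist (y (fl N t₀)) (D t₀ l) < δ := by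
    rcases le_total (fl N t) (fl N t₀) with h | h
    · exact hchain _ _ hb1 hb2 h
    · obtain ⟨l, h1, h2⟩ := hchain _ _ hb2 hb1 h
      exact ⟨l, h2, h1⟩
  have e1 : dist (D t (π t k)) (y (fl N t)) < 2 * δ := by
    rw [← hNt]; exact hopt _ _ _ _ (hclose2 _ hb1 _ htb) k
  have e2 : dist (D t₀ (π t₀ k)) (y (fl N t₀)) < 2 * δ := by
    rw [← hNt₀]; exact hopt _ _ _ _ (hclose2 _ hb2 _ ht₀b) k
  have t1 := dist_triangle (D t (π t k)) (y (fl N t)) (D t₀ l)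
  have t2 := dist_triangle (D t₀ (π t₀ k)) (y (fl N t₀)) (D t₀ l)
  have t3 := dist_triangle_right (D t (π t k)) (D t₀ (π t₀ k)) (D t₀ l)
  linarith

end Lifting

section OneSided

open Filter

lemma MonotoneOn.exists_tendsto_nhdsGT {f : ℝ → ℝ} {a b t : ℝ} (hf : MonotoneOn f (Icc a b))
    (ht : t ∈ Ioo a b) : ∃ l, Tendsto f (𝓝[>] t) (𝓝 l) := by
  have hm : Monotone fun t => f (max a (min b t)) := fun x y hxy =>
    hf (max_min_mem_Icc (ht.1.trans ht.2).le x) (max_min_mem_Icc (ht.1.trans ht.2).le y)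
      (monotone_max_min a b hxy)
  refine ⟨_, (hm.tendsto_rightLim t).congr' ?_⟩
  filter_upwards [nhdsWithin_le_nhds (Icc_mem_nhds ht.1 ht.2)] with x hx
  rw [max_min_eq_self hx]

lemma MonotoneOn.exists_tendsto_nhdsLT {f : ℝ → ℝ} {a b t : ℝ} (hf : MonotoneOn f (Icc a b))
    (ht : t ∈ Ioo a b) : ∃ l, Tendsto f (𝓝[<] t) (𝓝 l) := by
  have hm : Monotone fun t => f (max a (min b t)) := fun x y hxy =>
    hf (max_min_mem_Icc (ht.1.trans ht.2).le x) (max_min_mem_Icc (ht.1.trans ht.2).le y)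
      (monotone_max_min a b hxy)
  refine ⟨_, (hm.tendsto_leftLim t).congr' ?_⟩
  filter_upwards [nhdsWithin_le_nhds (Icc_mem_nhds ht.1 ht.2)] with x hx
  rw [max_min_eq_self hx]

lemma IsSubgradientOn.hasDerivWithinAt_of_tendsto {s S : Set ℝ} {f c G : ℝ → ℝ}
    (h : IsSubgradientOn s f c G) {x C : ℝ} (hs : s ∈ 𝓝 x) [NeBot (𝓝[S] x)]
    (hc : Tendsto c (𝓝[S] x) (𝓝 C)) (hf : ContinuousAt f x) (hG : ContinuousAt G x) :
    HasDerivWithinAt f C S x := by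
  have hG' : Tendsto G (𝓝[S] x) (𝓝 (G x)) := hG.mono_left nhdsWithin_le_nhds
  have hf' : Tendsto f (𝓝[S] x) (𝓝 (f x)) := hf.mono_left nhdsWithin_le_nhds
  have hid : Tendsto (fun y : ℝ => y) (𝓝[S] x) (𝓝 x) := nhdsWithin_le_nhds
  have key : ∀ y ∈ s, |f y - f x - (y - x) * C| ≤ |y - x| * (|G y - G x| + |c y - C|) := by
    intro y hy
    refine le_of_tendsto_of_tendsto
      (((tendsto_const_nhds.sub hf').sub ((tendsto_const_nhds.sub hid).mul hc)).abs)
      ((tendsto_const_nhds.sub hid).abs.mul ((tendsto_const_nhds.sub hG').abs.add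
        (tendsto_const_nhds.sub hc).abs)) ?_
    filter_upwards [nhdsWithin_le_nhds hs] with z hz using h.abs_sub_le hz hy
  rw [hasDerivWithinAt_iff_isLittleO, Asymptotics.isLittleO_iff]
  intro ε hε
  have h1 : Tendsto (fun y => |G y - G x| + |c y - C|) (𝓝[S] x) (𝓝 0) := by
    simpa using (hG'.sub (tendsto_const_nhds (x := G x))).abs.add
      (hc.sub (tendsto_const_nhds (x := C))).abs
  filter_upwards [nhdsWithin_le_nhds hs, h1.eventually (gt_mem_nhds hε)] with y hy hlt
  rw [Real.norm_eq_abs, Real.norm_eq_abs, smul_eq_mul, mul_comm ε]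
  exact (key y hy).trans (mul_le_mul_of_nonneg_left hlt.le (abs_nonneg _))

lemma tendsto_of_tendsto_nhdsGT {d r : ℝ → ℝ} {S : Set ℝ} (hS : IsOpen S) {x l : ℝ}
    (hd : Tendsto d (𝓝[S] x) (𝓝 l))
    (hr : ∀ᶠ s in 𝓝[S] x, Tendsto d (𝓝[>] s) (𝓝 (r s))) : Tendsto r (𝓝[S] x) (𝓝 l) := by
  rw [(closed_nhds_basis l).tendsto_right_iff]
  rintro V ⟨hV, hVc⟩
  have h1 := eventually_eventually_nhdsWithin.2 (hd.eventually hV)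
  filter_upwards [hr, h1, self_mem_nhdsWithin] with s hs h2 hsS
  rw [hS.nhdsWithin_eq hsS] at h2
  exact hVc.mem_of_tendsto hs (h2.filter_mono nhdsWithin_le_nhds)

variable {n : ℕ} {H H' : ℝ → Matrix (Fin n) (Fin n) ℂ} {G : ℝ → ℝ} {a b : ℝ}

/-- The right derivative of the `k`-th eigenvalue. -/
noncomputable def eigRightDeriv (H : ℝ → Matrix (Fin n) (Fin n) ℂ) (k : Fin n) (t : ℝ) : ℝ :=
  derivWithin (fun s => sortedEig (H s) k) (Ioi t) t

lemma IsHermitianCurve.exists_oneSided_deriv (h : IsHermitianCurve (Icc a b) H H' G) {t : ℝ}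
    (ht : t ∈ Ioo a b) : ∃ l : Fin n → ℝ, ∀ k,
      HasDerivWithinAt (fun s => sortedEig (H s) k) (l k) (Iio t) t ∧
      HasDerivWithinAt (fun s => sortedEig (H s) k) (eigRightDeriv H k t) (Ioi t) t ∧
      Tendsto (eigRightDeriv H k) (𝓝[<] t) (𝓝 (l k)) ∧
      Tendsto (eigRightDeriv H k) (𝓝[>] t) (𝓝 (eigRightDeriv H k t)) := by
  obtain ⟨c, -, hc⟩ := h.exists_subgradient (convex_Icc a b)
  set G' : ℝ → ℝ := fun t => (n : ℝ) ^ 3 * G t with hG'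
  have hG'm : MonotoneOn G' (Icc a b) := fun x hx y hy hxy =>
    mul_le_mul_of_nonneg_left (h.mono hx hy hxy) (by positivity)
  have hG'c : ContinuousOn G' (Icc a b) := continuousOn_const.mul h.continuousOn
  have hHc : ∀ i j, ContinuousOn (fun t => H t i j) (Icc a b) := fun i j t ht =>
    (h.hasDeriv i j t ht).continuousWithinAt
  have hnhds : ∀ s ∈ Ioo a b, Icc a b ∈ 𝓝 s := fun s hs => Icc_mem_nhds hs.1 hs.2
  have hlim : ∀ {S : Set ℝ} {s : ℝ}, s ∈ Ioo a b → ∀ j,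
      (∃ l, Tendsto (fun t => c j t + 2 * G' t) (𝓝[S] s) (𝓝 l)) →
      ∃ l, Tendsto (c j) (𝓝[S] s) (𝓝 l) := by
    rintro S s hs j ⟨l, hl⟩
    have hGs : Tendsto G' (𝓝[S] s) (𝓝 (G' s)) :=
      (hG'c.continuousAt (hnhds s hs)).mono_left nhdsWithin_le_nhds
    exact ⟨l - 2 * G' s, (hl.sub (hGs.const_mul 2)).congr fun t => by ring⟩
  have hcR : ∀ s ∈ Ioo a b, ∀ j, ∃ l, Tendsto (c j) (𝓝[>] s) (𝓝 l) := fun s hs j =>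
    hlim hs j (((hc j).monotoneOn hG'm).exists_tendsto_nhdsGT hs)
  have hcL : ∀ s ∈ Ioo a b, ∀ j, ∃ l, Tendsto (c j) (𝓝[<] s) (𝓝 l) := fun s hs j =>
    hlim hs j (((hc j).monotoneOn hG'm).exists_tendsto_nhdsLT hs)
  have hder : ∀ {S : Set ℝ} {s : ℝ}, s ∈ Ioo a b → NeBot (𝓝[S] s) → ∀ k : Fin n, ∀ l₀ l₁,
      Tendsto (c k) (𝓝[S] s) (𝓝 l₀) → Tendsto (c (k + 1)) (𝓝[S] s) (𝓝 l₁) →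
      HasDerivWithinAt (fun s => sortedEig (H s) k) (l₁ - l₀) S s := by
    intro S s hs hne k l₀ l₁ h₀ h₁
    simp only [sortedEig_eq_sub]
    have hcont : ∀ j, ContinuousAt (fun s => topEigSum (H s) j) s := fun j =>
      (continuousOn_topEigSum hHc h.isHermitian j).continuousAt (hnhds s hs)
    exact ((hc _).hasDerivWithinAt_of_tendsto (hnhds s hs) h₁ (hcont _)
      (hG'c.continuousAt (hnhds s hs))).sub ((hc _).hasDerivWithinAt_of_tendsto (hnhds s hs) h₀
        (hcont _) (hG'c.continuousAt (hnhds s hs)))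
  have hrd : ∀ s ∈ Ioo a b, ∀ k : Fin n,
      Tendsto (fun t => c (k + 1) t - c k t) (𝓝[>] s) (𝓝 (eigRightDeriv H k s)) ∧
      HasDerivWithinAt (fun s => sortedEig (H s) k) (eigRightDeriv H k s) (Ioi s) s := by
    intro s hs k
    obtain ⟨l₀, h₀⟩ := hcR s hs k
    obtain ⟨l₁, h₁⟩ := hcR s hs (k + 1)
    have h2 := hder hs inferInstance k l₀ l₁ h₀ h₁
    have h3 : eigRightDeriv H k s = l₁ - l₀ := h2.derivWithin (uniqueDiffWithinAt_Ioi s)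
    rw [h3]
    exact ⟨h₁.sub h₀, h2⟩
  have hev : ∀ (S : Set ℝ) (k : Fin n), ∀ᶠ s in 𝓝[S] t,
      Tendsto (fun t => c (k + 1) t - c k t) (𝓝[>] s) (𝓝 (eigRightDeriv H k s)) := by
    intro S k
    filter_upwards [nhdsWithin_le_nhds (Ioo_mem_nhds ht.1 ht.2)] with s hs using (hrd s hs k).1
  choose L hL using hcL t ht
  refine ⟨fun k => L (k + 1) - L k, fun k => ⟨hder ht inferInstance k _ _ (hL k) (hL _),
    (hrd t ht k).2, tendsto_of_tendsto_nhdsGT isOpen_Iio ((hL _).sub (hL k)) (hev _ k),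
    tendsto_of_tendsto_nhdsGT isOpen_Ioi (hrd t ht k).1 (hev _ k)⟩⟩

end OneSided

section Determinant

open Filter

variable {n : ℕ}

lemma HasDerivWithinAt.tendsto_div {f : ℝ → ℝ} {S : Set ℝ} {t l : ℝ} (hS : t ∉ S)
    (h : HasDerivWithinAt f l S t) :
    Tendsto (fun s => (f s - f t) / (s - t)) (𝓝[S] t) (𝓝 l) := by
  have := (hasDerivWithinAt_iff_tendsto_slope' hS).1 h
  refine this.congr fun s => ?_
  rw [slope_def_field]

/-- The characteristic polynomial of the reduced derivative on an eigenspace: both one-sided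
derivatives of the eigenvalues have it. -/
lemma exists_prod_limit {H : ℝ → Matrix (Fin n) (Fin n) ℂ} {K : Matrix (Fin n) (Fin n) ℂ} {t : ℝ}
    (hH : ∀ᶠ s in 𝓝 t, (H s).IsHermitian)
    (hd : ∀ i j, HasDerivAt (fun s => H s i j) (K i j) t) (x z : ℝ) :
    ∃ c : ℂ, ∀ S : Set ℝ, t ∉ S → NeBot (𝓝[S] t) → ∀ l : Fin n → ℝ,
      (∀ k, HasDerivWithinAt (fun s => sortedEig (H s) k) (l k) S t) →
      ((∏ k with sortedEig (H t) k = x, (l k - z) : ℝ) : ℂ) *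
        ((∏ k with ¬ sortedEig (H t) k = x, (sortedEig (H t) k - x) : ℝ) : ℂ) = c := by
  obtain ⟨b, hb⟩ := exists_eigenbasis hH.self_of_nhds
  set U : Matrix (Fin n) (Fin n) ℂ := Matrix.of fun i k => b k i with hU
  have hUU : U.conjTranspose * U = 1 := by
    ext k l
    have h1 := orthonormal_iff_ite.1 b.orthonormal k l
    rw [PiLp.inner_apply] at h1
    simp only [Matrix.mul_apply, Matrix.conjTranspose_apply, hU, Matrix.of_apply, Matrix.one_apply]
    rw [← h1]
    exact Finset.sum_congr rfl fun i _ => by simp [mul_comm]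
  have hdU : ∀ B : Matrix (Fin n) (Fin n) ℂ, (U.conjTranspose * B * U).det = B.det := by
    intro B
    rw [Matrix.det_mul, Matrix.det_mul, mul_right_comm, ← Matrix.det_mul, hUU, Matrix.det_one,
      one_mul]
  have hHU : H t * U = U * Matrix.diagonal fun k => (sortedEig (H t) k : ℂ) := by
    ext i k
    have h1 := congrArg (fun v : EuclideanSpace ℂ (Fin n) => v i) (hb k)
    simp only [Matrix.toEuclideanLin, Matrix.toLpLin_apply, Matrix.mulVec, dotProduct,
      PiLp.smul_apply, smul_eq_mul] at h1
    rw [Matrix.mul_diagonal, Matrix.mul_apply]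
    simp only [hU, Matrix.of_apply]
    rw [h1, mul_comm]
  set M : ℝ → Matrix (Fin n) (Fin n) ℂ := fun s =>
    U.conjTranspose * (H s - ((x + z * (s - t) : ℝ) : ℂ) • 1) * U with hM
  set M' : Matrix (Fin n) (Fin n) ℂ := U.conjTranspose * (K - (z : ℂ) • 1) * U with hM'
  have hMt : M t = Matrix.diagonal fun k => ((sortedEig (H t) k : ℂ) - x) := by
    simp only [hM, sub_self, mul_zero, add_zero]
    rw [Matrix.mul_assoc, sub_mul, hHU, Matrix.smul_mul, one_mul, mul_sub, Matrix.mul_smul,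
      ← Matrix.mul_assoc, hUU, one_mul, ← Matrix.diagonal_one, ← Matrix.diagonal_smul,
      Matrix.diagonal_sub]
    simp
  have hMd : ∀ k l, HasDerivAt (fun s => M s k l) (M' k l) t := by
    intro k l
    simp only [hM, hM', Matrix.mul_apply, Matrix.sub_apply, Matrix.smul_apply]
    refine HasDerivAt.fun_sum fun j _ => HasDerivAt.mul_const (HasDerivAt.fun_sum fun i _ =>
      HasDerivAt.const_mul _ (((hd i j).sub ?_))) _
    have : HasDerivAt (fun s : ℝ => x + z * (s - t)) z t := by
      simpa using ((hasDerivAt_id t).sub_const t).const_mul z |>.const_add x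
    exact this.ofReal_comp.smul_const _
  set v : ℝ → Fin n → ℂ := fun s k => if sortedEig (H t) k = x then ((s - t : ℝ) : ℂ)⁻¹ else 1
    with hv
  set N : ℝ → Matrix (Fin n) (Fin n) ℂ := fun s => Matrix.of fun k l => v s k * M s k l with hN
  set N₀ : Matrix (Fin n) (Fin n) ℂ := Matrix.of fun k l =>
    if sortedEig (H t) k = x then M' k l else M t k l with hN₀
  have hNlim : ∀ S : Set ℝ, t ∉ S → Tendsto N (𝓝[S] t) (𝓝 N₀) := by
    intro S hS
    refine tendsto_pi_nhds.2 fun k => tendsto_pi_nhds.2 fun l => ?_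
    simp only [hN, hN₀, Matrix.of_apply, hv]
    split_ifs with hk
    · have h1 := (hasDerivWithinAt_iff_tendsto_slope' hS).1 ((hMd k l).hasDerivWithinAt (s := S))
      refine h1.congr fun s => ?_
      have h2 : M t k l = 0 := by
        rw [hMt, Matrix.diagonal_apply]
        split_ifs with h
        · rw [hk, sub_self]
        · rfl
      rw [slope_def_module, h2, sub_zero, Complex.real_smul, Complex.ofReal_inv]
    · simp only [one_mul]
      exact (hMd k l).continuousAt.mono_left nhdsWithin_le_nhds
  have hdetlim : ∀ S : Set ℝ, t ∉ S → Tendsto (fun s => (N s).det) (𝓝[S] t) (𝓝 N₀.det) :=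
    fun S hS => ((Continuous.matrix_det continuous_id).tendsto N₀).comp (hNlim S hS)
  refine ⟨N₀.det, fun S hS hne l hl => tendsto_nhds_unique (f := fun s => (N s).det) ?_
    (hdetlim S hS)⟩
  have hcont : ∀ k, Tendsto (fun s => sortedEig (H s) k) (𝓝[S] t) (𝓝 (sortedEig (H t) k)) :=
    fun k => (hl k).continuousWithinAt
  have hid : Tendsto (fun s : ℝ => s) (𝓝[S] t) (𝓝 t) := nhdsWithin_le_nhds
  have hP : Tendsto (fun s => (∏ k with sortedEig (H t) k = x,
        ((sortedEig (H s) k - sortedEig (H t) k) / (s - t) - z)) *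
        ∏ k with ¬ sortedEig (H t) k = x, (sortedEig (H s) k - (x + z * (s - t)))) (𝓝[S] t)
      (𝓝 ((∏ k with sortedEig (H t) k = x, (l k - z)) *
        ∏ k with ¬ sortedEig (H t) k = x, (sortedEig (H t) k - x))) := by
    refine Tendsto.mul (tendsto_finsetProd _ fun k _ => ((hl k).tendsto_div hS).sub_const z)
      (tendsto_finsetProd _ fun k _ => ?_)
    have := (hcont k).sub ((tendsto_const_nhds (x := x)).add
      ((hid.sub (tendsto_const_nhds (x := t))).const_mul z))
    simpa using this
  rw [← Complex.ofReal_mul]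
  refine ((Complex.continuous_ofReal.tendsto _).comp hP).congr' ?_
  filter_upwards [nhdsWithin_le_nhds hH, self_mem_nhdsWithin] with s hs hsS
  have hst : s - t ≠ 0 := sub_ne_zero.2 fun h => hS (h ▸ hsS)
  have hdet : (N s).det = (∏ k, v s k) * (M s).det := Matrix.det_mul_column (v s) (M s)
  rw [hdet, hM]
  simp only
  rw [hdU, det_sub_smul_one hs, ← Finset.prod_mul_distrib, Function.comp_apply,
    ← Finset.prod_filter_mul_prod_filter_not Finset.univ (fun k => sortedEig (H t) k = x)
      (fun k => v s k * _)]
  push_cast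
  congr 1
  · refine Finset.prod_congr rfl fun k hk => ?_
    have hk' := (Finset.mem_filter.1 hk).2
    have hst' : (s : ℂ) - t ≠ 0 := by exact_mod_cast hst
    simp only [hv, if_pos hk', hk']
    push_cast
    field_simp
    ring
  · refine Finset.prod_congr rfl fun k hk => ?_
    have hk' := (Finset.mem_filter.1 hk).2
    simp only [hv, if_neg hk', one_mul]

/-- Left and right derivatives of the eigenvalues agree up to a permutation within the
eigenspaces. -/
lemma exists_perm_oneSided_deriv {H : ℝ → Matrix (Fin n) (Fin n) ℂ}
    {K : Matrix (Fin n) (Fin n) ℂ} {t : ℝ} (hH : ∀ᶠ s in 𝓝 t, (H s).IsHermitian)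
    (hd : ∀ i j, HasDerivAt (fun s => H s i j) (K i j) t) {l r : Fin n → ℝ}
    (hl : ∀ k, HasDerivWithinAt (fun s => sortedEig (H s) k) (l k) (Iio t) t)
    (hr : ∀ k, HasDerivWithinAt (fun s => sortedEig (H s) k) (r k) (Ioi t) t) :
    ∃ p : Equiv.Perm (Fin n), ∀ k,
      sortedEig (H t) (p k) = sortedEig (H t) k ∧ l (p k) = r k := by
  classical
  have hprod : ∀ x z : ℝ, ∏ k with sortedEig (H t) k = x, (z - l k)
      = ∏ k with sortedEig (H t) k = x, (z - r k) := by
    intro x z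
    obtain ⟨c, hc⟩ := exists_prod_limit hH hd x z
    have h1 := (hc _ self_notMem_Iio inferInstance l hl).trans
      (hc _ self_notMem_Ioi inferInstance r hr).symm
    have h2 : ∏ k with ¬ sortedEig (H t) k = x, (sortedEig (H t) k - x) ≠ 0 :=
      Finset.prod_ne_zero_iff.2 fun k hk => sub_ne_zero.2 (Finset.mem_filter.1 hk).2
    have h3 := mul_right_cancel₀ (by exact_mod_cast h2) h1
    have h4 : ∏ k with sortedEig (H t) k = x, (l k - z)
      = ∏ k with sortedEig (H t) k = x, (r k - z) := by exact_mod_cast h3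
    have h5 : ∀ f : Fin n → ℝ, ∏ k with sortedEig (H t) k = x, (z - f k)
        = (∏ k with sortedEig (H t) k = x, (-1 : ℝ)) *
          ∏ k with sortedEig (H t) k = x, (f k - z) := fun f => by
      rw [← Finset.prod_mul_distrib]
      exact Finset.prod_congr rfl fun k _ => by ring
    rw [h5, h5, h4]
  have hms : ∀ x : ℝ, (Finset.univ.filter fun k => sortedEig (H t) k = x).val.map l
      = (Finset.univ.filter fun k => sortedEig (H t) k = x).val.map r := by
    intro x
    have hpoly : ((((Finset.univ.filter fun k => sortedEig (H t) k = x).val.map l).map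
        fun a => Polynomial.X - Polynomial.C a).prod : Polynomial ℝ)
        = (((Finset.univ.filter fun k => sortedEig (H t) k = x).val.map r).map
        fun a => Polynomial.X - Polynomial.C a).prod := by
      refine Polynomial.funext fun z => ?_
      have := hprod x z
      simpa [Finset.prod, Polynomial.eval_multiset_prod, Multiset.map_map, Function.comp_def]
        using this
    have := congrArg Polynomial.roots hpoly
    rwa [Polynomial.roots_multiset_prod_X_sub_C, Polynomial.roots_multiset_prod_X_sub_C] at this
  have hcard : ∀ c : ℝ × ℝ, Nonempty ({k // (sortedEig (H t) k, r k) = c} ≃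
      {k // (sortedEig (H t) k, l k) = c}) := by
    rintro ⟨x, y⟩
    have h1 := congrArg (Multiset.count y) (hms x)
    rw [Multiset.count_map, Multiset.count_map, ← Finset.filter_val, ← Finset.filter_val,
      Finset.filter_filter, Finset.filter_filter] at h1
    refine ⟨Fintype.equivOfCardEq ?_⟩
    rw [Fintype.card_subtype, Fintype.card_subtype]
    simp only [Prod.mk.injEq, eq_comm (b := y)]
    exact h1.symm
  have e' : ∀ c : ℝ × ℝ, {k // (sortedEig (H t) k, r k) = c} ≃
      {k // (sortedEig (H t) k, l k) = c} := fun c => (hcard c).some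
  refine ⟨Equiv.ofFiberEquiv e', fun k => ?_⟩
  have := Equiv.ofFiberEquiv_map e' k
  exact ⟨congrArg Prod.fst this, congrArg Prod.snd this⟩

end Determinant

section Existence

open Filter

lemma hasDerivWithinAt_of_selection {κ : Type*} [Finite κ] {f g : κ → ℝ → ℝ} {q : ℝ → κ}
    {S : Set ℝ} {t : ℝ} (hS : t ∉ S) {d : κ → ℝ} (hf : ∀ k, HasDerivWithinAt (f k) (d k) S t)
    (hg : ∀ k, Tendsto (g k) (𝓝[S] t) (𝓝 (d k))) (hfc : ContinuousAt (fun s => f (q s) s) t)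
    (hgc : ContinuousAt (fun s => g (q s) s) t) :
    HasDerivWithinAt (fun s => f (q s) s) (g (q t) t) S t := by
  rw [hasDerivWithinAt_iff_tendsto_slope' hS]
  have hU : S = ⋃ k, S ∩ {s | q s = k} := by
    ext s; simp
  rw [hU, nhdsWithin_iUnion, tendsto_iSup]
  intro k
  rcases (𝓝[S ∩ {s | q s = k}] t).eq_or_neBot with h | h
  · rw [h]; exact tendsto_bot
  have hle : 𝓝[S ∩ {s | q s = k}] t ≤ 𝓝[S] t := nhdsWithin_mono _ inter_subset_left
  have hk : ∀ᶠ s in 𝓝[S ∩ {s | q s = k}] t, q s = k := by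
    filter_upwards [self_mem_nhdsWithin] with s hs using hs.2
  have h1 : f (q t) t = f k t := by
    refine tendsto_nhds_unique (hfc.mono_left nhdsWithin_le_nhds)
      (((hf k).continuousWithinAt.mono_left hle).congr' ?_)
    filter_upwards [hk] with s hs
    rw [hs]
  have h2 : g (q t) t = d k := by
    refine tendsto_nhds_unique (hgc.mono_left nhdsWithin_le_nhds)
      (((hg k).mono_left hle).congr' ?_)
    filter_upwards [hk] with s hs
    rw [hs]
  rw [h2]
  refine (((hasDerivWithinAt_iff_tendsto_slope' hS).1 (hf k)).mono_left hle).congr' ?_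
  filter_upwards [hk] with s hs
  rw [slope_def_field, slope_def_field, hs, h1]

/-- Eigenvalues of a locally semiconvex curve of Hermitian matrices can be arranged to be
continuously differentiable. -/
theorem exists_hasDerivAt_sortedEig {n : ℕ} {H H' : ℝ → Matrix (Fin n) (Fin n) ℂ}
    (hH : ∀ t, ∃ a b G, t ∈ Ioo a b ∧ IsHermitianCurve (Icc a b) H H' G) :
    ∃ π : ℝ → Equiv.Perm (Fin n), ∃ w : Fin n → ℝ → ℝ, (∀ i, Continuous (w i)) ∧
      ∀ i t, HasDerivAt (fun t => sortedEig (H t) (π t i)) (w i t) t := by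
  have hl : ∀ t, ∃ l : Fin n → ℝ, ∀ k,
      HasDerivWithinAt (fun s => sortedEig (H s) k) (l k) (Iio t) t ∧
      HasDerivWithinAt (fun s => sortedEig (H s) k) (eigRightDeriv H k t) (Ioi t) t ∧
      Tendsto (eigRightDeriv H k) (𝓝[<] t) (𝓝 (l k)) ∧
      Tendsto (eigRightDeriv H k) (𝓝[>] t) (𝓝 (eigRightDeriv H k t)) := fun t => by
    obtain ⟨a, b, G, ht, h⟩ := hH t
    exact h.exists_oneSided_deriv ht
  choose l hl using hl
  have hperm : ∀ t, ∃ p : Equiv.Perm (Fin n), ∀ k,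
      sortedEig (H t) (p k) = sortedEig (H t) k ∧ l t (p k) = eigRightDeriv H k t := fun t => by
    obtain ⟨a, b, G, ht, h⟩ := hH t
    refine exists_perm_oneSided_deriv (K := H' t) ?_ (fun i j => ?_) (fun k => (hl t k).1)
      (fun k => (hl t k).2.1)
    · filter_upwards [Icc_mem_nhds ht.1 ht.2] with s hs using h.isHermitian s hs
    · exact (h.hasDeriv i j t (Ioo_subset_Icc_self ht)).hasDerivAt (Icc_mem_nhds ht.1 ht.2)
  set D : ℝ → Fin n → ℝ × ℝ := fun t k => (sortedEig (H t) k, eigRightDeriv H k t) with hD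
  have hclose : ∀ t₀, ∀ ε > 0, ∀ᶠ t in 𝓝 t₀, UnorderedClose ε (D t₀) (D t) := by
    intro t₀ ε hε
    obtain ⟨p, hp⟩ := hperm t₀
    have hR : ∀ᶠ t in 𝓝[>] t₀, UnorderedClose ε (D t₀) (D t) := by
      have : ∀ k, Tendsto (fun t => D t k) (𝓝[>] t₀) (𝓝 (D t₀ k)) := fun k =>
        (hl t₀ k).2.1.continuousWithinAt.tendsto.prodMk_nhds (hl t₀ k).2.2.2
      filter_upwards [eventually_all.2 fun k => Metric.tendsto_nhds.1 (this k) ε hε] with t ht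
      exact ⟨1, ht⟩
    have hL : ∀ᶠ t in 𝓝[<] t₀, UnorderedClose ε (D t₀) (D t) := by
      have : ∀ k, Tendsto (fun t => D t (p k)) (𝓝[<] t₀) (𝓝 (D t₀ k)) := fun k => by
        have h1 := (hl t₀ (p k)).1.continuousWithinAt.tendsto.prodMk_nhds (hl t₀ (p k)).2.2.1
        rwa [(hp k).1, (hp k).2] at h1
      filter_upwards [eventually_all.2 fun k => Metric.tendsto_nhds.1 (this k) ε hε] with t ht
      exact ⟨p, ht⟩
    rw [← nhdsLT_sup_nhdsGE, ← Ioi_insert, nhdsWithin_insert, eventually_sup, eventually_sup]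
    exact ⟨hL, by simpa using ⟨1, fun k => by simpa using hε⟩, hR⟩
  obtain ⟨π, hπ⟩ := exists_continuous_lift D hclose
  refine ⟨π, fun i t => eigRightDeriv H (π t i) t, fun i => continuous_snd.comp (hπ i),
    fun i t => ?_⟩
  have hc1 : ContinuousAt (fun s => sortedEig (H s) (π s i)) t :=
    (continuous_fst.comp (hπ i)).continuousAt
  have hc2 : ContinuousAt (fun s => eigRightDeriv H (π s i) s) t :=
    (continuous_snd.comp (hπ i)).continuousAt
  have hL := hasDerivWithinAt_of_selection (f := fun k s => sortedEig (H s) k)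
    (g := eigRightDeriv H) (q := fun s => π s i) self_notMem_Iio (fun k => (hl t k).1)
    (fun k => (hl t k).2.2.1) hc1 hc2
  have hR := hasDerivWithinAt_of_selection (f := fun k s => sortedEig (H s) k)
    (g := eigRightDeriv H) (q := fun s => π s i) self_notMem_Ioi (fun k => (hl t k).2.1)
    (fun k => (hl t k).2.2.2) hc1 hc2
  rw [← hasDerivWithinAt_univ, ← Iic_union_Ici (a := t)]
  exact hL.Iic_of_Iio.union hR.Ici_of_Ioi

lemma sortedEig_gram_pos_iff {m n : ℕ} {M : Matrix (Fin m) (Fin n) ℂ} (hM : M.rank = min m n)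
    (k : Fin n) : 0 < sortedEig (M.conjTranspose * M) k ↔ k.val < min m n := by
  rw [sortedEig_gram]
  refine ⟨fun h => ?_, fun h => by have := singularValues_pos_of_rank hM h; positivity⟩
  by_contra hc
  rw [singularValues_eq_zero_of_min_le M (not_lt.1 hc)] at h
  simp at h

theorem exists_contDiff_singularValues {m n : ℕ} {A : ℝ → Matrix (Fin m) (Fin n) ℂ}
    {H' : ℝ → Matrix (Fin n) (Fin n) ℂ}
    (hA : ∀ t, ∃ a b G, t ∈ Ioo a b ∧
      IsHermitianCurve (Icc a b) (fun t => (A t).conjTranspose * A t) H' G)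
    (hrank : ∀ t, (A t).rank = min m n) :
    ∃ σ : ℝ → EuclideanSpace ℝ (Fin (min m n)),
      (∀ t, IsSingularValueTuple (A t) (σ t)) ∧ ContDiff ℝ 1 σ := by
  set H : ℝ → Matrix (Fin n) (Fin n) ℂ := fun t => (A t).conjTranspose * A t with hH
  have hHc : ∀ k, Continuous fun t => sortedEig (H t) k := fun k =>
    continuous_iff_continuousAt.2 fun t => by
      obtain ⟨a, b, G, ht, h⟩ := hA t
      exact (continuousOn_sortedEig (fun i j t ht => (h.hasDeriv i j t ht).continuousWithinAt)
        h.isHermitian k).continuousAt (Icc_mem_nhds ht.1 ht.2)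
  obtain ⟨π₀, w₀, hw₀, hd₀⟩ := exists_hasDerivAt_sortedEig hA
  set π : ℝ → Equiv.Perm (Fin n) := fun t => (π₀ 0).symm.trans (π₀ t) with hπ
  have hd : ∀ i t, HasDerivAt (fun t => sortedEig (H t) (π t i)) (w₀ ((π₀ 0).symm i) t) t :=
    fun i t => hd₀ _ t
  have hc : ∀ i, Continuous fun t => sortedEig (H t) (π t i) := fun i =>
    continuous_iff_continuousAt.2 fun t => (hd i t).continuousAt
  have hlt : ∀ i : Fin n, i.val < min m n → ∀ t, (π t i).val < min m n := by
    intro i hi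
    have hl : min m n - 1 < n := by have := i.isLt; omega
    have hiff : ∀ t, 0 < sortedEig (H t) (π t i) ↔
        sortedEig (H t) ⟨min m n - 1, hl⟩ ≤ sortedEig (H t) (π t i) := by
      refine fun t => ⟨fun h => sortedEig_antitone _ ?_, fun h => lt_of_lt_of_le ?_ h⟩
      · have := (sortedEig_gram_pos_iff (hrank t) _).1 h
        rw [Fin.le_def]
        exact Nat.le_sub_one_of_lt this
      · rw [sortedEig_gram_pos_iff (hrank t)]
        exact Nat.sub_one_lt_of_lt hi
    have hclopen : IsClopen {t | 0 < sortedEig (H t) (π t i)} := by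
      refine ⟨?_, isOpen_lt continuous_const (hc i)⟩
      simp only [hiff]
      exact isClosed_le (hHc _) (hc i)
    have huniv := hclopen.eq_univ ⟨0, by
      simpa [hπ] using (sortedEig_gram_pos_iff (hrank 0) i).2 hi⟩
    intro t
    have ht : t ∈ {t | 0 < sortedEig (H t) (π t i)} := huniv ▸ mem_univ t
    exact (sortedEig_gram_pos_iff (hrank t) _).1 ht
  set ι : Fin (min m n) → Fin n := Fin.castLE (min_le_right m n) with hι
  have hιlt : ∀ j t, (π t (ι j)).val < min m n := fun j t => hlt (ι j) j.isLt t
  have hpos : ∀ j t, 0 < sortedEig (H t) (π t (ι j)) := fun j t =>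
    (sortedEig_gram_pos_iff (hrank t) _).2 (hιlt j t)
  refine ⟨fun t => WithLp.toLp 2 fun j => √(sortedEig (H t) (π t (ι j))), fun t => ?_, ?_⟩
  · set q : Fin (min m n) → Fin (min m n) := fun j => ⟨(π t (ι j)).val, hιlt j t⟩ with hq
    have hinj : Function.Injective q := fun i j hij => by
      have h1 : (π t (ι i)).val = (π t (ι j)).val := (Fin.ext_iff.1 hij : (q i).val = (q j).val)
      exact Fin.castLE_injective _ ((π t).injective (Fin.ext h1))
    refine ⟨Equiv.ofBijective q (Finite.injective_iff_bijective.1 hinj), fun j => ?_⟩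
    simp only [Equiv.ofBijective_apply, hH, hq]
    rw [sortedEig_gram, Real.sqrt_sq (LinearMap.singularValues_nonneg _ _)]
  · rw [contDiff_euclidean]
    intro j
    have h1 : ∀ t, HasDerivAt (fun t => √(sortedEig (H t) (π t (ι j))))
        (w₀ ((π₀ 0).symm (ι j)) t / (2 * √(sortedEig (H t) (π t (ι j))))) t := fun t =>
      (hd (ι j) t).sqrt (hpos j t).ne'
    rw [contDiff_one_iff_deriv]
    refine ⟨fun t => (h1 t).differentiableAt, ?_⟩
    rw [show deriv (fun t => √(sortedEig (H t) (π t (ι j)))) = _ from funext fun t => (h1 t).deriv]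
    refine (hw₀ _).div (continuous_const.mul (hc _).sqrt) fun t => ?_
    have := Real.sqrt_pos.2 (hpos j t)
    positivity

end Existence

section WeakDerivative

open Filter

variable {E : Type*} [NormedAddCommGroup E] [NormedSpace ℝ E]

/-- A smooth step from `0` to `1` on `[p, p + ε]`. -/
noncomputable def smoothStep (p ε x : ℝ) : ℝ := Real.smoothTransition ((x - p) / ε)

lemma contDiff_smoothStep (p ε : ℝ) : ContDiff ℝ ∞ (smoothStep p ε) :=
  Real.smoothTransition.contDiff.comp ((contDiff_id.sub contDiff_const).div_const ε)

lemma smoothStep_eq_zero {p ε x : ℝ} (hε : 0 < ε) (hx : x ≤ p) : smoothStep p ε x = 0 :=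
  Real.smoothTransition.zero_of_nonpos (div_nonpos_of_nonpos_of_nonneg (by linarith) hε.le)

lemma smoothStep_eq_one {p ε x : ℝ} (hε : 0 < ε) (hx : p + ε ≤ x) : smoothStep p ε x = 1 :=
  Real.smoothTransition.one_of_one_le ((one_le_div hε).2 (by linarith))

lemma deriv_smoothStep_nonneg {p ε : ℝ} (hε : 0 < ε) (x : ℝ) : 0 ≤ deriv (smoothStep p ε) x :=
  Monotone.deriv_nonneg fun _ _ hxy => Real.smoothTransition.monotone
    (div_le_div_of_nonneg_right (sub_le_sub_right hxy p) hε.le)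

lemma continuous_deriv_smoothStep (p ε : ℝ) : Continuous (deriv (smoothStep p ε)) :=
  (contDiff_smoothStep p ε).continuous_deriv (by simp)

lemma deriv_smoothStep_eq_zero {p ε x : ℝ} (hε : 0 < ε) (hx : x < p ∨ p + ε < x) :
    deriv (smoothStep p ε) x = 0 := by
  rcases hx with hx | hx
  · have : smoothStep p ε =ᶠ[𝓝 x] fun _ => 0 := by
      filter_upwards [gt_mem_nhds hx] with y hy using smoothStep_eq_zero hε hy.le
    rw [this.deriv_eq, deriv_const]
  · have : smoothStep p ε =ᶠ[𝓝 x] fun _ => 1 := by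
      filter_upwards [lt_mem_nhds hx] with y hy using smoothStep_eq_one hε hy.le
    rw [this.deriv_eq, deriv_const]

lemma tendsto_integral_deriv_smoothStep [CompleteSpace E] {F : ℝ → E} {s c p : ℝ}
    (hp : p ∈ Ico s c) (hF : ContinuousOn F (Icc s c)) :
    Tendsto (fun ε => ∫ x in s..c, deriv (smoothStep p ε) x • F x) (𝓝[>] 0) (𝓝 (F p)) := by
  have hsc : s ≤ c := hp.1.trans hp.2.le
  rw [Metric.tendsto_nhds]
  intro η hη
  obtain ⟨ρ, hρ, hclose⟩ := Metric.continuousWithinAt_iff.1 (hF p ⟨hp.1, hp.2.le⟩) (η / 2)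
    (by positivity)
  filter_upwards [self_mem_nhdsWithin, mem_nhdsWithin_of_mem_nhds (gt_mem_nhds hρ),
    mem_nhdsWithin_of_mem_nhds (gt_mem_nhds (sub_pos.2 hp.2))] with ε hε hερ hεc
  have hε : 0 < ε := hε
  have hi : IntervalIntegrable (deriv (smoothStep p ε)) volume s c :=
    (continuous_deriv_smoothStep p ε).intervalIntegrable _ _
  have h1 : ∫ x in s..c, deriv (smoothStep p ε) x = 1 := by
    rw [intervalIntegral.integral_deriv_eq_sub
      (fun x _ => ((contDiff_smoothStep p ε).differentiable (by simp)) x) hi,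
      smoothStep_eq_one hε (by linarith), smoothStep_eq_zero hε hp.1, sub_zero]
  have hF' : IntervalIntegrable (fun x => deriv (smoothStep p ε) x • F x) volume s c :=
    ((continuous_deriv_smoothStep p ε).continuousOn.smul
      (by rwa [uIcc_of_le hsc])).intervalIntegrable
  have hc' : IntervalIntegrable (fun x => deriv (smoothStep p ε) x • F p) volume s c :=
    ((continuous_deriv_smoothStep p ε).smul continuous_const).intervalIntegrable _ _
  have h2 : (∫ x in s..c, deriv (smoothStep p ε) x • F x) - F p
      = ∫ x in s..c, deriv (smoothStep p ε) x • (F x - F p) := by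
    simp_rw [smul_sub]
    rw [intervalIntegral.integral_sub hF' hc', intervalIntegral.integral_smul_const, h1, one_smul]
  rw [dist_eq_norm, h2]
  refine lt_of_le_of_lt (intervalIntegral.norm_integral_le_of_norm_le (μ := volume)
    (g := fun x => deriv (smoothStep p ε) x * (η / 2)) hsc
    (ae_of_all _ fun x hx => ?_) (hi.mul_const _)) ?_
  · rw [norm_smul, Real.norm_of_nonneg (deriv_smoothStep_nonneg hε x)]
    by_cases hx' : x < p ∨ p + ε < x
    · rw [deriv_smoothStep_eq_zero hε hx']; simp
    · push Not at hx'
      refine mul_le_mul_of_nonneg_left ?_ (deriv_smoothStep_nonneg hε x)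
      rw [← dist_eq_norm]
      refine (hclose (Ioc_subset_Icc_self hx) ?_).le
      rw [Real.dist_eq, abs_lt]
      constructor <;> linarith
  · rw [intervalIntegral.integral_mul_const, h1]
    linarith

lemma tendsto_integral_smoothStep {g : ℝ → E} {s c p : ℝ}
    (hp : p ∈ Ico s c) (hg : IntervalIntegrable g volume s c) :
    Tendsto (fun ε => ∫ x in s..c, smoothStep p ε x • g x) (𝓝[>] 0) (𝓝 (∫ x in p..c, g x)) := by
  have hsc : s ≤ c := hp.1.trans hp.2.le
  have hlim : ∫ x in p..c, g x = ∫ x in s..c, (Ioi p).indicator g x := by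
    rw [intervalIntegral.integral_of_le hsc, intervalIntegral.integral_of_le hp.2.le,
      setIntegral_indicator measurableSet_Ioi]
    congr 2
    ext x
    simp only [mem_Ioc, mem_inter_iff, mem_Ioi]
    have := hp.1
    constructor
    · rintro ⟨h1, h2⟩; exact ⟨⟨by linarith, h2⟩, h1⟩
    · rintro ⟨⟨_, h2⟩, h1⟩; exact ⟨h1, h2⟩
  rw [hlim]
  refine intervalIntegral.tendsto_integral_filter_of_dominated_convergence (fun x => ‖g x‖)
    (Eventually.of_forall fun ε => ?_) (Eventually.of_forall fun ε => ae_of_all _ fun x _ => ?_)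
    hg.norm (ae_of_all _ fun x _ => ?_)
  · exact (contDiff_smoothStep p ε).continuous.aestronglyMeasurable.smul
      hg.aestronglyMeasurable_restrict_uIoc
  · rw [norm_smul, smoothStep, Real.norm_of_nonneg (Real.smoothTransition.nonneg _)]
    exact mul_le_of_le_one_left (norm_nonneg _) (Real.smoothTransition.le_one _)
  · refine tendsto_const_nhds.congr' ?_
    by_cases hx : p < x
    · filter_upwards [self_mem_nhdsWithin,
        mem_nhdsWithin_of_mem_nhds (gt_mem_nhds (sub_pos.2 hx))] with ε hε hεx
      rw [indicator_of_mem (show x ∈ Ioi p from hx), smoothStep_eq_one hε (by linarith), one_smul]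
    · filter_upwards [self_mem_nhdsWithin] with ε hε
      rw [indicator_of_notMem (show x ∉ Ioi p from hx), smoothStep_eq_zero hε (not_lt.1 hx),
        zero_smul]

/-- A weakly differentiable function with a continuous representative is the primitive of its weak
derivative. -/
theorem IsWeakDerivOn.sub_eq_integral [CompleteSpace E] {Ω : Set ℝ} (hΩ : IsOpen Ω)
    {f f₀ g : ℝ → E} (h : IsWeakDerivOn Ω f g) (hf : f =ᵐ[volume.restrict Ω] f₀)
    (hf₀ : ContinuousOn f₀ Ω) {s t : ℝ} (hst : s ≤ t) (hI : Icc s t ⊆ Ω) :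
    f₀ t - f₀ s = ∫ x in s..t, g x := by
  obtain ⟨δ, hδ, hball⟩ := Metric.isOpen_iff.1 hΩ t (hI ⟨hst, le_rfl⟩)
  set c := t + δ / 2 with hc
  have htc : t < c := by linarith
  have hsc : s < c := by linarith
  have hcΩ : Icc s c ⊆ Ω := by
    intro x hx
    rcases le_total x t with hxt | hxt
    · exact hI ⟨hx.1, hxt⟩
    · refine hball ?_
      rw [Metric.mem_ball, Real.dist_eq, abs_lt]
      have := hx.2
      constructor <;> linarith
  have hgi : IntervalIntegrable g volume s c := by
    rw [intervalIntegrable_iff_integrableOn_Icc_of_le hsc.le]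
    exact h.locallyIntegrableOn_deriv.integrableOn_compact_subset hcΩ isCompact_Icc
  have hf₀c : ContinuousOn f₀ (Icc s c) := hf₀.mono hcΩ
  set φ : ℝ → ℝ → ℝ := fun ε x => smoothStep s ε x - smoothStep t ε x with hφ
  have hφs : ∀ ε, ContDiff ℝ ∞ (φ ε) := fun ε =>
    (contDiff_smoothStep s ε).sub (contDiff_smoothStep t ε)
  have hφd : ∀ ε x, deriv (φ ε) x = deriv (smoothStep s ε) x - deriv (smoothStep t ε) x :=
    fun ε x => deriv_fun_sub (((contDiff_smoothStep s ε).differentiable (by simp)) x)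
      (((contDiff_smoothStep t ε).differentiable (by simp)) x)
  have hsmall : ∀ᶠ ε in 𝓝[>] (0 : ℝ), 0 < ε ∧ t + ε ≤ c := by
    filter_upwards [self_mem_nhdsWithin, mem_nhdsWithin_of_mem_nhds
      (gt_mem_nhds (show (0 : ℝ) < δ / 2 by positivity))] with ε h1 h2
    exact ⟨h1, by rw [hc]; linarith⟩
  have hsupp : ∀ ε, 0 < ε → t + ε ≤ c → tsupport (φ ε) ⊆ Icc s c := by
    intro ε hε hεc
    refine closure_minimal (fun x hx => ?_) isClosed_Icc
    by_contra hxI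
    apply hx
    simp only [hφ]
    rw [mem_Icc, not_and_or, not_le, not_le] at hxI
    rcases hxI with hlt | hlt
    · rw [smoothStep_eq_zero hε hlt.le, smoothStep_eq_zero hε (by linarith), sub_zero]
    · rw [smoothStep_eq_one hε (by linarith), smoothStep_eq_one hε (by linarith), sub_self]
  have heq : ∀ᶠ ε in 𝓝[>] (0 : ℝ),
      (∫ x in s..c, deriv (smoothStep s ε) x • f₀ x)
          - (∫ x in s..c, deriv (smoothStep t ε) x • f₀ x)
        = -((∫ x in s..c, smoothStep s ε x • g x) - ∫ x in s..c, smoothStep t ε x • g x) := by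
    filter_upwards [hsmall] with ε ⟨hε, hεc⟩
    have h1 := h.integral_eq (φ ε) (hφs ε)
      (HasCompactSupport.of_support_subset_isCompact isCompact_Icc
        (subset_closure.trans (hsupp ε hε hεc))) ((hsupp ε hε hεc).trans hcΩ)
    have h2 : ∫ x in Ω, deriv (φ ε) x • f x = ∫ x in Ω, deriv (φ ε) x • f₀ x :=
      integral_congr_ae (by filter_upwards [hf] with x hx; rw [hx])
    have h3 : ∀ F : ℝ → E, ∀ ψ : ℝ → ℝ, (∀ x, x ∉ Icc s c → ψ x = 0) →
        ∫ x in Ω, ψ x • F x = ∫ x in s..c, ψ x • F x := by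
      intro F ψ hψ
      rw [intervalIntegral.integral_of_le hsc.le, ← integral_Icc_eq_integral_Ioc]
      exact setIntegral_eq_of_subset_of_forall_sdiff_eq_zero hΩ.measurableSet hcΩ
        fun x hx => by rw [hψ x hx.2, zero_smul]
    rw [h2, h3 f₀ _ fun x hx => ?_, h3 g _ fun x hx => ?_] at h1
    · simp_rw [hφd] at h1
      simp only [hφ, sub_smul] at h1
      rwa [intervalIntegral.integral_sub, intervalIntegral.integral_sub] at h1
      · exact hgi.continuousOn_smul (contDiff_smoothStep s ε).continuous.continuousOn
      · exact hgi.continuousOn_smul (contDiff_smoothStep t ε).continuous.continuousOn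
      · exact ((continuous_deriv_smoothStep s ε).continuousOn.smul
          (by rwa [uIcc_of_le hsc.le])).intervalIntegrable
      · exact ((continuous_deriv_smoothStep t ε).continuousOn.smul
          (by rwa [uIcc_of_le hsc.le])).intervalIntegrable
    · exact image_eq_zero_of_notMem_tsupport fun hx' => hx (hsupp ε hε hεc hx')
    · exact Function.notMem_support.1 fun hx' =>
        hx (hsupp ε hε hεc (support_deriv_subset hx'))
  have hsm : s ∈ Ico s c := ⟨le_rfl, hsc⟩
  have htm : t ∈ Ico s c := ⟨hst, htc⟩
  have hL := (tendsto_integral_deriv_smoothStep hsm hf₀c).sub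
    (tendsto_integral_deriv_smoothStep htm hf₀c)
  have hR := ((tendsto_integral_smoothStep hsm hgi).sub (tendsto_integral_smoothStep htm hgi)).neg
  have hlim := tendsto_nhds_unique (hL.congr' heq) hR
  have hsplit := intervalIntegral.integral_add_adjacent_intervals
    (hgi.mono_set (by rw [uIcc_of_le hst, uIcc_of_le hsc.le]; exact Icc_subset_Icc_right htc.le))
    (hgi.mono_set (by rw [uIcc_of_le htc.le, uIcc_of_le hsc.le]; exact Icc_subset_Icc_left hst))
  rw [← hsplit, add_sub_cancel_right] at hlim
  rw [← neg_sub, hlim, neg_neg]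

lemma IsWeakDerivOn.mono {Ω Ω' : Set ℝ} {f g : ℝ → E} (h : IsWeakDerivOn Ω f g)
    (hΩ : MeasurableSet Ω) (hsub : Ω' ⊆ Ω) : IsWeakDerivOn Ω' f g where
  locallyIntegrableOn := h.locallyIntegrableOn.mono_set hsub
  locallyIntegrableOn_deriv := h.locallyIntegrableOn_deriv.mono_set hsub
  integral_eq φ hφ hc hs := by
    have h1 := h.integral_eq φ hφ hc (hs.trans hsub)
    rwa [setIntegral_eq_of_subset_of_forall_sdiff_eq_zero hΩ hsub fun x hx => ?_,
      setIntegral_eq_of_subset_of_forall_sdiff_eq_zero hΩ hsub fun x hx => ?_] at h1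
    · rw [image_eq_zero_of_notMem_tsupport fun hx' => hx.2 (hs hx'), zero_smul]
    · rw [Function.notMem_support.1 fun hx' => hx.2 (hs (support_deriv_subset hx')), zero_smul]

/-- A `C¹` function on `[a, b]` of class `W^{2,1}` has an absolutely continuous derivative. -/
theorem hasACDeriv_of_memW21 {f : ℝ → ℂ} {a b : ℝ} (hab : a < b)
    (hf : ContDiffOn ℝ 1 f (Icc a b)) (hw : MemW21 (Ioo a b) f) :
    HasACDeriv a b f (derivWithin f (Icc a b)) := by
  obtain ⟨g, h, hfg, hgh, -, hgi, hhi⟩ := hw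
  set f' := derivWithin f (Icc a b) with hf'
  have hd : ∀ t ∈ Icc a b, HasDerivWithinAt f (f' t) (Icc a b) t := fun t ht =>
    (hf.differentiableOn (by simp) t ht).hasDerivWithinAt
  have hf'c : ContinuousOn f' (Icc a b) :=
    hf.continuousOn_derivWithin (uniqueDiffOn_Icc hab) (by simp)
  have hIoo : ∀ {s t : ℝ}, s ∈ Ioo a b → t ∈ Ioo a b → Icc s t ⊆ Ioo a b := fun hs ht x hx =>
    ⟨hs.1.trans_le hx.1, hx.2.trans_lt ht.2⟩
  have hgi' : IntervalIntegrable g volume a b :=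
    (intervalIntegrable_iff_integrableOn_Ioo_of_le hab.le).2 hgi
  have hhi' : IntervalIntegrable h volume a b :=
    (intervalIntegrable_iff_integrableOn_Ioo_of_le hab.le).2 hhi
  have hgf' : g =ᵐ[volume.restrict (Ioo a b)] f' := by
    refine ae_restrict_of_ae_restrict_inter_Ioo fun s t hs ht hst => ?_
    have hsub : Ioo s t ⊆ Ioo a b := Ioo_subset_Icc_self.trans (hIoo hs ht)
    rw [inter_eq_right.2 hsub, ae_restrict_iff' measurableSet_Ioo]
    filter_upwards [hgi'.ae_hasDerivAt_integral] with x hx hxI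
    have hxab := hsub hxI
    have h1 := hx (by rw [uIcc_of_le hab.le]; exact Ioo_subset_Icc_self hxab) s
      (by rw [uIcc_of_le hab.le]; exact Ioo_subset_Icc_self hs)
    have h2 : HasDerivAt f (g x) x := by
      refine (h1.const_add (f s)).congr_of_eventuallyEq ?_
      filter_upwards [Ioo_mem_nhds hxI.1 hxI.2] with y hy
      rw [← hfg.sub_eq_integral isOpen_Ioo (ae_eq_refl f)
        (hf.continuousOn.mono Ioo_subset_Icc_self) hy.1.le (hIoo hs (hsub hy))]
      abel
    exact h2.unique ((hd x (Ioo_subset_Icc_self hxab)).hasDerivAt (Icc_mem_nhds hxab.1 hxab.2))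
  obtain ⟨m, hm⟩ : ∃ m, m ∈ Ioo a b := ⟨(a + b) / 2, by constructor <;> linarith⟩
  have hmI := Ioo_subset_Icc_self hm
  have hsubI : ∀ {s t : ℝ}, s ∈ Icc a b → t ∈ Icc a b → uIcc s t ⊆ uIcc a b := fun hs ht => by
    rw [uIcc_of_le hab.le]; exact ordConnected_Icc.uIcc_subset hs ht
  have hprim : EqOn f' (fun t => f' m + ∫ x in m..t, h x) (Icc a b) := by
    refine EqOn.of_subset_closure (s := Ioo a b) (fun t ht => ?_) hf'c ?_ Ioo_subset_Icc_self
      (closure_Ioo hab.ne).ge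
    · rcases le_total m t with hmt | hmt
      · rw [← hgh.sub_eq_integral isOpen_Ioo hgf' (hf'c.mono Ioo_subset_Icc_self) hmt (hIoo hm ht)]
        abel
      · have := hgh.sub_eq_integral isOpen_Ioo hgf' (hf'c.mono Ioo_subset_Icc_self) hmt (hIoo ht hm)
        rw [intervalIntegral.integral_symm, ← this]
        abel
    · refine continuousOn_const.add ?_
      have := intervalIntegral.continuousOn_primitive_interval'
        hhi' (show m ∈ uIcc a b by rwa [uIcc_of_le hab.le])
      rwa [uIcc_of_le hab.le] at this
  refine ⟨hd, (hhi'.norm.absolutelyContinuousOnInterval_intervalIntegral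
    left_mem_uIcc).of_dist_le fun x hx y hy => ?_⟩
  rw [uIcc_of_le hab.le] at hx hy
  have hi : ∀ {s t}, s ∈ Icc a b → t ∈ Icc a b → IntervalIntegrable h volume s t := fun hs ht =>
    hhi'.mono_set (hsubI hs ht)
  rw [hprim hx, hprim hy, dist_eq_norm, Real.dist_eq, add_sub_add_left_eq_sub,
    intervalIntegral.integral_interval_sub_left (hi hmI hx) (hi hmI hy),
    intervalIntegral.integral_interval_sub_left (hi (left_mem_Icc.2 hab.le) hx).norm
      (hi (left_mem_Icc.2 hab.le) hy).norm]
  exact intervalIntegral.norm_integral_le_abs_integral_norm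

/-- Restriction of a function of class `W^{2,1}_loc` to a bounded interval. -/
lemma MemW21Loc.memW21_Ioo {f : ℝ → E} (hf : MemW21Loc univ f) (a b : ℝ) :
    MemW21 (Ioo a b) f := by
  obtain ⟨g, h, hfg, hgh⟩ := hf
  have hi : ∀ {u : ℝ → E}, LocallyIntegrableOn u univ → IntegrableOn u (Ioo a b) := fun hu =>
    (hu.integrableOn_compact_subset (subset_univ (Icc a b)) isCompact_Icc).mono_set
      Ioo_subset_Icc_self
  exact ⟨g, h, hfg.mono MeasurableSet.univ (subset_univ _), hgh.mono MeasurableSet.univ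
    (subset_univ _), hi hfg.locallyIntegrableOn, hi hfg.locallyIntegrableOn_deriv,
    hi hgh.locallyIntegrableOn_deriv⟩

end WeakDerivative

section SobolevOfAC

open Filter

lemma AbsolutelyContinuousOnInterval.integral_deriv_mul_testFunction {u φ : ℝ → ℝ} {a b : ℝ}
    (hab : a ≤ b) (hu : AbsolutelyContinuousOnInterval u a b) (hφ : ContDiff ℝ 1 φ)
    (hs : tsupport φ ⊆ Ioo a b) :
    ∫ x in Ioo a b, deriv φ x * u x = -∫ x in Ioo a b, φ x * deriv u x := by
  have hφac : AbsolutelyContinuousOnInterval φ a b :=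
    hφ.contDiffOn.absolutelyContinuousOnInterval
  have ha : φ a = 0 := image_eq_zero_of_notMem_tsupport fun h => (hs h).1.false
  have hb : φ b = 0 := image_eq_zero_of_notMem_tsupport fun h => (hs h).2.false
  have h1 := hφac.integral_mul_deriv_eq_deriv_mul hu
  rw [ha, hb, zero_mul, zero_mul, sub_zero, zero_sub, intervalIntegral.integral_of_le hab,
    intervalIntegral.integral_of_le hab, integral_Ioc_eq_integral_Ioo,
    integral_Ioc_eq_integral_Ioo] at h1
  rw [h1, neg_neg]

lemma AbsolutelyContinuousOnInterval.integrableOn_deriv {u : ℝ → ℝ} {a b : ℝ} (hab : a ≤ b)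
    (hu : AbsolutelyContinuousOnInterval u a b) : IntegrableOn (deriv u) (Ioo a b) :=
  (intervalIntegrable_iff_integrableOn_Ioo_of_le hab).1 hu.intervalIntegrable_deriv

/-- Absolutely continuous functions are weakly differentiable. -/
lemma isWeakDerivOn_of_absolutelyContinuous {d : ℕ} {a b : ℝ} (hab : a ≤ b)
    {u v : ℝ → EuclideanSpace ℝ (Fin d)}
    (hu : ∀ j, AbsolutelyContinuousOnInterval (fun t => u t j) a b)
    (hv : ∀ j, ∀ t ∈ Ioo a b, v t j = deriv (fun t => u t j) t) :
    IsWeakDerivOn (Ioo a b) u v ∧ IntegrableOn u (Ioo a b) ∧ IntegrableOn v (Ioo a b) := by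
  have hui : ∀ j, IntegrableOn (fun t => u t j) (Ioo a b) := fun j => by
    have := (hu j).continuousOn
    rw [uIcc_of_le hab] at this
    exact this.integrableOn_Icc.mono_set Ioo_subset_Icc_self
  have hvi : ∀ j, IntegrableOn (fun t => v t j) (Ioo a b) := fun j =>
    ((hu j).integrableOn_deriv hab).congr_fun (fun t ht => (hv j t ht).symm) measurableSet_Ioo
  have hU : IntegrableOn u (Ioo a b) := Integrable.of_eval_piLp hui
  have hV : IntegrableOn v (Ioo a b) := Integrable.of_eval_piLp hvi
  refine ⟨⟨hU.locallyIntegrableOn, hV.locallyIntegrableOn, fun φ hφ hc hs => ?_⟩, hU, hV⟩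
  have hbdd : ∀ {ψ w : ℝ → ℝ}, Continuous ψ → IntegrableOn w (Ioo a b) →
      IntegrableOn (fun t => ψ t * w t) (Ioo a b) := fun hψ hw =>
    hw.continuousOn_mul_of_subset hψ.continuousOn isCompact_Icc measurableSet_Ioo
      Ioo_subset_Icc_self
  have hφ' : Continuous (deriv φ) := hφ.continuous_deriv (by simp)
  ext j
  have e1 : (∫ x in Ioo a b, deriv φ x • u x) j = ∫ x in Ioo a b, deriv φ x * u x j :=
    eval_integral_piLp (f := fun x => deriv φ x • u x) (fun i => hbdd hφ' (hui i)) j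
  have e2 : (∫ x in Ioo a b, φ x • v x) j = ∫ x in Ioo a b, φ x * v x j :=
    eval_integral_piLp (f := fun x => φ x • v x) (fun i => hbdd hφ.continuous (hvi i)) j
  rw [PiLp.neg_apply, e1, e2, (hu j).integral_deriv_mul_testFunction hab (hφ.of_le (by simp)) hs]
  congr 1
  exact setIntegral_congr_fun measurableSet_Ioo fun t ht => by
    simp only
    rw [hv j t ht]

lemma isWeakDerivOn_univ_of_Ioo {E : Type*} [NormedAddCommGroup E] [NormedSpace ℝ E]
    {f g : ℝ → E} (h : ∀ N : ℕ, IsWeakDerivOn (Ioo (-(N : ℝ)) N) f g) :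
    IsWeakDerivOn univ f g := by
  have hex : ∀ x : ℝ, ∃ N : ℕ, x ∈ Ioo (-(N : ℝ)) N := fun x => by
    obtain ⟨N, hN⟩ := exists_nat_gt |x|
    exact ⟨N, abs_lt.1 hN⟩
  have hloc : ∀ {u : ℝ → E}, (∀ N : ℕ, LocallyIntegrableOn u (Ioo (-(N : ℝ)) N)) →
      LocallyIntegrableOn u univ := fun hu x _ => by
    obtain ⟨N, hN⟩ := hex x
    have := hu N x hN
    rwa [isOpen_Ioo.nhdsWithin_eq hN, ← nhdsWithin_univ] at this
  refine ⟨hloc fun N => (h N).locallyIntegrableOn, hloc fun N => (h N).locallyIntegrableOn_deriv,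
    fun φ hφ hc _ => ?_⟩
  obtain ⟨R, hR⟩ := hc.isBounded.subset_closedBall 0
  obtain ⟨N, hN⟩ := exists_nat_gt R
  have hsub : tsupport φ ⊆ Ioo (-(N : ℝ)) N := fun x hx => by
    have := hR hx
    rw [mem_closedBall_zero_iff, Real.norm_eq_abs] at this
    exact abs_lt.1 (this.trans_lt hN)
  have h1 := (h N).integral_eq φ hφ hc hsub
  rw [setIntegral_eq_of_subset_of_forall_sdiff_eq_zero MeasurableSet.univ
      (subset_univ (Ioo (-(N : ℝ)) N)) fun x hx => ?_,
    setIntegral_eq_of_subset_of_forall_sdiff_eq_zero MeasurableSet.univ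
      (subset_univ (Ioo (-(N : ℝ)) N)) fun x hx => ?_]
  · exact h1
  · rw [image_eq_zero_of_notMem_tsupport fun hx' => hx.2 (hsub hx'), zero_smul]
  · rw [Function.notMem_support.1 fun hx' => hx.2 (hsub (support_deriv_subset hx')), zero_smul]

lemma w21Norm_le {E : Type*} [NormedAddCommGroup E] [NormedSpace ℝ E] {Ω : Set ℝ} {f g h : ℝ → E}
    (hfg : IsWeakDerivOn Ω f g) (hgh : IsWeakDerivOn Ω g h) :
    w21Norm Ω f ≤ (∫⁻ x in Ω, ‖f x‖ₑ) + (∫⁻ x in Ω, ‖g x‖ₑ) + (∫⁻ x in Ω, ‖h x‖ₑ) :=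
  iInf_le_of_le g <| iInf_le_of_le h <| iInf_le_of_le hfg <| iInf_le_of_le hgh le_rfl

lemma lintegral_enorm_le_sum {d : ℕ} {μ : Measure ℝ} {u : ℝ → EuclideanSpace ℝ (Fin d)}
    (hu : Integrable u μ) :
    ∫⁻ x, ‖u x‖ₑ ∂μ ≤ ENNReal.ofReal (∑ j, ∫ x, |u x j| ∂μ) := by
  rw [← ofReal_integral_norm_eq_lintegral_enorm hu,
    ← integral_finsetSum _ fun j _ => (hu.eval_piLp j).abs]
  refine ENNReal.ofReal_le_ofReal (integral_mono hu.norm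
    (integrable_finsetSum _ fun j _ => (hu.eval_piLp j).abs) fun x => ?_)
  have h1 : u x = ∑ j, EuclideanSpace.single j (u x j) := by
    ext i; simp [Finset.sum_apply, Pi.single_apply]
  conv_lhs => rw [h1]
  exact (norm_sum_le _ _).trans (Finset.sum_le_sum fun j _ => by simp)

/-- A function whose derivative is locally absolutely continuous is difference-convex. -/
lemma isDCOn_univ_of_absolutelyContinuous {f w : ℝ → ℝ} (hd : ∀ t, HasDerivAt f (w t) t)
    (hw : ∀ N : ℕ, AbsolutelyContinuousOnInterval w (-N) N) : IsDCOn univ f := by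
  have hac : ∀ s t : ℝ, AbsolutelyContinuousOnInterval w s t := by
    intro s t
    obtain ⟨N, hN⟩ := exists_nat_ge (max |s| |t|)
    have h1 := abs_le.1 ((le_max_left |s| |t|).trans hN)
    have h2 := abs_le.1 ((le_max_right |s| |t|).trans hN)
    refine (hw N).mono ?_
    rw [uIcc_of_le (show -(N : ℝ) ≤ N by linarith)]
    exact ordConnected_Icc.uIcc_subset h1 h2
  have hi : ∀ s t : ℝ, IntervalIntegrable (fun x => |deriv w x|) volume s t := fun s t =>
    (hac s t).intervalIntegrable_deriv.abs
  set P : ℝ → ℝ := fun t => ∫ x in (0 : ℝ)..t, |deriv w x| with hP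
  have hPc : Continuous P := intervalIntegral.continuous_primitive hi 0
  have hPsub : ∀ s t, P t - P s = ∫ x in s..t, |deriv w x| := fun s t =>
    intervalIntegral.integral_interval_sub_left (hi _ _) (hi _ _)
  have hPm : Monotone P := fun s t hst => by
    rw [← sub_nonneg, hPsub]
    exact intervalIntegral.integral_nonneg hst fun x _ => abs_nonneg _
  have hwPm : Monotone fun t => w t + P t := fun s t hst => by
    have h1 := (hac s t).integral_deriv_eq_sub
    have h2 := intervalIntegral.abs_integral_le_integral_abs (f := deriv w) (μ := volume) hst
    rw [h1, ← hPsub] at h2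
    simp only
    linarith [(abs_le.1 h2).1]
  set Q : ℝ → ℝ := fun t => ∫ x in (0 : ℝ)..t, P x with hQ
  have hQd : ∀ t, HasDerivAt Q (P t) t := fun t => (hPc.integral_hasStrictDerivAt 0 t).hasDerivAt
  have hfQd : ∀ t, HasDerivAt (fun t => f t + Q t) (w t + P t) t := fun t => (hd t).add (hQd t)
  refine ⟨fun t => f t + Q t, Q, ?_, fun t _ => (hfQd t).continuousAt.continuousWithinAt, ?_,
    fun t _ => (hQd t).continuousAt.continuousWithinAt, fun t _ => by simp⟩
  · refine Monotone.convexOn_univ_of_deriv (fun t => (hfQd t).differentiableAt) ?_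
    rwa [show deriv (fun t => f t + Q t) = _ from funext fun t => (hfQd t).deriv]
  · refine Monotone.convexOn_univ_of_deriv (fun t => (hQd t).differentiableAt) ?_
    rwa [show deriv Q = P from funext fun t => (hQd t).deriv]

end SobolevOfAC

section MatrixCurve

variable {m n : ℕ} {a b M L : ℝ} {A A' : ℝ → Matrix (Fin m) (Fin n) ℂ}

lemma IntervalIntegrable.finsetSum_fun {ι : Type*} (s : Finset ι) {f : ι → ℝ → ℝ}
    (h : ∀ i ∈ s, IntervalIntegrable (f i) volume a b) :
    IntervalIntegrable (fun x => ∑ i ∈ s, f i x) volume a b := by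
  have := IntervalIntegrable.sum s h
  rwa [Finset.sum_fn] at this

/-- The sum of the moduli of the derivatives of the real and imaginary parts of the entries. -/
noncomputable def entryVariation (A' : ℝ → Matrix (Fin m) (Fin n) ℂ) (t : ℝ) : ℝ :=
  ∑ i, ∑ j, (|deriv (fun t => (A' t i j).re) t| + |deriv (fun t => (A' t i j).im) t|)

lemma HasACDeriv.im {f f' : ℝ → ℂ} (h : HasACDeriv a b f f') :
    HasACDeriv a b (fun t => (f t).im) fun t => (f' t).im where
  hasDeriv t ht := Complex.imCLM.hasFDerivAt.comp_hasDerivWithinAt t (h.hasDeriv t ht)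
  ac := h.ac.of_dist_le fun x _ y _ => by
    rw [Real.dist_eq, dist_eq_norm, ← Complex.sub_im]; exact Complex.abs_im_le_norm _

lemma isMatrixCurve_of_hasACDeriv (hab : a ≤ b)
    (h : ∀ i j, HasACDeriv a b (fun t => A t i j) fun t => A' t i j)
    (hM : ∀ t ∈ Icc a b, entrySum (A t) ≤ M) (hL : ∀ t ∈ Icc a b, entrySum (A' t) ≤ L) :
    IsMatrixCurve a b M L A A' fun t => ∫ x in a..t, entryVariation A' x := by
  have hi : ∀ {s t : ℝ}, s ∈ Icc a b → t ∈ Icc a b →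
      IntervalIntegrable (entryVariation A') volume s t := by
    intro s t hs ht
    refine IntervalIntegrable.mono_set (a := a) (b := b) ?_ ?_
    · exact .finsetSum_fun _ fun i _ => .finsetSum_fun _ fun j _ =>
        (h i j).re.ac.intervalIntegrable_deriv.abs.add (h i j).im.ac.intervalIntegrable_deriv.abs
    · rw [uIcc_of_le hab]; exact ordConnected_Icc.uIcc_subset hs ht
  have hsub : ∀ s ∈ Icc a b, ∀ t ∈ Icc a b, (∫ x in a..t, entryVariation A' x)
      - ∫ x in a..s, entryVariation A' x = ∫ x in s..t, entryVariation A' x := fun s hs t ht =>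
    intervalIntegral.integral_interval_sub_left (hi (left_mem_Icc.2 hab) ht)
      (hi (left_mem_Icc.2 hab) hs)
  have hnn : ∀ t, 0 ≤ entryVariation A' t := fun t => by unfold entryVariation; positivity
  refine ⟨h, hM, hL, fun s hs t ht hst => ?_, ?_, fun s hs t ht hst => ?_⟩
  · rw [← sub_nonneg, hsub s hs t ht]
    exact intervalIntegral.integral_nonneg hst fun x _ => hnn x
  · have := intervalIntegral.continuousOn_primitive_interval'
      (hi (left_mem_Icc.2 hab) (right_mem_Icc.2 hab)) left_mem_uIcc
    rwa [uIcc_of_le hab] at this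
  · rw [hsub s hs t ht]
    have hmono : uIcc s t ⊆ uIcc a b := by
      rw [uIcc_of_le hab]; exact ordConnected_Icc.uIcc_subset hs ht
    have key : ∀ {u : ℝ → ℝ}, AbsolutelyContinuousOnInterval u a b →
        IntervalIntegrable (fun x => |deriv u x|) volume s t ∧
        |u t - u s| ≤ ∫ x in s..t, |deriv u x| := fun {u} hu => by
      have h1 := hu.mono hmono
      refine ⟨h1.intervalIntegrable_deriv.abs, ?_⟩
      rw [← h1.integral_deriv_eq_sub]
      exact intervalIntegral.abs_integral_le_integral_abs hst
    unfold entryVariation entrySum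
    rw [intervalIntegral.integral_finsetSum fun i _ => IntervalIntegrable.finsetSum_fun _ fun j _ =>
        (key (h i j).re.ac).1.add (key (h i j).im.ac).1]
    refine Finset.sum_le_sum fun i _ => ?_
    rw [intervalIntegral.integral_finsetSum fun j _ =>
        (key (h i j).re.ac).1.add (key (h i j).im.ac).1]
    refine Finset.sum_le_sum fun j _ => ?_
    rw [intervalIntegral.integral_add (key (h i j).re.ac).1 (key (h i j).im.ac).1]
    refine (Complex.norm_le_abs_re_add_abs_im _).trans (add_le_add ?_ ?_)
    · simpa using (key (h i j).re.ac).2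
    · simpa using (key (h i j).im.ac).2

end MatrixCurve

section Curve

open Filter

variable {m n : ℕ}

lemma exists_entrySum_le {B : ℝ → Matrix (Fin m) (Fin n) ℂ} {a b : ℝ}
    (hB : ∀ i j, ContinuousOn (fun t => B t i j) (Icc a b)) :
    ∃ M, ∀ t ∈ Icc a b, entrySum (B t) ≤ M := by
  have hc : ContinuousOn (fun t => entrySum (B t)) (Icc a b) :=
    continuousOn_finsetSum _ fun i _ => continuousOn_finsetSum _ fun j _ => (hB i j).norm
  obtain ⟨M, hM⟩ := isCompact_Icc.exists_bound_of_continuousOn hc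
  exact ⟨M, fun t ht => (le_abs_self _).trans (hM t ht)⟩

lemma HasACDeriv.congr_deriv {a b : ℝ} (hab : a ≤ b) {f f' g' : ℝ → ℂ} (h : HasACDeriv a b f f')
    (hg : EqOn f' g' (Icc a b)) : HasACDeriv a b f g' where
  hasDeriv t ht := hg ht ▸ h.hasDeriv t ht
  ac := h.ac.of_dist_le fun x hx y hy => by
    rw [uIcc_of_le hab] at hx hy
    rw [hg hx, hg hy]

lemma exists_pos_forall_le {ι : Type*} [Finite ι] {c : ι → ℝ} (hc : ∀ i, 0 < c i) :
    ∃ c₀ > 0, ∀ i, c₀ ≤ c i := by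
  have h1 : ∀ᶠ x in 𝓝[>] (0 : ℝ), ∀ i, x ≤ c i := eventually_all.2 fun i =>
    mem_nhdsWithin_of_mem_nhds (Iic_mem_nhds (hc i))
  obtain ⟨x, hx, hx0⟩ := (h1.and self_mem_nhdsWithin).exists
  exact ⟨x, hx0, hx⟩

lemma IsSingularValueTuple.pos {M : Matrix (Fin m) (Fin n) ℂ}
    {s : EuclideanSpace ℝ (Fin (min m n))} (hs : IsSingularValueTuple M s)
    (hM : M.rank = min m n) (j : Fin (min m n)) : 0 < s j := by
  obtain ⟨π, hπ⟩ := hs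
  rw [hπ]
  exact singularValues_pos_of_rank hM (π j).isLt

/-- Existence of a regular system of singular values for a curve of class `C¹ ∩ W^{2,1}_loc` of
matrices of full rank. -/
theorem exists_regular_singularValue_system {A : ℝ → Matrix (Fin m) (Fin n) ℂ}
    (hA : ∀ i j, ContDiff ℝ 1 fun t => A t i j) (hw : ∀ i j, MemW21Loc univ fun t => A t i j)
    (hrank : ∀ t, (A t).rank = min m n) :
    ∃ σ : ℝ → EuclideanSpace ℝ (Fin (min m n)),
      (∀ t, IsSingularValueTuple (A t) (σ t)) ∧
      ContDiff ℝ 1 σ ∧ (∀ j, IsDCOn univ (fun t => σ t j)) ∧ MemW21Loc univ σ := by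
  set A' : ℝ → Matrix (Fin m) (Fin n) ℂ := fun t => Matrix.of fun i j =>
    deriv (fun t => A t i j) t with hA'
  have hcurve : ∀ a b, a < b → ∃ M L, IsMatrixCurve a b M L A A'
      fun t => ∫ x in a..t, entryVariation A' x := by
    intro a b hab
    obtain ⟨M, hM⟩ := exists_entrySum_le (B := A) (a := a) (b := b) fun i j =>
      (hA i j).continuous.continuousOn
    obtain ⟨L, hL⟩ := exists_entrySum_le (B := A') (a := a) (b := b) fun i j =>
      ((hA i j).continuous_deriv le_rfl).continuousOn
    refine ⟨M, L, isMatrixCurve_of_hasACDeriv hab.le (fun i j => ?_) hM hL⟩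
    refine (hasACDeriv_of_memW21 hab (hA i j).contDiffOn ((hw i j).memW21_Ioo a b)).congr_deriv
      hab.le fun t ht => ?_
    exact ((hA i j).differentiable (by simp) t).derivWithin (uniqueDiffOn_Icc hab t ht)
  obtain ⟨σ, hσ, hσc⟩ := exists_contDiff_singularValues (A := A) (H' := gramDeriv A A')
    (fun t => by
      obtain ⟨M, L, h⟩ := hcurve (t - 1) (t + 1) (by linarith)
      exact ⟨t - 1, t + 1, _, by constructor <;> linarith,
        h.isHermitianCurve_gram (by linarith)⟩) hrank
  have hd : ∀ j t, HasDerivAt (fun t => σ t j) (deriv σ t j) t := fun j t =>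
    ((EuclideanSpace.proj (𝕜 := ℝ) j).hasFDerivAt (x := σ t)).comp_hasDerivAt t
      ((hσc.differentiable (by simp) t).hasDerivAt)
  have hdc : ∀ j, Continuous fun t => deriv σ t j := fun j =>
    (EuclideanSpace.proj (𝕜 := ℝ) j).continuous.comp (hσc.continuous_deriv le_rfl)
  have hac' : ∀ a b : ℝ, a < b → ∀ j,
      AbsolutelyContinuousOnInterval (fun t => deriv σ t j) a b := by
    intro a b hab
    obtain ⟨M, L, h⟩ := hcurve a b hab
    have hmin : ∀ j, ∃ c > 0, ∀ t ∈ Icc a b, c ≤ σ t j := fun j => by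
      obtain ⟨x, -, hx⟩ := isCompact_Icc.exists_isMinOn (nonempty_Icc.2 hab.le)
        (f := fun t => σ t j) fun t _ => (hd j t).continuousAt.continuousWithinAt
      exact ⟨σ x j, (hσ x).pos (hrank x) j, fun t ht => hx ht⟩
    choose c hc hcσ using hmin
    obtain ⟨c₀, hc₀, hle⟩ := exists_pos_forall_le hc
    obtain ⟨C, -, hC⟩ := exists_singularValue_regularity_bound m n M L _ hab hc₀
    exact fun j => (hC A A' _ σ (deriv σ) h le_rfl (fun t _ => hσ t)
      (fun j t _ => (hd j t).hasDerivWithinAt) (fun j => (hdc j).continuousOn)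
      (fun j t ht => (hle j).trans (hcσ j t ht)) j).1
  have hac : ∀ j, ∀ N : ℕ, AbsolutelyContinuousOnInterval (fun t => deriv σ t j) (-N) N := by
    intro j N
    refine (hac' (-(N + 1 : ℕ)) (N + 1 : ℕ) (by push_cast; linarith) j).mono ?_
    have hN : (0 : ℝ) ≤ N := Nat.cast_nonneg N
    rw [uIcc_of_le (by linarith), uIcc_of_le (by push_cast; linarith)]
    exact Icc_subset_Icc (by push_cast; linarith) (by push_cast; linarith)
  refine ⟨σ, hσ, hσc, fun j => isDCOn_univ_of_absolutelyContinuous (hd j) (hac j), deriv σ,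
    fun t => WithLp.toLp 2 fun j => deriv (fun t => deriv σ t j) t,
    isWeakDerivOn_univ_of_Ioo fun N => ?_, isWeakDerivOn_univ_of_Ioo fun N => ?_⟩
  · refine (isWeakDerivOn_of_absolutelyContinuous (neg_le_self (Nat.cast_nonneg N))
      (fun j => ?_) fun j t _ => (hd j t).deriv.symm).1
    exact (contDiff_euclidean.1 hσc j).contDiffOn.absolutelyContinuousOnInterval
  · exact (isWeakDerivOn_of_absolutelyContinuous (neg_le_self (Nat.cast_nonneg N))
      (fun j => hac j N) fun j t _ => rfl).1

end Curve

section DifferenceConvex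

open Filter

/-- A bounded convex function has bounded one-sided derivatives in the interior. -/
lemma ConvexOn.abs_rightDeriv_le {g : ℝ → ℝ} {c ε M x : ℝ} (hε : 0 < ε)
    (hg : ConvexOn ℝ (Ioo (c - 3 * ε) (c + 3 * ε)) g)
    (hM : ∀ y ∈ Ioo (c - 3 * ε) (c + 3 * ε), |g y| ≤ M) (hx : x ∈ Icc (c - ε) (c + ε)) :
    |derivWithin g (Ioi x) x| ≤ 2 * M / ε := by
  have hmem : ∀ y, x - ε ≤ y → y ≤ x + ε → y ∈ Ioo (c - 3 * ε) (c + 3 * ε) := fun y h1 h2 =>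
    ⟨by linarith [hx.1], by linarith [hx.2]⟩
  have hxm := hmem x (by linarith) (by linarith)
  have hlm := hmem (x - ε) le_rfl (by linarith)
  have hrm := hmem (x + ε) (by linarith) le_rfl
  have hxi : x ∈ interior (Ioo (c - 3 * ε) (c + 3 * ε)) := by rwa [interior_Ioo]
  have h1 := hg.rightDeriv_le_slope_of_mem_interior hxi hrm (by linarith)
  have h2 := (hg.slope_le_leftDeriv_of_mem_interior hlm hxi (by linarith)).trans
    (hg.leftDeriv_le_rightDeriv_of_mem_interior hxi)
  rw [slope_def_field, add_sub_cancel_left] at h1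
  rw [slope_def_field, sub_sub_cancel] at h2
  have b1 := abs_le.1 (hM _ hxm)
  have b2 := abs_le.1 (hM _ hlm)
  have b3 := abs_le.1 (hM _ hrm)
  rw [abs_le]
  constructor
  · refine le_trans ?_ h2
    rw [← neg_div]
    exact div_le_div_of_nonneg_right (by linarith) hε.le
  · refine h1.trans ?_
    exact div_le_div_of_nonneg_right (by linarith) hε.le

/-- Bounds for the derivatives of a difference of bounded convex functions. -/
lemma exists_deriv_bound_of_convexOn_sub {g h u w : ℝ → ℝ} {c ε M a b : ℝ} (hε : 0 < ε)
    (hab : a < b) (hg : ConvexOn ℝ (Ioo (c - 3 * ε) (c + 3 * ε)) g)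
    (hh : ConvexOn ℝ (Ioo (c - 3 * ε) (c + 3 * ε)) h)
    (hgM : ∀ y ∈ Ioo (c - 3 * ε) (c + 3 * ε), |g y| ≤ M)
    (hhM : ∀ y ∈ Ioo (c - 3 * ε) (c + 3 * ε), |h y| ≤ M)
    (hu : ∀ y ∈ Ioo (c - 3 * ε) (c + 3 * ε), u y = g y - h y)
    (hd : ∀ t ∈ Icc a b, HasDerivWithinAt u (w t) (Icc a b) t)
    (hw : AbsolutelyContinuousOnInterval w a b) :
    (∀ t ∈ Icc a b ∩ Ioo (c - ε) (c + ε), |w t| ≤ 4 * M / ε) ∧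
      ∫⁻ t in Icc a b ∩ Ioo (c - ε) (c + ε), ‖deriv w t‖ₑ ≤ ENNReal.ofReal (8 * M / ε) := by
  rcases (Icc a b ∩ Ioo (c - ε) (c + ε)).eq_empty_or_nonempty with hE | ⟨t₀, ht₀, ht₀'⟩
  · rw [hE]; simp
  set p := max a (c - ε) with hp
  set q := min b (c + ε) with hq
  have hpq : p < q := max_lt (lt_min hab (ht₀.1.trans_lt ht₀'.2))
    (lt_min (ht₀'.1.trans_le ht₀.2) (by linarith))
  have hsub : Icc a b ∩ Ioo (c - ε) (c + ε) ⊆ Icc p q := fun t ht =>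
    ⟨max_le ht.1.1 ht.2.1.le, le_min ht.1.2 ht.2.2.le⟩
  have hpqab : Icc p q ⊆ Icc a b := Icc_subset_Icc (le_max_left _ _) (min_le_left _ _)
  have hpqc : Icc p q ⊆ Icc (c - ε) (c + ε) := Icc_subset_Icc (le_max_right _ _) (min_le_right _ _)
  have hJ : Icc p q ⊆ interior (Ioo (c - 3 * ε) (c + 3 * ε)) := fun t ht => by
    have := hpqc ht
    rw [interior_Ioo]
    exact ⟨by linarith [this.1], by linarith [this.2]⟩
  set g' : ℝ → ℝ := fun x => derivWithin g (Ioi x) x with hg'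
  set h' : ℝ → ℝ := fun x => derivWithin h (Ioi x) x with hh'
  have hgm : MonotoneOn g' (Icc p q) := hg.monotoneOn_rightDeriv.mono hJ
  have hhm : MonotoneOn h' (Icc p q) := hh.monotoneOn_rightDeriv.mono hJ
  have hgb : ∀ t ∈ Icc p q, |g' t| ≤ 2 * M / ε := fun t ht => hg.abs_rightDeriv_le hε hgM (hpqc ht)
  have hhb : ∀ t ∈ Icc p q, |h' t| ≤ 2 * M / ε := fun t ht => hh.abs_rightDeriv_le hε hhM (hpqc ht)
  have hweq : ∀ t ∈ Ico p q, w t = g' t - h' t := by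
    intro t ht
    have htI : t ∈ Icc p q := Ico_subset_Icc_self ht
    have hti := hJ htI
    have h1 : HasDerivWithinAt u (w t) (Ioi t) t :=
      (hd t (hpqab htI)).mono_of_mem_nhdsWithin
        (mem_of_superset (Ioc_mem_nhdsGT (ht.2.trans_le (min_le_left _ _)))
          fun x hx => ⟨(hpqab htI).1.trans hx.1.le, hx.2⟩)
    have h2 : HasDerivWithinAt u (g' t - h' t) (Ioi t) t := by
      refine ((hg.hasDerivWithinAt_rightDeriv_of_mem_interior hti).sub
        (hh.hasDerivWithinAt_rightDeriv_of_mem_interior hti)).congr_of_eventuallyEq ?_ ?_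
      · filter_upwards [nhdsWithin_le_nhds (isOpen_interior.mem_nhds hti)] with x hx
        exact hu x (interior_subset hx)
      · exact hu t (interior_subset hti)
    exact (uniqueDiffWithinAt_Ioi t).eq_deriv _ h1 h2
  have hwac : AbsolutelyContinuousOnInterval w p q := hw.mono (by
    rwa [uIcc_of_le hpq.le, uIcc_of_le hab.le])
  have hwc : ContinuousOn w (Icc p q) := by
    have := hwac.continuousOn
    rwa [uIcc_of_le hpq.le] at this
  have hqlim : Tendsto w (𝓝[<] q) (𝓝 (w q)) :=
    (hwc q (right_mem_Icc.2 hpq.le)).mono_of_mem_nhdsWithin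
      (mem_of_superset (Ico_mem_nhdsLT hpq) Ico_subset_Icc_self)
  have hbound : ∀ t ∈ Icc p q, |w t| ≤ 4 * M / ε := by
    have hIco : ∀ t ∈ Ico p q, |w t| ≤ 4 * M / ε := fun t ht => by
      have e1 := hgb t (Ico_subset_Icc_self ht)
      have e2 := hhb t (Ico_subset_Icc_self ht)
      rw [hweq t ht]
      calc |g' t - h' t| ≤ |g' t| + |h' t| := abs_sub _ _
        _ ≤ 2 * M / ε + 2 * M / ε := add_le_add e1 e2
        _ = 4 * M / ε := by ring
    intro t ht
    rcases ht.2.eq_or_lt with rfl | hlt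
    · refine le_of_tendsto hqlim.abs ?_
      filter_upwards [Ico_mem_nhdsLT hpq] with x hx using hIco x hx
    · exact hIco t ⟨ht.1, hlt⟩
  set V : ℝ → ℝ := fun t => g' t + h' t with hV
  have hVm : MonotoneOn V (Icc p q) := hgm.add hhm
  have hwV : ∀ s ∈ Icc p q, ∀ t ∈ Icc p q, s ≤ t → |w t - w s| ≤ V t - V s := by
    have hIco : ∀ s ∈ Ico p q, ∀ t ∈ Ico p q, s ≤ t → |w t - w s| ≤ V t - V s := by
      intro s hs t ht hst
      have e1 := hgm (Ico_subset_Icc_self hs) (Ico_subset_Icc_self ht) hst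
      have e2 := hhm (Ico_subset_Icc_self hs) (Ico_subset_Icc_self ht) hst
      rw [hweq s hs, hweq t ht, abs_le]
      simp only [hV]
      constructor <;> linarith
    intro s hs t ht hst
    rcases hst.eq_or_lt with rfl | hlt
    · simp
    have hs' : s ∈ Ico p q := ⟨hs.1, hlt.trans_le ht.2⟩
    rcases ht.2.eq_or_lt with rfl | htq
    · refine le_of_tendsto (hqlim.sub_const (w s)).abs ?_
      filter_upwards [Ico_mem_nhdsLT hlt] with x hx
      have hx' : x ∈ Ico p q := ⟨hs.1.trans hx.1, hx.2⟩
      exact (hIco s hs' x hx' hx.1).trans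
        (sub_le_sub_right (hVm (Ico_subset_Icc_self hx') ht hx.2.le) _)
    · exact hIco s hs' t ⟨ht.1, htq⟩ hst
  refine ⟨fun t ht => hbound t (hsub ht), (lintegral_mono_set hsub).trans ?_⟩
  have hint : IntegrableOn (deriv w) (Icc p q) :=
    (intervalIntegrable_iff_integrableOn_Icc_of_le hpq.le).1 hwac.intervalIntegrable_deriv
  rw [← ofReal_integral_norm_eq_lintegral_enorm hint]
  refine ENNReal.ofReal_le_ofReal ?_
  have h1 := integral_abs_deriv_le hpq.le hVm hwac hwV
  rw [intervalIntegral.integral_of_le hpq.le, ← integral_Icc_eq_integral_Ioc] at h1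
  refine h1.trans ?_
  have hpI := left_mem_Icc.2 hpq.le
  have hqI := right_mem_Icc.2 hpq.le
  have e1 := abs_le.1 (hgb p hpI)
  have e2 := abs_le.1 (hgb q hqI)
  have e3 := abs_le.1 (hhb p hpI)
  have e4 := abs_le.1 (hhb q hqI)
  have : 8 * M / ε = 2 * M / ε + 2 * M / ε + 2 * M / ε + 2 * M / ε := by ring
  rw [this]
  simp only [hV]
  linarith

lemma ConvexOn.comp_prodMk {F : Type*} [AddCommGroup F] [Module ℝ F] {V : Set (ℝ × F)}
    {g : ℝ × F → ℝ} (hg : ConvexOn ℝ V g) {J : Set ℝ} (hJ : Convex ℝ J) {r : F}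
    (h : ∀ t ∈ J, (t, r) ∈ V) : ConvexOn ℝ J fun t => g (t, r) := by
  refine ⟨hJ, fun x hx y hy α β hα hβ hαβ => ?_⟩
  have h1 := hg.2 (h x hx) (h y hy) hα hβ hαβ
  have h2 : α • (x, r) + β • (y, r) = (α • x + β • y, r) := by
    rw [Prod.smul_mk, Prod.smul_mk, Prod.mk_add_mk, ← add_smul, hαβ, one_smul]
  rwa [h2] at h1

lemma IsLocallyDCOn.continuousOn {E : Type*} [AddCommGroup E] [Module ℝ E] [TopologicalSpace E]
    {U : Set E} (hU : IsOpen U) {f : E → ℝ} (hf : IsLocallyDCOn U f) : ContinuousOn f U := by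
  intro x hx
  obtain ⟨V, hV, -, g, h, -, hg, -, hh, hfgh⟩ := hf x hx
  rw [hU.nhdsWithin_eq hx] at hV
  have h1 := ((hg x (mem_of_mem_nhds hV)).continuousAt hV).sub
    ((hh x (mem_of_mem_nhds hV)).continuousAt hV)
  refine (h1.congr ?_).continuousWithinAt
  filter_upwards [hV] with y hy using (hfgh y hy).symm

/-- Uniform bounds, over a compact set of parameters, for the derivatives of a locally
difference-convex function which is sufficiently regular in the first variable. -/
theorem IsLocallyDCOn.exists_deriv_bound {k : ℕ} {U K : Set (ℝ × (Fin k → ℝ))} (hU : IsOpen U)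
    (hK : IsCompact K) (hKU : K ⊆ U) {f : ℝ × (Fin k → ℝ) → ℝ} (hf : IsLocallyDCOn U f) {a b : ℝ}
    (hab : a < b) :
    ∃ C : ℝ, 0 ≤ C ∧ ∀ (r : Fin k → ℝ) (w : ℝ → ℝ), (∀ t ∈ Icc a b, (t, r) ∈ K) →
      HasACDeriv a b (fun t => f (t, r)) w →
      (∀ t ∈ Icc a b, |w t| ≤ C) ∧ ∫ t in a..b, |deriv w t| ≤ C := by
  have key : ∃ C : ℝ, 0 ≤ C ∧ ∀ (r : Fin k → ℝ) (w : ℝ → ℝ),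
      HasACDeriv a b (fun t => f (t, r)) w →
      (∀ t ∈ Icc a b, (t, r) ∈ K → |w t| ≤ C) ∧
      ∫⁻ t in Icc a b ∩ {t | (t, r) ∈ K}, ‖deriv w t‖ₑ ≤ ENNReal.ofReal C := by
    refine hK.induction_on (p := fun S => ∃ C : ℝ, 0 ≤ C ∧ ∀ (r : Fin k → ℝ) (w : ℝ → ℝ),
      HasACDeriv a b (fun t => f (t, r)) w →
      (∀ t ∈ Icc a b, (t, r) ∈ S → |w t| ≤ C) ∧
      ∫⁻ t in Icc a b ∩ {t | (t, r) ∈ S}, ‖deriv w t‖ₑ ≤ ENNReal.ofReal C) ?_ ?_ ?_ ?_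
    · exact ⟨0, le_rfl, fun r w _ => by simp⟩
    · rintro S T hST ⟨C, hC, h⟩
      refine ⟨C, hC, fun r w hw => ⟨fun t ht hS => (h r w hw).1 t ht (hST hS),
        (lintegral_mono_set (inter_subset_inter_right _ fun t ht => ?_)).trans (h r w hw).2⟩⟩
      exact hST ht
    · rintro S T ⟨C, hC, h⟩ ⟨C', hC', h'⟩
      refine ⟨C + C', add_nonneg hC hC', fun r w hw => ⟨?_, ?_⟩⟩
      · rintro t ht (hS | hT)
        · linarith [(h r w hw).1 t ht hS]
        · linarith [(h' r w hw).1 t ht hT]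
      · rw [ENNReal.ofReal_add hC hC']
        refine le_trans ?_ ((lintegral_union_le _ _ _).trans
          (add_le_add (h r w hw).2 (h' r w hw).2))
        refine lintegral_mono_set ?_
        rintro t ⟨ht, hS | hT⟩
        · exact Or.inl ⟨ht, hS⟩
        · exact Or.inr ⟨ht, hT⟩
    · rintro ⟨c, r₀⟩ hx
      have hxU := hKU hx
      obtain ⟨V, hV, -, g, h, hgc, hg, hhc, hh, hfgh⟩ := hf _ hxU
      rw [hU.nhdsWithin_eq hxU] at hV
      set M : ℝ := max |g (c, r₀)| |h (c, r₀)| + 1 with hM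
      have hM0 : 0 ≤ M := by positivity
      have hgev : ∀ᶠ y in 𝓝 (c, r₀), |g y| < M :=
        ((hg _ (mem_of_mem_nhds hV)).continuousAt hV).abs.eventually
          (gt_mem_nhds (lt_add_of_le_of_pos (le_max_left _ _) one_pos))
      have hhev : ∀ᶠ y in 𝓝 (c, r₀), |h y| < M :=
        ((hh _ (mem_of_mem_nhds hV)).continuousAt hV).abs.eventually
          (gt_mem_nhds (lt_add_of_le_of_pos (le_max_right _ _) one_pos))
      obtain ⟨δ, hδ, hball⟩ := Metric.eventually_nhds_iff_ball.1 ((hgev.and hhev).and hV)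
      set ε := δ / 3 with hε
      have hε0 : 0 < ε := by positivity
      refine ⟨Metric.ball (c, r₀) ε, mem_nhdsWithin_of_mem_nhds (Metric.ball_mem_nhds _ hε0),
        8 * M / ε, by positivity, fun r w hw => ?_⟩
      have hmem : ∀ t, (t, r) ∈ Metric.ball (c, r₀) ε ↔
          t ∈ Ioo (c - ε) (c + ε) ∧ r ∈ Metric.ball r₀ ε := fun t => by
        rw [← ball_prod_same, mem_prod, Real.ball_eq_Ioo]
      by_cases hr : r ∈ Metric.ball r₀ ε
      · have hin : ∀ t ∈ Ioo (c - 3 * ε) (c + 3 * ε), (t, r) ∈ Metric.ball (c, r₀) δ := by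
          intro t ht
          rw [← ball_prod_same, mem_prod, Real.ball_eq_Ioo]
          have : δ = 3 * ε := by rw [hε]; ring
          rw [this]
          exact ⟨ht, Metric.ball_subset_ball (by linarith) hr⟩
        have hset : Icc a b ∩ {t | (t, r) ∈ Metric.ball (c, r₀) ε}
            = Icc a b ∩ Ioo (c - ε) (c + ε) := by
          ext t
          simp only [mem_inter_iff, mem_ofPred_eq, hmem, hr, and_true]
        obtain ⟨h1, h2⟩ := exists_deriv_bound_of_convexOn_sub (c := c) (M := M) hε0 hab
          (hgc.comp_prodMk (convex_Ioo _ _) fun t ht => (hball _ (hin t ht)).2)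
          (hhc.comp_prodMk (convex_Ioo _ _) fun t ht => (hball _ (hin t ht)).2)
          (fun t ht => (hball _ (hin t ht)).1.1.le) (fun t ht => (hball _ (hin t ht)).1.2.le)
          (fun t ht => hfgh _ (hball _ (hin t ht)).2) hw.hasDeriv hw.ac
        rw [hset]
        refine ⟨fun t ht hS => (h1 t ⟨ht, ((hmem t).1 hS).1⟩).trans ?_, h2⟩
        exact div_le_div_of_nonneg_right (by linarith) hε0.le
      · refine ⟨fun t ht hS => absurd ((hmem t).1 hS).2 hr, ?_⟩
        have hset : Icc a b ∩ {t | (t, r) ∈ Metric.ball (c, r₀) ε} = ∅ := by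
          ext t
          simp only [mem_inter_iff, mem_ofPred_eq, hmem, hr, and_false, mem_empty_iff_false]
        rw [hset]
        simp
  obtain ⟨C, hC, h⟩ := key
  refine ⟨C, hC, fun r w hr hw => ⟨fun t ht => (h r w hw).1 t ht (hr t ht), ?_⟩⟩
  have h2 := (h r w hw).2
  rw [inter_eq_left.2 (show Icc a b ⊆ {t | (t, r) ∈ K} from hr)] at h2
  have hint : IntegrableOn (deriv w) (Icc a b) :=
    (intervalIntegrable_iff_integrableOn_Icc_of_le hab.le).1 hw.ac.intervalIntegrable_deriv
  rw [← ofReal_integral_norm_eq_lintegral_enorm hint, ENNReal.ofReal_le_ofReal_iff hC] at h2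
  rw [intervalIntegral.integral_of_le hab.le, ← integral_Icc_eq_integral_Ioc]
  exact h2

end DifferenceConvex

section Uniform

open Filter

variable {m n : ℕ}

/-- Singular values of a continuous family of matrices of full rank are bounded below on compact
sets. -/
lemma exists_singularValue_lower_bound {X : Type*} [TopologicalSpace X] {K : Set X}
    (hK : IsCompact K) {A : X → Matrix (Fin m) (Fin n) ℂ}
    (hA : ∀ i j, ContinuousOn (fun p => A p i j) K) (hrank : ∀ p ∈ K, (A p).rank = min m n) :
    ∃ c₀ > 0, ∀ p ∈ K, ∀ s, IsSingularValueTuple (A p) s → ∀ j, c₀ ≤ s j := by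
  rcases K.eq_empty_or_nonempty with rfl | hne
  · exact ⟨1, one_pos, fun p hp => hp.elim⟩
  rcases Nat.eq_zero_or_pos (min m n) with h0 | hpos
  · exact ⟨1, one_pos, fun p _ s _ j => absurd j.isLt (by omega)⟩
  set k : Fin n := ⟨min m n - 1, by omega⟩ with hk
  have hc : ContinuousOn (fun p => sortedEig ((A p).conjTranspose * A p) k) K := by
    refine continuousOn_sortedEig (fun i j => ?_)
      (fun p _ => Matrix.isHermitian_conjTranspose_mul_self (A p)) k
    simp only [Matrix.mul_apply, Matrix.conjTranspose_apply]
    exact continuousOn_finsetSum _ fun l _ => (hA l i).star.mul (hA l j)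
  obtain ⟨p₀, hp₀, hmin⟩ := hK.exists_isMinOn hne hc
  have hk' : (k : ℕ) < min m n := by simp only [hk]; omega
  refine ⟨_, Real.sqrt_pos.2 ((sortedEig_gram_pos_iff (hrank p₀ hp₀) k).2 hk'),
    fun p hp s hs j => ?_⟩
  obtain ⟨π, hπ⟩ := hs
  have hlt := (π j).isLt
  have h1 : sortedEig ((A p₀).conjTranspose * A p₀) k ≤ s j ^ 2 := by
    rw [hπ, ← sortedEig_gram (A p) ⟨π j, by omega⟩]
    refine (hmin hp).trans (sortedEig_antitone _ ?_)
    rw [Fin.le_def]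
    simp only [hk]
    omega
  refine Real.sqrt_le_iff.2 ⟨?_, h1⟩
  rw [hπ]
  exact LinearMap.singularValues_nonneg _ _

lemma continuousOn_of_isLocallyDCOn {E : Type*} [AddCommGroup E] [Module ℝ E] [TopologicalSpace E]
    {U : Set E} (hU : IsOpen U) {f : E → ℂ} (hre : IsLocallyDCOn U fun p => (f p).re)
    (him : IsLocallyDCOn U fun p => (f p).im) : ContinuousOn f U := by
  have h := (Complex.continuous_ofReal.comp_continuousOn (hre.continuousOn hU)).add
    ((Complex.continuous_ofReal.comp_continuousOn (him.continuousOn hU)).mul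
      (continuousOn_const (c := Complex.I)))
  exact h.congr fun p _ => (Complex.re_add_im (f p)).symm

/-- Uniform bounds for a family of matrices which is locally difference-convex and regular in the
first variable. -/
lemma exists_uniform_matrixCurve {k : ℕ} {a b : ℝ} (hab : a < b) {U : Set (ℝ × (Fin k → ℝ))}
    (hU : IsOpen U) {R : Set (Fin k → ℝ)} (hR : IsCompact R) (hRU : Icc a b ×ˢ R ⊆ U)
    {A : ℝ × (Fin k → ℝ) → Matrix (Fin m) (Fin n) ℂ}
    (hA : ∀ i j, IsLocallyDCOn U (fun p => (A p i j).re) ∧ IsLocallyDCOn U fun p => (A p i j).im)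
    (hreg : ∀ r ∈ R, ∀ i j, ContDiffOn ℝ 1 (fun t => A (t, r) i j) (Icc a b) ∧
      MemW21 (Ioo a b) fun t => A (t, r) i j) :
    ∃ M L Γ : ℝ, ∀ r ∈ R, ∃ (A' : ℝ → Matrix (Fin m) (Fin n) ℂ) (G : ℝ → ℝ),
      IsMatrixCurve a b M L (fun t => A (t, r)) A' G ∧ G b - G a ≤ Γ := by
  have hK : IsCompact (Icc a b ×ˢ R) := isCompact_Icc.prod hR
  have hAc : ∀ i j, ContinuousOn (fun p => A p i j) (Icc a b ×ˢ R) := fun i j =>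
    (continuousOn_of_isLocallyDCOn hU (hA i j).1 (hA i j).2).mono hRU
  obtain ⟨M, hM⟩ := hK.exists_bound_of_continuousOn (f := fun p => entrySum (A p))
    (continuousOn_finsetSum _ fun i _ => continuousOn_finsetSum _ fun j _ => (hAc i j).norm)
  choose C₁ hC₁ h₁ using fun i j => (hA i j).1.exists_deriv_bound hU hK hRU hab
  choose C₂ hC₂ h₂ using fun i j => (hA i j).2.exists_deriv_bound hU hK hRU hab
  refine ⟨M, ∑ i, ∑ j, (C₁ i j + C₂ i j), ∑ i, ∑ j, (C₁ i j + C₂ i j), fun r hr => ?_⟩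
  set A' : ℝ → Matrix (Fin m) (Fin n) ℂ := fun t => Matrix.of fun i j =>
    derivWithin (fun t => A (t, r) i j) (Icc a b) t with hA'
  have hac : ∀ i j, HasACDeriv a b (fun t => A (t, r) i j) fun t => A' t i j := fun i j =>
    hasACDeriv_of_memW21 hab (hreg r hr i j).1 (hreg r hr i j).2
  have hmem : ∀ t ∈ Icc a b, (t, r) ∈ Icc a b ×ˢ R := fun t ht => ⟨ht, hr⟩
  have hre := fun i j => h₁ i j r _ hmem (hac i j).re
  have him := fun i j => h₂ i j r _ hmem (hac i j).im
  refine ⟨A', _, isMatrixCurve_of_hasACDeriv hab.le hac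
    (fun t ht => (le_abs_self _).trans (hM _ (hmem t ht))) fun t ht => ?_, ?_⟩
  · refine Finset.sum_le_sum fun i _ => Finset.sum_le_sum fun j _ => ?_
    exact (Complex.norm_le_abs_re_add_abs_im _).trans
      (add_le_add ((hre i j).1 t ht) ((him i j).1 t ht))
  · rw [intervalIntegral.integral_same, sub_zero]
    have hi₁ := fun i j => (hac i j).re.ac.intervalIntegrable_deriv.abs
    have hi₂ := fun i j => (hac i j).im.ac.intervalIntegrable_deriv.abs
    unfold entryVariation
    rw [intervalIntegral.integral_finsetSum fun i _ => IntervalIntegrable.finsetSum_fun _ fun j _ =>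
      (hi₁ i j).add (hi₂ i j)]
    refine Finset.sum_le_sum fun i _ => ?_
    rw [intervalIntegral.integral_finsetSum fun j _ => (hi₁ i j).add (hi₂ i j)]
    refine Finset.sum_le_sum fun j _ => ?_
    rw [intervalIntegral.integral_add (hi₁ i j) (hi₂ i j)]
    exact add_le_add (hre i j).2 (him i j).2

lemma norm_le_mul_of_forall_abs_le {d : ℕ} {x : EuclideanSpace ℝ (Fin d)} {C : ℝ}
    (h : ∀ j, |x j| ≤ C) : ‖x‖ ≤ d * C := by
  have h1 : x = ∑ j, EuclideanSpace.single j (x j) := by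
    ext i; simp [Finset.sum_apply, Pi.single_apply]
  rw [h1]
  refine (norm_sum_le _ _).trans ((Finset.sum_le_sum fun j _ => ?_).trans_eq
    (show ∑ _j : Fin d, C = d * C by simp))
  simpa using h j

lemma lintegral_enorm_le_of_forall {d : ℕ} {a b C : ℝ} {u : ℝ → EuclideanSpace ℝ (Fin d)}
    (hu : IntegrableOn u (Ioo a b)) (h : ∀ j, ∫ t in Ioo a b, |u t j| ≤ C) :
    ∫⁻ t in Ioo a b, ‖u t‖ₑ ≤ ENNReal.ofReal (d * C) := by
  refine (lintegral_enorm_le_sum hu).trans (ENNReal.ofReal_le_ofReal ?_)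
  exact (Finset.sum_le_sum fun j _ => h j).trans_eq (by simp)

theorem w21Norm_le_of_bounds {d : ℕ} {a b C : ℝ} (hab : a < b) (hC : 0 ≤ C)
    {u : ℝ → EuclideanSpace ℝ (Fin d)} (hu : ContDiffOn ℝ 1 u (Icc a b))
    (hac : ∀ j, AbsolutelyContinuousOnInterval (fun t => derivWithin u (Icc a b) t j) a b)
    (h₀ : ∀ j, ∀ t ∈ Icc a b, |u t j| ≤ C)
    (h₁ : ∀ j, ∀ t ∈ Icc a b, |derivWithin u (Icc a b) t j| ≤ C)
    (h₂ : ∀ j, ∫ t in a..b, |deriv (fun t => derivWithin u (Icc a b) t j) t| ≤ C) :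
    w21Norm (Ioo a b) u ≤ ENNReal.ofReal (d * (C * (b - a)) + d * (C * (b - a)) + d * C) := by
  set v : ℝ → EuclideanSpace ℝ (Fin d) := derivWithin u (Icc a b) with hv
  set w : ℝ → EuclideanSpace ℝ (Fin d) := fun t => WithLp.toLp 2 fun j => deriv (fun t => v t j) t
    with hw
  have hd : ∀ j, ∀ t ∈ Icc a b, HasDerivWithinAt (fun t => u t j) (v t j) (Icc a b) t :=
    fun j t ht => ((EuclideanSpace.proj (𝕜 := ℝ) j).hasFDerivAt (x := u t)).comp_hasDerivWithinAt t
      ((hu.differentiableOn (by simp) t ht).hasDerivWithinAt)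
  obtain ⟨huv, hui, hvi⟩ := isWeakDerivOn_of_absolutelyContinuous (u := u) (v := v) hab.le
    (fun j => ContDiffOn.absolutelyContinuousOnInterval (by
      rw [uIcc_of_le hab.le]; exact contDiffOn_euclidean.1 hu j))
    fun j t ht => ((hd j t (Ioo_subset_Icc_self ht)).hasDerivAt (Icc_mem_nhds ht.1 ht.2)).deriv.symm
  obtain ⟨hvw, -, hwi⟩ := isWeakDerivOn_of_absolutelyContinuous (u := v) (v := w) hab.le hac
    fun j t _ => rfl
  have hbd : ∀ {f : ℝ → ℝ}, (∀ t ∈ Icc a b, |f t| ≤ C) → ∫ t in Ioo a b, |f t| ≤ C * (b - a) := by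
    intro f hf
    rw [← integral_Ioc_eq_integral_Ioo, ← intervalIntegral.integral_of_le hab.le]
    refine (le_abs_self _).trans ?_
    have := intervalIntegral.norm_integral_le_of_norm_le_const (a := a) (b := b) (C := C)
      (f := fun t => |f t|) fun t ht => by
        rw [uIoc_of_le hab.le] at ht
        simpa using hf t (Ioc_subset_Icc_self ht)
    rwa [abs_of_pos (sub_pos.2 hab)] at this
  have hb0 : 0 ≤ b - a := (sub_pos.2 hab).le
  rw [ENNReal.ofReal_add (by positivity) (by positivity),
    ENNReal.ofReal_add (by positivity) (by positivity)]
  refine (w21Norm_le huv hvw).trans (add_le_add (add_le_add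
    (lintegral_enorm_le_of_forall hui fun j => hbd (h₀ j))
    (lintegral_enorm_le_of_forall hvi fun j => hbd (h₁ j)))
    (lintegral_enorm_le_of_forall hwi fun j => ?_))
  rw [← integral_Ioc_eq_integral_Ioo, ← intervalIntegral.integral_of_le hab.le]
  exact h₂ j

/-- Uniform bounds for `C¹` systems of singular values. -/
theorem exists_uniform_singularValue_bound {k : ℕ} {a b : ℝ} (hab : a < b)
    {U : Set (ℝ × (Fin k → ℝ))} (hU : IsOpen U) {R : Set (Fin k → ℝ)} (hR : IsCompact R)
    (hRU : Icc a b ×ˢ R ⊆ U) {A : ℝ × (Fin k → ℝ) → Matrix (Fin m) (Fin n) ℂ}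
    (hA : ∀ i j, IsLocallyDCOn U (fun p => (A p i j).re) ∧ IsLocallyDCOn U fun p => (A p i j).im)
    (hreg : ∀ r ∈ R, ∀ i j, ContDiffOn ℝ 1 (fun t => A (t, r) i j) (Icc a b) ∧
      MemW21 (Ioo a b) fun t => A (t, r) i j)
    (hrank : ∀ t ∈ Icc a b, ∀ r ∈ R, (A (t, r)).rank = min m n) :
    ∃ C : ℝ, 0 ≤ C ∧ ∀ r ∈ R, ∀ σ : ℝ → EuclideanSpace ℝ (Fin (min m n)),
      (∀ t ∈ Icc a b, IsSingularValueTuple (A (t, r)) (σ t)) → ContDiffOn ℝ 1 σ (Icc a b) →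
      (∀ t ∈ Icc a b, ‖σ t‖ ≤ C ∧ ‖derivWithin σ (Icc a b) t‖ ≤ C) ∧
      w21Norm (Ioo a b) σ ≤ ENNReal.ofReal C := by
  obtain ⟨M, L, Γ, hcurve⟩ := exists_uniform_matrixCurve hab hU hR hRU hA hreg
  have hAc : ∀ i j, ContinuousOn (fun p => A p i j) (Icc a b ×ˢ R) := fun i j =>
    (continuousOn_of_isLocallyDCOn hU (hA i j).1 (hA i j).2).mono hRU
  obtain ⟨c₀, hc₀, hlow⟩ := exists_singularValue_lower_bound (isCompact_Icc.prod hR) hAc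
    fun p hp => hrank p.1 hp.1 p.2 hp.2
  obtain ⟨C, hC, hbound⟩ := exists_singularValue_regularity_bound m n M L Γ hab hc₀
  have hba : 0 ≤ b - a := (sub_pos.2 hab).le
  refine ⟨(min m n : ℕ) * (C * (b - a)) + (min m n : ℕ) * (C * (b - a)) + (min m n : ℕ) * C,
    by positivity, fun r hr σ hσ hσc => ?_⟩
  obtain ⟨A', G, hAG, hG⟩ := hcurve r hr
  have h := hbound _ A' G σ (derivWithin σ (Icc a b)) hAG hG hσ
    (fun j t ht => ((EuclideanSpace.proj (𝕜 := ℝ) j).hasFDerivAt (x := σ t)).comp_hasDerivWithinAt t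
      ((hσc.differentiableOn (by simp) t ht).hasDerivWithinAt))
    (fun j => (EuclideanSpace.proj (𝕜 := ℝ) j).continuous.comp_continuousOn
      (hσc.continuousOn_derivWithin (uniqueDiffOn_Icc hab) le_rfl))
    (fun j t ht => hlow (t, r) ⟨ht, hr⟩ _ (hσ t ht) j)
  refine ⟨fun t ht => ?_, w21Norm_le_of_bounds hab hC hσc (fun j => (h j).1)
    (fun j => (h j).2.1) (fun j => (h j).2.2.1) fun j => (h j).2.2.2⟩
  have hle : (min m n : ℕ) * C ≤ (min m n : ℕ) * (C * (b - a)) + (min m n : ℕ) * (C * (b - a))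
      + (min m n : ℕ) * C := le_add_of_nonneg_left (by positivity)
  exact ⟨(norm_le_mul_of_forall_abs_le fun j => (h j).2.1 t ht).trans hle,
    (norm_le_mul_of_forall_abs_le fun j => (h j).2.2.1 t ht).trans hle⟩

end Uniform

theorem mainTheorem3 (m n : ℕ) :
    -- existence of a system of singular values of class `C¹ ∩ DC ∩ W^{2,1}_loc`
    (∀ A : ℝ → Matrix (Fin m) (Fin n) ℂ,
      (∀ i j, ContDiff ℝ 1 (fun t => A t i j)) →
      (∀ i j, IsDCOn univ (fun t => (A t i j).re) ∧ IsDCOn univ (fun t => (A t i j).im)) →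
      (∀ i j, MemW21Loc univ (fun t => A t i j)) →
      (∀ t, (A t).rank = min m n) →
      ∃ σ : ℝ → EuclideanSpace ℝ (Fin (min m n)),
        (∀ t, IsSingularValueTuple (A t) (σ t)) ∧
        ContDiff ℝ 1 σ ∧ (∀ j, IsDCOn univ (fun t => σ t j)) ∧ MemW21Loc univ σ) ∧
    -- uniformity in parameters
    (∀ (k : ℕ) (a b : ℝ), a < b →
      ∀ U : Set (ℝ × (Fin k → ℝ)), IsOpen U →
      Icc a b ×ˢ univ.pi (fun _ : Fin k => Icc a b) ⊆ U →
      ∀ A : ℝ × (Fin k → ℝ) → Matrix (Fin m) (Fin n) ℂ,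
      (∀ i j, IsLocallyDCOn U (fun p => (A p i j).re) ∧
        IsLocallyDCOn U (fun p => (A p i j).im)) →
      (∀ r ∈ univ.pi (fun _ : Fin k => Icc a b), ∀ i j,
        ContDiffOn ℝ 1 (fun t => A (t, r) i j) (Icc a b) ∧
        MemW21 (Ioo a b) (fun t => A (t, r) i j)) →
      (∀ t ∈ Icc a b, ∀ r ∈ univ.pi (fun _ : Fin k => Icc a b), (A (t, r)).rank = min m n) →
      ∀ σ : (Fin k → ℝ) → ℝ → EuclideanSpace ℝ (Fin (min m n)),
      (∀ r ∈ univ.pi (fun _ : Fin k => Icc a b),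
        (∀ t ∈ Icc a b, IsSingularValueTuple (A (t, r)) (σ r t)) ∧
        ContDiffOn ℝ 1 (σ r) (Icc a b)) →
      (∃ C : ℝ, ∀ r ∈ univ.pi (fun _ : Fin k => Icc a b), ∀ t ∈ Icc a b,
        ‖σ r t‖ ≤ C ∧ ‖derivWithin (σ r) (Icc a b) t‖ ≤ C) ∧
      ∃ μ : (Fin k → ℝ) → ℝ, (∀ r, 0 ≤ μ r) ∧
        IntegrableOn μ (univ.pi (fun _ : Fin k => Ioo a b)) ∧
        ∀ᵐ r ∂(volume.restrict (univ.pi (fun _ : Fin k => Ioo a b))),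
          w21Norm (Ioo a b) (σ r) ≤ ENNReal.ofReal (μ r)) := by
  refine ⟨fun A hA _ hw hrank => exists_regular_singularValue_system hA hw hrank, ?_⟩
  intro k a b hab U hU hsub A hA hreg hrank σ hσ
  obtain ⟨C, hC, h⟩ := exists_uniform_singularValue_bound hab hU
    (isCompact_univ_pi fun _ => isCompact_Icc) hsub hA hreg hrank
  refine ⟨⟨C, fun r hr => (h r hr (σ r) (hσ r hr).1 (hσ r hr).2).1⟩, fun _ => C, fun _ => hC,
    ?_, ?_⟩
  · refine integrableOn_const (lt_of_le_of_lt (measure_mono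
      (pi_mono fun _ _ => Ioo_subset_Icc_self))
      (isCompact_univ_pi fun _ => isCompact_Icc).measure_lt_top).ne
  · refine (ae_restrict_iff' (MeasurableSet.univ_pi fun _ => measurableSet_Ioo)).2
      (ae_of_all _ fun r hr => ?_)
    have hr' : r ∈ univ.pi fun _ : Fin k => Icc a b := pi_mono (fun _ _ => Ioo_subset_Icc_self) hr
    exact (h r hr' (σ r) (hσ r hr').1 (hσ r hr').2).2
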